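/- Let $\mathbb K=\mathbb R$ or $\mathbb C$, let $G$ be a finite-dimensional (real or complex) Lie group whose Lie algebra $\mathfrak g$ is semisimple over $\mathbb K$, let $k\ge 1$, and let $\mathfrak g=\mathfrak g_{-k}\oplus\dots\oplus\mathfrak g_k$ be a $|k|$-grading: a vector space decomposition with $[\mathfrak g_i,\mathfrak g_j]\subset\mathfrak g_{i+j}$ (where $\mathfrak g_\ell=0$ for $|\ell|>k$) such that the subalgebra $\mathfrak g_-=\mathfrak g_{-k}\oplus\dots\oplus\mathfrak g_{-1}$ is generated by $\mathfrak g_{-1}$. Put $\mathfrak g^i=\mathfrak g_i\oplus\dots\oplus\mathfrak g_k$ and $P=\{g\in G:\operatorname{Ad}(g)(\mathfrak g^i)\subset\mathfrak g^i\ \text{for all } i\}$. For a smooth subbundle $H\subset TM$ of the tangent bundle of a manifold $M$, put $T^0M=0$, $T^{-1}M=H$, and for $n\ge1$ let $T^{-n-1}M$ be pointwise spanned by $T^{-n}M$ and the values of the Lie brackets $[\xi,\eta]$ of local sections $\xi$ of $T^{-n}M$ and $\eta$ of $H$. If all $T^{-n}M$ are smooth subbundles and $T^{-k}M=TM$, the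 symbol algebra of $H$ at $x$ is $\operatorname{gr}(T_xM)=\bigoplus_{n\ge1}T^{-n}_xM/T^{-n+1}_xM$, with $T^{-n}_xM/T^{-n+1}_xM$ in degree $-n$, and with the bracket induced by the Lie bracket of local sections of the bundles $T^{-n}M$. Then the following holds. (In the case $\mathbb K=\mathbb C$, "smooth" means holomorphic, and ranks and dimensions are complex.) 1. The space $G/P$ is Hausdorff, and it carries a structure of smooth manifold of dimension $\dim\mathfrak g_-$, compatible with the quotient topology, for which the projection $p:G\to G/P$ is a smooth submersion. 2. For the manifold structure on $G/P$ with these properties, the formula $$H_{gP}=T_gp\bigl(\{L_X(g):X\in\mathfrak g^{-1}\}\bigr),$$ where $L_X$ is the left-invariant vector field generated by $X$, gives a well-defined smooth subbundle $H\subset T(G/P)$ of rank $\dim\mathfrak g_{-1}$. It is bracket generating: local sections of $H$ together with their iterated Lie brackets span every tangent space. All the $T^{-n}(G/P)$ are smooth subbundles, $T^{-k}(G/P)=T(G/P)$, the bracket of the symbol algebra is well defined at each point, and the bundle $\operatorname{gr}(T(G/P))$ of symbol algebras is locally trivial as a bundle of graded Lie algebras, with modelling algebra $\mathfrak g_-=\mathfrak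 g_{-k}\oplus\dots\oplus\mathfrak g_{-1}$. 3. For every $g\in G$ the left translation $\ell_g:G/P\to G/P$ is smooth and satisfies $T_x\ell_g(H_x)=H_{gx}$ for all $x\in G/P$. -/

import Mathlib

open scoped Manifold ContDiff Topology

noncomputable section

/-! ### Distributions on a manifold and their symbol algebras -/

section Distributions

variable {𝕜 : Type*} [NontriviallyNormedField 𝕜]
  {E : Type*} [NormedAddCommGroup E] [NormedSpace 𝕜 E]
  {H : Type*} [TopologicalSpace H] (I : ModelWithCorners 𝕜 E H)
  {M : Type*} [TopologicalSpace M] [ChartedSpace H M]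

/-- A (not necessarily smooth) field of tangent subspaces on `M`. -/
abbrev TangentSubspaces (M : Type*) [TopologicalSpace M] [ChartedSpace H M] : Type _ :=
  ∀ x : M, Submodule 𝕜 (TangentSpace I x)

variable {I} [IsManifold I 1 M]

/-- `ξ` restricts to a smooth section of `D` over the set `U`. -/
def IsSectionOn (D : TangentSubspaces I M) (U : Set M) (ξ : ∀ x : M, TangentSpace I x) : Prop :=
  ContMDiffOn I I.tangent ∞ (fun y => (⟨y, ξ y⟩ : TangentBundle I M)) U ∧ ∀ y ∈ U, ξ y ∈ D y

/-- `D` is a smooth subbundle of rank `r` of the tangent bundle: locally it has a frame made of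
`r` smooth sections. -/
def IsSmoothSubbundle (D : TangentSubspaces I M) (r : ℕ) : Prop :=
  ∀ x : M, ∃ U : Set M, IsOpen U ∧ x ∈ U ∧
    ∃ s : Fin r → ∀ y : M, TangentSpace I y, (∀ i, IsSectionOn D U (s i)) ∧
      ∀ y ∈ U, LinearIndependent 𝕜 (fun i => s i y) ∧
        Submodule.span 𝕜 (Set.range fun i => s i y) = D y

/-- The vector fields obtained from sections of `D` over `U` by iterated Lie brackets. -/
inductive IsIteratedBracket (D : TangentSubspaces I M) (U : Set M) :
    (∀ x : M, TangentSpace I x) → Prop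
  | of_section (ξ : ∀ x : M, TangentSpace I x) (hξ : IsSectionOn D U ξ) : IsIteratedBracket D U ξ
  | bracket (ξ η : ∀ x : M, TangentSpace I x) (hξ : IsIteratedBracket D U ξ)
      (hη : IsIteratedBracket D U η) : IsIteratedBracket D U (VectorField.mlieBracket I ξ η)

/-- `D` is bracket generating: (local) sections of `D` together with their iterated Lie brackets
span every tangent space. -/
def IsBracketGenerating (D : TangentSubspaces I M) : Prop :=
  ∀ x : M, Submodule.span 𝕜 {v : TangentSpace I x | ∃ U : Set M, IsOpen U ∧ x ∈ U ∧
    ∃ ξ : ∀ y : M, TangentSpace I y, IsIteratedBracket D U ξ ∧ v = ξ x} = ⊤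

/-- The filtration of the tangent bundle determined by `D`; `symbolFiltration D n` is `T⁻ⁿM`.
Thus `T⁰M = 0`, `T⁻¹M = D`, and `T⁻ⁿ⁻¹M` is spanned by the sections of `T⁻ⁿM` together with the
Lie brackets of one section of `T⁻ⁿM` and one section of `T⁻¹M`. -/
def symbolFiltration (D : TangentSubspaces I M) : ℕ → TangentSubspaces I M
  | 0 => fun _ => ⊥
  | 1 => D
  | n + 2 => fun x => symbolFiltration D (n + 1) x ⊔
      Submodule.span 𝕜 {v : TangentSpace I x | ∃ U : Set M, IsOpen U ∧ x ∈ U ∧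
        ∃ ξ η : ∀ y : M, TangentSpace I y, IsSectionOn (symbolFiltration D (n + 1)) U ξ ∧
          IsSectionOn D U η ∧ v = VectorField.mlieBracket I ξ η x}

/-- All the `T⁻ⁿM` are smooth subbundles, and `T⁻ᵏM = TM`. -/
def IsRegularOfDepth (D : TangentSubspaces I M) (k : ℕ) : Prop :=
  (∀ n, ∃ r, IsSmoothSubbundle (symbolFiltration D n) r) ∧ ∀ x, symbolFiltration D k x = ⊤

/-- The component `T⁻ⁿₓM / T⁻ⁿ⁺¹ₓM` of degree `-n` of the associated graded of `TₓM`. (It is zero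
for `n = 0`.) -/
abbrev SymbolGr (D : TangentSubspaces I M) (n : ℕ) (x : M) : Type _ :=
  ↥(symbolFiltration D n x) ⧸
    (symbolFiltration D (n - 1) x).submoduleOf (symbolFiltration D n x)

/-- The class of an element of `T⁻ⁿₓM` in the associated graded. -/
def symbolClass (D : TangentSubspaces I M) (n : ℕ) (x : M) (v : TangentSpace I x)
    (hv : v ∈ symbolFiltration D n x) : SymbolGr D n x :=
  Submodule.Quotient.mk ⟨v, hv⟩

/-- `B` is the bracket of the symbol algebra of `D` at `x`: the family of bilinear maps
`gr₋ᵢ × gr₋ⱼ → gr₋₍ᵢ₊ⱼ₎` which is induced by the Lie bracket of sections of `T⁻ⁱM` and `T⁻ʲM`. -/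
def IsSymbolBracket (D : TangentSubspaces I M) (x : M)
    (B : ∀ i j : ℕ, SymbolGr D i x →ₗ[𝕜] SymbolGr D j x →ₗ[𝕜] SymbolGr D (i + j) x) : Prop :=
  ∀ (i j : ℕ) (U : Set M) (_ : IsOpen U) (hx : x ∈ U) (ξ η : ∀ y : M, TangentSpace I y)
    (hξ : IsSectionOn (symbolFiltration D i) U ξ) (hη : IsSectionOn (symbolFiltration D j) U η),
    ∃ h : VectorField.mlieBracket I ξ η x ∈ symbolFiltration D (i + j) x,
      B i j (symbolClass D i x (ξ x) (hξ.2 x hx)) (symbolClass D j x (η x) (hη.2 x hx)) =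
        symbolClass D (i + j) x (VectorField.mlieBracket I ξ η x) h

/-- The bundle `gr(TM)` of symbol algebras of `D` is locally trivial as a bundle of graded Lie
algebras, with modelling algebra the graded Lie algebra `L = ⨁ₙ 𝔫 n`, where `𝔫 n` is the component
of degree `-n`. That is, over a neighbourhood `U` of any given point there are linear isomorphisms
`φ n y : 𝔫 n ≃ gr₋ₙ(T_yM)` which depend smoothly on `y` (each `y ↦ φ n y a` is the class of a
smooth section of `T⁻ⁿM`) and which, for every `y`, carry the bracket of `L` to the bracket of the
symbol algebra at `y`. -/
def HasLocallyTrivialSymbol (D : TangentSubspaces I M) {L : Type*} [LieRing L] [LieAlgebra 𝕜 L]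
    (𝔫 : ℕ → Submodule 𝕜 L) : Prop :=
  ∀ x : M, ∃ U : Set M, IsOpen U ∧ x ∈ U ∧
    ∃ φ : ∀ (n : ℕ) (y : U), 𝔫 n ≃ₗ[𝕜] SymbolGr D n (y : M),
      (∀ (n : ℕ) (a : 𝔫 n), ∃ (ξ : ∀ y : M, TangentSpace I y)
        (hξ : IsSectionOn (symbolFiltration D n) U ξ),
        ∀ y : U, φ n y a = symbolClass D n y (ξ y) (hξ.2 y y.2)) ∧
      ∀ y : U, ∃ B : ∀ i j : ℕ,
        SymbolGr D i (y : M) →ₗ[𝕜] SymbolGr D j (y : M) →ₗ[𝕜] SymbolGr D (i + j) (y : M),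
        IsSymbolBracket D (y : M) B ∧
        ∀ (i j : ℕ) (a : 𝔫 i) (b : 𝔫 j), ∃ h : ⁅(a : L), (b : L)⁆ ∈ 𝔫 (i + j),
          φ (i + j) y ⟨⁅(a : L), (b : L)⁆, h⟩ = B i j (φ i y a) (φ j y b)

end Distributions

/-! ### `|k|`-gradings -/

/-- A `|k|`-grading `L = L₋ₖ ⊕ ⋯ ⊕ Lₖ` of a Lie algebra: it is compatible with the bracket, and the
subalgebra `L₋ = L₋ₖ ⊕ ⋯ ⊕ L₋₁` is generated by `L₋₁`. -/
structure KGrading (𝕜 : Type*) [Field 𝕜] (L : Type*) [LieRing L] [LieAlgebra 𝕜 L] (k : ℕ) where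
  /-- the component of degree `i` -/
  comp : ℤ → Submodule 𝕜 L
  isInternal : DirectSum.IsInternal comp
  comp_eq_bot : ∀ i : ℤ, (k : ℤ) < |i| → comp i = ⊥
  lie_mem : ∀ (i j : ℤ) (x y : L), x ∈ comp i → y ∈ comp j → ⁅x, y⁆ ∈ comp (i + j)
  generated : (LieSubalgebra.lieSpan 𝕜 L (comp (-1) : Set L)).toSubmodule =
    ⨆ (i : ℤ) (_ : i < 0), comp i

namespace KGrading

variable {𝕜 : Type*} [Field 𝕜] {L : Type*} [LieRing L] [LieAlgebra 𝕜 L] {k : ℕ}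
  (𝔤 : KGrading 𝕜 L k)

/-- The filtration component `Lⁱ = Lᵢ ⊕ ⋯ ⊕ Lₖ`. -/
def filt (i : ℤ) : Submodule 𝕜 L := ⨆ (j : ℤ) (_ : i ≤ j), 𝔤.comp j

/-- The subalgebra `L₋ = L₋ₖ ⊕ ⋯ ⊕ L₋₁`. -/
def neg : LieSubalgebra 𝕜 L where
  toSubmodule := ⨆ (i : ℤ) (_ : i < 0), 𝔤.comp i
  lie_mem' {x y} hx hy := by
    change x ∈ ⨆ (i : ℤ) (_ : i < 0), 𝔤.comp i at hx
    change y ∈ ⨆ (i : ℤ) (_ : i < 0), 𝔤.comp i at hy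
    change ⁅x, y⁆ ∈ ⨆ (i : ℤ) (_ : i < 0), 𝔤.comp i
    rw [← 𝔤.generated] at hx hy ⊢
    exact LieSubalgebra.lie_mem _ hx hy

/-- The component of degree `-n` of the graded Lie algebra `L₋`. -/
def negComp (n : ℕ) : Submodule 𝕜 𝔤.neg :=
  (𝔤.comp (-(n : ℤ))).comap 𝔤.neg.toSubmodule.subtype

end KGrading

/-! ### The generalized flag manifold -/

section LieGroups

variable {𝕜 : Type*} [RCLike 𝕜]

/-- Makes the Lie algebra structure of the tangent space at the identity available for smooth Lie
groups over `ℝ` and over `ℂ`. -/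
instance instLEInftyMinSmoothness : ENat.LEInfty (minSmoothness 𝕜 3) :=
  ⟨by rw [minSmoothness_of_isRCLikeNormedField]; exact ENat.LEInfty.out⟩

variable {E : Type*} [NormedAddCommGroup E] [NormedSpace 𝕜 E]
  {G : Type*} [TopologicalSpace G] [ChartedSpace E G] [Group G]

/-- The adjoint action `Ad(g)` on the Lie algebra: the derivative at `1` of `x ↦ g x g⁻¹`. -/
def lieAd (g : G) : GroupLieAlgebra 𝓘(𝕜, E) G →L[𝕜] GroupLieAlgebra 𝓘(𝕜, E) G :=
  mfderiv 𝓘(𝕜, E) 𝓘(𝕜, E) (fun x : G => g * x * g⁻¹) (1 : G)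

theorem lieAd_one (X : GroupLieAlgebra 𝓘(𝕜, E) G) : lieAd (𝕜 := 𝕜) (E := E) (1 : G) X = X := by
  have e : (fun x : G => 1 * x * (1 : G)⁻¹) = id := by funext x; simp
  unfold lieAd
  rw [e, mfderiv_id]
  rfl

variable [LieGroup 𝓘(𝕜, E) ∞ G]

theorem mdifferentiableAt_conj (g x : G) :
    MDifferentiableAt 𝓘(𝕜, E) 𝓘(𝕜, E) (fun x : G => g * x * g⁻¹) x :=
  (((contMDiff_mul_left (I := 𝓘(𝕜, E)) (n := ∞) (a := g)).mul
    (contMDiff_const (c := g⁻¹))).mdifferentiable (by simp)) x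

theorem lieAd_mul (g h : G) (X : GroupLieAlgebra 𝓘(𝕜, E) G) :
    lieAd (𝕜 := 𝕜) (E := E) (g * h) X = lieAd (𝕜 := 𝕜) (E := E) g (lieAd (𝕜 := 𝕜) (E := E) h X) := by
  have e : (fun x : G => g * h * x * (g * h)⁻¹) =
      (fun x : G => g * x * g⁻¹) ∘ (fun x : G => h * x * h⁻¹) := by
    funext x; simp [mul_assoc]
  unfold lieAd
  rw [e]
  exact mfderiv_comp_apply_of_eq (I' := 𝓘(𝕜, E)) (x := (1 : G)) (y := (1 : G))
    (mdifferentiableAt_conj g 1) (mdifferentiableAt_conj h 1) (by simp) X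

variable [FiniteDimensional 𝕜 E] [CompleteSpace E] {k : ℕ}

/-- The parabolic subgroup `P = {g ∈ G : Ad(g)(𝔤ⁱ) ⊆ 𝔤ⁱ for all i}`. -/
def parabolicSubgroup (𝔤 : KGrading 𝕜 (GroupLieAlgebra 𝓘(𝕜, E) G) k) : Subgroup G where
  carrier := {g | ∀ i : ℤ, ∀ X ∈ 𝔤.filt i, lieAd (𝕜 := 𝕜) (E := E) g X ∈ 𝔤.filt i}
  mul_mem' {g h} hg hh i X hX := by
    rw [lieAd_mul]
    exact hg i _ (hh i X hX)
  one_mem' i X hX := by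
    rw [lieAd_one]
    exact hX
  inv_mem' {g} hg i X hX := by
    have hinj : Function.Injective (lieAd (𝕜 := 𝕜) (E := E) g) := by
      intro Y Z h
      have h' := congrArg (lieAd (𝕜 := 𝕜) (E := E) g⁻¹) h
      rwa [← lieAd_mul, ← lieAd_mul, inv_mul_cancel, lieAd_one, lieAd_one] at h'
    have : FiniteDimensional 𝕜 (GroupLieAlgebra 𝓘(𝕜, E) G) := ‹FiniteDimensional 𝕜 E›
    have hle : (𝔤.filt i).map (lieAd (𝕜 := 𝕜) (E := E) g).toLinearMap ≤ 𝔤.filt i := by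
      rintro _ ⟨Y, hY, rfl⟩
      exact hg i Y hY
    have heq := Submodule.eq_of_le_of_finrank_eq hle
      ((Submodule.equivMapOfInjective _ hinj (𝔤.filt i)).finrank_eq).symm
    rw [← heq] at hX
    obtain ⟨Y, hY, rfl⟩ := hX
    change lieAd (𝕜 := 𝕜) (E := E) g⁻¹ (lieAd (𝕜 := 𝕜) (E := E) g Y) ∈ _
    rw [← lieAd_mul, inv_mul_cancel, lieAd_one]
    exact hY

variable (𝔤 : KGrading 𝕜 (GroupLieAlgebra 𝓘(𝕜, E) G) k)

/-- The generalized flag manifold `G/P`, with the quotient topology. -/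
abbrev FlagManifold : Type _ := G ⧸ parabolicSubgroup 𝔤

/-- The model space of the generalized flag manifold, which has the dimension of `𝔤₋`. -/
abbrev FlagModel : Type _ := EuclideanSpace 𝕜 (Fin (Module.finrank 𝕜 𝔤.neg))

/-- The natural projection `G → G/P`. -/
def flagProj (g : G) : FlagManifold 𝔤 := QuotientGroup.mk g

/-- The given charts make `G/P` into a smooth manifold for which the natural projection `G → G/P`
is a smooth submersion. Two such structures on `G/P` always have the same smooth maps: this is the
usual smooth structure of the homogeneous space `G/P`. -/
structure IsHomogeneousStructure [ChartedSpace (FlagModel 𝔤) (FlagManifold 𝔤)] : Prop where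
  isManifold : IsManifold 𝓘(𝕜, FlagModel 𝔤) ∞ (FlagManifold 𝔤)
  isSubmersion : Manifold.IsSubmersion 𝓘(𝕜, E) 𝓘(𝕜, FlagModel 𝔤) ∞ (flagProj 𝔤)

end LieGroups

end

/-! Charts. Choose projections of the Lie algebra onto the components 𝔤ⁱ and let `Ad(g)` move their
images while the kernels stay fixed. The resulting tuple of idempotents, `movedIdempotent`, is
smooth in g near 1. It takes equal values at g and h exactly when g⁻¹h ∈ P
(`movedIdempotent_eq_iff`), and its derivative along the left-invariant field of X vanishes exactly
when ad X preserves the filtration (`modelDeriv_movedIdempotent_eq_zero_iff`). The infinitesimal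
stabilizer of the filtration is 𝔤⁰: comparing degrees, a component of X of lowest negative degree
would have to be central, and the centre is trivial (`KGrading.mem_filt_zero_iff`). So this map has
constant rank, and the constant rank theorem yields a chart of G at 1 whose first component labels
the cosets of P (`exists_flag_slice`). Its translates form an atlas of G/P in which the projection p
is a coordinate projection. The quotient is Hausdorff because P, a stabilizer of subspaces, is
closed.

Distribution. In the left trivialization of TG, the derivative of p is `quotientDeriv`, whose kernel
is 𝔤⁰ for every admissible manifold structure. Each 𝔤⁻ⁿ is Ad(P)-invariant, hence projects to a
homogeneous subbundle `flagDist 𝔤 n` of T(G/P), and the wanted distribution is the case n = 1. Left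
translations on G fix the trivialization, so these subbundles are invariant.

Brackets. Lift fields ξ, η on G/P to Lie-algebra-valued functions Z, W on G. Then [ξ, η] is the
projection of [Z, W] + dW(L_Z) − dZ(L_W) (`fieldBracket_eq_quotientDeriv`). If Z and W have values
in 𝔤⁻ⁱ and 𝔤⁻ʲ with i, j ≥ 1, the two derivative terms stay in these subspaces, so modulo 𝔤⁻ⁱ⁻ʲ⁺¹
only the algebraic bracket survives. Generation by degree −1 makes each 𝔤₋ₙ₋₁ the span of [𝔤₋ₙ,
𝔤₋₁]. Together these facts identify T⁻ⁿ with `flagDist 𝔤 n`, give bracket generation, and show that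
a local section of p turns 𝔤₋ₙ ≅ 𝔤⁻ⁿ/𝔤⁻ⁿ⁺¹ into a local trivialization of the symbol algebras. -/

noncomputable section

set_option linter.unusedSectionVars false

/-! ### Derivatives between model spaces, fields along maps, and the bracket as a commutator. -/

section DerivativeAlong

variable {𝕜 : Type*} [RCLike 𝕜]
  {E : Type*} [NormedAddCommGroup E] [NormedSpace 𝕜 E]
  {E' : Type*} [NormedAddCommGroup E'] [NormedSpace 𝕜 E']
  {E'' : Type*} [NormedAddCommGroup E''] [NormedSpace 𝕜 E'']
  {F : Type*} [NormedAddCommGroup F] [NormedSpace 𝕜 F]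
  {M : Type*} [TopologicalSpace M] [ChartedSpace E M]
  {M' : Type*} [TopologicalSpace M'] [ChartedSpace E' M']
  {N : Type*} [TopologicalSpace N] [ChartedSpace E'' N]

variable (𝕜 E E') in
/-- The derivative of a map between boundaryless manifolds, as a map between the model spaces. -/
def modelDeriv (f : M → M') (x : M) : E →L[𝕜] E' := mfderiv 𝓘(𝕜, E) 𝓘(𝕜, E') f x

/-- The vector field `V` along the map `γ` is smooth on `S`. -/
def IsSmoothAlong (𝕜 E'' E : Type*) [RCLike 𝕜] [NormedAddCommGroup E] [NormedSpace 𝕜 E]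
    [NormedAddCommGroup E''] [NormedSpace 𝕜 E'']
    {M : Type*} [TopologicalSpace M] [ChartedSpace E M] [IsManifold 𝓘(𝕜, E) 1 M]
    {N : Type*} [TopologicalSpace N] [ChartedSpace E'' N]
    (γ : N → M) (V : N → E) (S : Set N) : Prop :=
  ContMDiffOn 𝓘(𝕜, E'') 𝓘(𝕜, E).tangent ∞
    (fun y => (⟨γ y, V y⟩ : TangentBundle 𝓘(𝕜, E) M)) S

variable (𝕜) in
/-- The Lie bracket of vector fields, given as maps to the model space. -/
def fieldBracket (V W : M → E) (x : M) : E := VectorField.mlieBracket 𝓘(𝕜, E) V W x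

theorem modelDeriv_comp {g : M' → N} {f : M → M'} (x : M)
    (hg : MDifferentiableAt 𝓘(𝕜, E') 𝓘(𝕜, E'') g (f x))
    (hf : MDifferentiableAt 𝓘(𝕜, E) 𝓘(𝕜, E') f x) :
    modelDeriv 𝕜 E E'' (g ∘ f) x = (modelDeriv 𝕜 E' E'' g (f x)).comp (modelDeriv 𝕜 E E' f x) :=
  mfderiv_comp x hg hf

theorem modelDeriv_comp_apply {g : M' → N} {f : M → M'} (x : M)
    (hg : MDifferentiableAt 𝓘(𝕜, E') 𝓘(𝕜, E'') g (f x))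
    (hf : MDifferentiableAt 𝓘(𝕜, E) 𝓘(𝕜, E') f x) (v : E) :
    modelDeriv 𝕜 E E'' (g ∘ f) x v = modelDeriv 𝕜 E' E'' g (f x) (modelDeriv 𝕜 E E' f x v) := by
  rw [modelDeriv_comp x hg hf]; rfl

theorem modelDeriv_id (x : M) : modelDeriv 𝕜 E E (id : M → M) x = ContinuousLinearMap.id 𝕜 E :=
  mfderiv_id

theorem modelDeriv_const (c : M') (x : M) : modelDeriv 𝕜 E E' (fun _ : M => c) x = 0 :=
  mfderiv_const

theorem modelDeriv_congr {f g : M → M'} {x : M} (h : f =ᶠ[𝓝 x] g) :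
    modelDeriv 𝕜 E E' f x = modelDeriv 𝕜 E E' g x :=
  h.mfderiv_eq

theorem modelDeriv_eq_fderiv (f : E → F) (x : E) : modelDeriv 𝕜 E F f x = fderiv 𝕜 f x :=
  mfderiv_eq_fderiv

theorem modelDeriv_eq_fderiv_chart {u : M → F} {x : M}
    (hu : MDifferentiableAt 𝓘(𝕜, E) 𝓘(𝕜, F) u x) :
    modelDeriv 𝕜 E F u x =
      fderiv 𝕜 (u ∘ (extChartAt 𝓘(𝕜, E) x).symm) (extChartAt 𝓘(𝕜, E) x x) := by
  have h : modelDeriv 𝕜 E F u x = fderivWithin 𝕜 (writtenInExtChartAt 𝓘(𝕜, E) 𝓘(𝕜, F) x u)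
    (Set.range 𝓘(𝕜, E)) (extChartAt 𝓘(𝕜, E) x x) := hu.mfderiv
  rw [h, ModelWithCorners.range_eq_univ, fderivWithin_univ]
  rfl

variable [IsManifold 𝓘(𝕜, E) ∞ M] [IsManifold 𝓘(𝕜, E') ∞ M']

/-- The derivative of a smooth map applied to a smooth vector field along a smooth map is smooth. -/
theorem IsSmoothAlong.modelDeriv {f : M → M'} {U : Set M} (hU : IsOpen U)
    (hf : ContMDiffOn 𝓘(𝕜, E) 𝓘(𝕜, E') ∞ f U) {S : Set N} {γ : N → M} {V : N → E}
    (hV : IsSmoothAlong 𝕜 E'' E γ V S) (hγ : ∀ y ∈ S, γ y ∈ U) :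
    IsSmoothAlong 𝕜 E'' E' (fun y => f (γ y))
      (fun y => _root_.modelDeriv 𝕜 E E' f (γ y) (V y)) S := by
  have h := hf.contMDiffOn_tangentMapWithin (m := ∞) (by simp) hU.uniqueMDiffOn
  have h2 := h.comp hV (fun y hy => hγ y hy)
  refine h2.congr fun y hy => ?_
  simp only [Function.comp, tangentMapWithin]
  rw [mfderivWithin_of_isOpen hU (hγ y hy)]
  rfl

/-- The derivative of a smooth vector-valued function along a smooth vector field is smooth. -/
theorem IsSmoothAlong.contMDiffOn_modelDeriv {u : M → F} {U : Set M} (hU : IsOpen U)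
    (hu : ContMDiffOn 𝓘(𝕜, E) 𝓘(𝕜, F) ∞ u U) {S : Set N} {γ : N → M} {V : N → E}
    (hV : IsSmoothAlong 𝕜 E'' E γ V S) (hγ : ∀ y ∈ S, γ y ∈ U) :
    ContMDiffOn 𝓘(𝕜, E'') 𝓘(𝕜, F) ∞ (fun y => _root_.modelDeriv 𝕜 E F u (γ y) (V y)) S :=
  (contMDiff_snd_tangentBundle_modelSpace F 𝓘(𝕜, F)).comp_contMDiffOn
    (IsSmoothAlong.modelDeriv hU hu hV hγ)

section Bracket

variable [CompleteSpace E]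

variable (𝕜) in
/-- The vector field `V` written in the chart at `x`. -/
def chartField (x : M) (V : M → E) (y : E) : E :=
  (modelDeriv 𝕜 E E (extChartAt 𝓘(𝕜, E) x).symm y).inverse (V ((extChartAt 𝓘(𝕜, E) x).symm y))

theorem mpullbackWithin_eq_chartField (x : M) (X : M → E) :
    (VectorField.mpullbackWithin 𝓘(𝕜, E) 𝓘(𝕜, E)
      (extChartAt 𝓘(𝕜, E) x).symm (fun y => (X y : TangentSpace 𝓘(𝕜, E) y))
      (Set.range 𝓘(𝕜, E)) : E → E) = chartField 𝕜 x X := by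
  funext y
  have : (VectorField.mpullbackWithin 𝓘(𝕜, E) 𝓘(𝕜, E)
    (extChartAt 𝓘(𝕜, E) x).symm (fun y => (X y : TangentSpace 𝓘(𝕜, E) y))
    (Set.range 𝓘(𝕜, E)) y : E) = (mfderivWithin 𝓘(𝕜, E) 𝓘(𝕜, E)
      (extChartAt 𝓘(𝕜, E) x).symm (Set.range 𝓘(𝕜, E)) y).inverse
      (X ((extChartAt 𝓘(𝕜, E) x).symm y)) := rfl
  rw [this, ModelWithCorners.range_eq_univ, mfderivWithin_univ]
  rfl

theorem fieldBracket_eq (V W : M → E) (x : M) :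
    fieldBracket 𝕜 V W x = (modelDeriv 𝕜 E E (extChartAt 𝓘(𝕜, E) x) x).inverse
      (VectorField.lieBracket 𝕜 (chartField 𝕜 x V) (chartField 𝕜 x W)
        (extChartAt 𝓘(𝕜, E) x x)) := by
  have e := mpullbackWithin_eq_chartField (𝕜 := 𝕜) (E := E) x
  have h : fieldBracket 𝕜 V W x = (modelDeriv 𝕜 E E (extChartAt 𝓘(𝕜, E) x) x).inverse
      (VectorField.lieBracketWithin 𝕜
        (VectorField.mpullbackWithin 𝓘(𝕜, E) 𝓘(𝕜, E)
      (extChartAt 𝓘(𝕜, E) x).symm (fun y => (V y : TangentSpace 𝓘(𝕜, E) y))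
      (Set.range 𝓘(𝕜, E)) : E → E)
        (VectorField.mpullbackWithin 𝓘(𝕜, E) 𝓘(𝕜, E)
      (extChartAt 𝓘(𝕜, E) x).symm (fun y => (W y : TangentSpace 𝓘(𝕜, E) y))
      (Set.range 𝓘(𝕜, E)) : E → E)
        ((extChartAt 𝓘(𝕜, E) x).symm ⁻¹' Set.univ ∩ Set.range 𝓘(𝕜, E))
        (extChartAt 𝓘(𝕜, E) x x)) := rfl
  rw [h, e, e, ModelWithCorners.range_eq_univ, Set.preimage_univ, Set.univ_inter,
    VectorField.lieBracketWithin_univ]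

/-- The Lie bracket of vector fields is the commutator of the derivatives along them. -/
theorem modelDeriv_fieldBracket {u : M → F} {U : Set M} (hU : IsOpen U)
    (hu : ContMDiffOn 𝓘(𝕜, E) 𝓘(𝕜, F) ∞ u U) {V W : M → E}
    (hV : IsSmoothAlong 𝕜 E E id V U) (hW : IsSmoothAlong 𝕜 E E id W U) {x : M} (hx : x ∈ U) :
    modelDeriv 𝕜 E F u x (fieldBracket 𝕜 V W x) =
      modelDeriv 𝕜 E F (fun y => modelDeriv 𝕜 E F u y (W y)) x (V x) -
      modelDeriv 𝕜 E F (fun y => modelDeriv 𝕜 E F u y (V y)) x (W x) := by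
  set φ := extChartAt 𝓘(𝕜, E) x with hφ
  have hxs : x ∈ φ.source := mem_extChartAt_source x
  have hxt : φ x ∈ φ.target := mem_extChartAt_target x
  have hto : φ.symm (φ x) = x := extChartAt_to_inv x
  have hsymm : ContMDiffOn 𝓘(𝕜, E) 𝓘(𝕜, E) ∞ φ.symm φ.target := contMDiffOn_extChartAt_symm x
  have hopen : IsOpen φ.target := isOpen_extChartAt_target x
  set T : Set E := φ.target ∩ φ.symm ⁻¹' U with hT
  have hTo : IsOpen T := (continuousOn_extChartAt_symm x).isOpen_inter_preimage hopen hU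
  have hxT : φ x ∈ T := ⟨hxt, by simpa [hto] using hx⟩
  have hinv : ∀ y ∈ φ.target, (modelDeriv 𝕜 E E φ.symm y).IsInvertible := by
    intro y hy
    have := isInvertible_mfderivWithin_extChartAt_symm (I := 𝓘(𝕜, E)) hy
    rw [ModelWithCorners.range_eq_univ, mfderivWithin_univ] at this
    exact this
  have hd : ∀ y ∈ φ.target, MDifferentiableAt 𝓘(𝕜, E) 𝓘(𝕜, E) φ.symm y := fun y hy =>
    (hsymm.contMDiffAt (hopen.mem_nhds hy)).mdifferentiableAt (by simp)
  have hfield : ∀ (X : M → E), IsSmoothAlong 𝕜 E E id X U →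
      DifferentiableAt 𝕜 (chartField 𝕜 x X) (φ x) := by
    intro X hX
    have h1 : MDifferentiableAt 𝓘(𝕜, E) 𝓘(𝕜, E).tangent
        (fun y => (⟨y, X y⟩ : TangentBundle 𝓘(𝕜, E) M)) x :=
      (hX.contMDiffAt (hU.mem_nhds hx)).mdifferentiableAt (by simp)
    have h2 : DifferentiableWithinAt 𝕜 (VectorField.mpullbackWithin 𝓘(𝕜, E) 𝓘(𝕜, E)
        (extChartAt 𝓘(𝕜, E) x).symm (fun y => (X y : TangentSpace 𝓘(𝕜, E) y))
        (Set.range 𝓘(𝕜, E)) : E → E)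
        ((extChartAt 𝓘(𝕜, E) x).symm ⁻¹' Set.univ ∩ Set.range 𝓘(𝕜, E)) (φ x) :=
      (h1.mdifferentiableWithinAt (s := Set.univ)).differentiableWithinAt_mpullbackWithin_vectorField
    rwa [mpullbackWithin_eq_chartField, ModelWithCorners.range_eq_univ, Set.preimage_univ,
      Set.univ_inter, differentiableWithinAt_univ] at h2
  -- transport of the derivative along a field to the chart
  have key : ∀ (w : M → F) (X : M → E), ∀ y ∈ T,
      MDifferentiableAt 𝓘(𝕜, E) 𝓘(𝕜, F) w (φ.symm y) →
      fderiv 𝕜 (w ∘ φ.symm) y (chartField 𝕜 x X y) =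
        modelDeriv 𝕜 E F w (φ.symm y) (X (φ.symm y)) := by
    intro w X y hy hw
    rw [← modelDeriv_eq_fderiv, modelDeriv_comp_apply y hw (hd y hy.1)]
    exact congrArg _ ((hinv y hy.1).self_apply_inverse _)
  have hsmooth : ∀ X : M → E, IsSmoothAlong 𝕜 E E id X U →
      ContMDiffOn 𝓘(𝕜, E) 𝓘(𝕜, F) ∞ (fun y => modelDeriv 𝕜 E F u y (X y)) U := fun X hX =>
    hX.contMDiffOn_modelDeriv hU hu (fun y hy => hy)
  have humd : ∀ (w : M → F), ContMDiffOn 𝓘(𝕜, E) 𝓘(𝕜, F) ∞ w U → ∀ y ∈ T,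
      MDifferentiableAt 𝓘(𝕜, E) 𝓘(𝕜, F) w (φ.symm y) := fun w hw y hy =>
    (hw.contMDiffAt (hU.mem_nhds hy.2)).mdifferentiableAt (by simp)
  -- Iterated derivatives transport by using `key` twice; the inner derivative has to be replaced on
  -- a whole neighbourhood of `φ x` before it is differentiated again.
  have second : ∀ (X Y : M → E), IsSmoothAlong 𝕜 E E id X U →
      fderiv 𝕜 (fun y => fderiv 𝕜 (u ∘ φ.symm) y (chartField 𝕜 x X y)) (φ x)
        (chartField 𝕜 x Y (φ x)) =
      modelDeriv 𝕜 E F (fun y => modelDeriv 𝕜 E F u y (X y)) x (Y x) := by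
    intro X Y hX
    have h1 : (fun y => fderiv 𝕜 (u ∘ φ.symm) y (chartField 𝕜 x X y)) =ᶠ[𝓝 (φ x)]
        (fun y => modelDeriv 𝕜 E F u y (X y)) ∘ φ.symm := by
      filter_upwards [hTo.mem_nhds hxT] with y hy
      exact key u X y hy (humd u hu y hy)
    rw [h1.fderiv_eq, key _ Y _ hxT (humd _ (hsmooth X hX) _ hxT), hto]
  have huφ : ContDiffAt 𝕜 ∞ (u ∘ φ.symm) (φ x) := by
    rw [← contMDiffAt_iff_contDiffAt]
    have := hu.contMDiffAt (hU.mem_nhds hx)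
    rw [← hto] at this
    exact this.comp (φ x) (hsymm.contMDiffAt (hopen.mem_nhds hxt))
  -- In the chart the identity rests on the symmetry of the second derivative of `u ∘ φ.symm`.
  have h3 := VectorField.fderiv_apply_lieBracket (𝕜 := 𝕜) huφ
    (by rw [minSmoothness_of_isRCLikeNormedField]; exact ENat.LEInfty.out)
    (hfield W hW) (hfield V hV)
  rw [second V W hV, second W V hW] at h3
  rw [← h3, fieldBracket_eq]
  have hmd := humd u hu _ hxT
  rw [← modelDeriv_eq_fderiv, modelDeriv_comp_apply _ hmd (hd _ hxt), hto]
  congr 1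
  -- The bracket is brought back to `M` by the inverse of the derivative of `φ`, while the chain
  -- rule produces the derivative of `φ.symm`.
  have e1 : (modelDeriv 𝕜 E E φ x).inverse = modelDeriv 𝕜 E E φ.symm (φ x) := by
    refine ContinuousLinearMap.inverse_eq ?_ ?_
    · have := mfderiv_extChartAt_comp_mfderivWithin_extChartAt_symm (I := 𝓘(𝕜, E)) hxt
      rw [ModelWithCorners.range_eq_univ, mfderivWithin_univ] at this
      rw [← hφ, hto] at this
      exact this
    · have := mfderivWithin_extChartAt_symm_comp_mfderiv_extChartAt (I := 𝓘(𝕜, E)) hxt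
      rw [ModelWithCorners.range_eq_univ, mfderivWithin_univ] at this
      rw [← hφ, hto] at this
      exact this
  rw [e1]

end Bracket

end DerivativeAlong

/-! ### Symmetry of mixed partial derivatives. -/

section MixedPartials

variable {𝕜 : Type*} [RCLike 𝕜]
  {E : Type*} [NormedAddCommGroup E] [NormedSpace 𝕜 E]
  {E' : Type*} [NormedAddCommGroup E'] [NormedSpace 𝕜 E']
  {F : Type*} [NormedAddCommGroup F] [NormedSpace 𝕜 F]

/-- Mixed second partial derivatives commute. -/
theorem fderiv_fderiv_swap {w : E × E' → F} {a : E} {b : E'} (hw : ContDiffAt 𝕜 ∞ w (a, b))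
    (X : E') (Y : E) :
    fderiv 𝕜 (fun y => fderiv 𝕜 (fun x => w (x, y)) a Y) b X =
      fderiv 𝕜 (fun x => fderiv 𝕜 (fun y => w (x, y)) b X) a Y := by
  have hw2 : ContDiffAt 𝕜 2 w (a, b) := hw.of_le (by exact ENat.LEInfty.out)
  have hd : ∀ᶠ p in 𝓝 (a, b), DifferentiableAt 𝕜 w p := by
    filter_upwards [hw2.eventually (by simp)] with p hp
    exact hp.differentiableAt (by simp)
  have hD : DifferentiableAt 𝕜 (fderiv 𝕜 w) (a, b) :=
    (hw2.fderiv_right (m := 1) (by norm_num)).differentiableAt (by simp)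
  have hs : IsSymmSndFDerivAt 𝕜 w (a, b) := hw2.isSymmSndFDerivAt (by simp)
  -- Near the base point a partial derivative is the total derivative on `(Y, 0)` or `(0, X)`, so
  -- both sides become values of the symmetric second derivative of `w`.
  have c1 : ∀ᶠ y in 𝓝 b, fderiv 𝕜 (fun x => w (x, y)) a Y = fderiv 𝕜 w (a, y) (Y, 0) := by
    have hc : Filter.Tendsto (fun y : E' => (a, y)) (𝓝 b) (𝓝 (a, b)) :=
      (Continuous.prodMk_right a).tendsto b
    filter_upwards [hc.eventually hd] with y hy
    have h := hy.hasFDerivAt.comp a (hasFDerivAt_prodMk_left (𝕜 := 𝕜) a y)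
    have := h.fderiv
    simp only [Function.comp_def] at this
    rw [this]
    simp
  have c2 : ∀ᶠ x in 𝓝 a, fderiv 𝕜 (fun y => w (x, y)) b X = fderiv 𝕜 w (x, b) (0, X) := by
    have hc : Filter.Tendsto (fun x : E => (x, b)) (𝓝 a) (𝓝 (a, b)) :=
      (Continuous.prodMk_left b).tendsto a
    filter_upwards [hc.eventually hd] with x hx
    have h := hx.hasFDerivAt.comp b (hasFDerivAt_prodMk_right (𝕜 := 𝕜) x b)
    have := h.fderiv
    simp only [Function.comp_def] at this
    rw [this]
    simp
  rw [Filter.EventuallyEq.fderiv_eq c1, Filter.EventuallyEq.fderiv_eq c2]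
  have d1 : HasFDerivAt (fun y => fderiv 𝕜 w (a, y) (Y, 0))
      ((ContinuousLinearMap.apply 𝕜 F ((Y, 0) : E × E')).comp ((fderiv 𝕜 (fderiv 𝕜 w) (a, b)).comp
        (ContinuousLinearMap.inr 𝕜 E E'))) b :=
    (ContinuousLinearMap.apply 𝕜 F ((Y, 0) : E × E')).hasFDerivAt.comp b
      (hD.hasFDerivAt.comp b (hasFDerivAt_prodMk_right (𝕜 := 𝕜) a b))
  have d2 : HasFDerivAt (fun x => fderiv 𝕜 w (x, b) (0, X))
      ((ContinuousLinearMap.apply 𝕜 F ((0, X) : E × E')).comp ((fderiv 𝕜 (fderiv 𝕜 w) (a, b)).comp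
        (ContinuousLinearMap.inl 𝕜 E E'))) a :=
    (ContinuousLinearMap.apply 𝕜 F ((0, X) : E × E')).hasFDerivAt.comp a
      (hD.hasFDerivAt.comp a (hasFDerivAt_prodMk_left (𝕜 := 𝕜) a b))
  rw [d1.fderiv, d2.fderiv]
  simpa using hs (0, X) (Y, 0)

end MixedPartials

/-! ### Smooth dependence of derivatives on parameters. -/

section ParametricDerivative

open Bundle

variable {𝕜 : Type*} [RCLike 𝕜]
  {E : Type*} [NormedAddCommGroup E] [NormedSpace 𝕜 E]
  {E' : Type*} [NormedAddCommGroup E'] [NormedSpace 𝕜 E']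
  {E'' : Type*} [NormedAddCommGroup E''] [NormedSpace 𝕜 E'']
  {M : Type*} [TopologicalSpace M] [ChartedSpace E M] [IsManifold 𝓘(𝕜, E) ∞ M]
  {M' : Type*} [TopologicalSpace M'] [ChartedSpace E' M'] [IsManifold 𝓘(𝕜, E') ∞ M']
  {N : Type*} [TopologicalSpace N] [ChartedSpace E'' N] [IsManifold 𝓘(𝕜, E'') ∞ N]

/-- The derivative of a family of maps at a point in a fixed direction depends smoothly on the
parameter. -/
theorem isSmoothAlong_modelDeriv_param {c : M × M' → N}
    (hc : ContMDiff (𝓘(𝕜, E).prod 𝓘(𝕜, E')) 𝓘(𝕜, E'') ∞ c) (x₀ : M') (v : E') :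
    IsSmoothAlong 𝕜 E E'' (fun g => c (g, x₀))
      (fun g => modelDeriv 𝕜 E' E'' (fun x => c (g, x)) x₀ v) Set.univ := by
  unfold IsSmoothAlong
  rw [contMDiffOn_univ]
  -- A partial derivative is the tangent map of `c` on a pair of tangent vectors whose parameter
  -- component is zero; hence the zero section here and the constant vector `v` below.
  let fg : M → TangentBundle 𝓘(𝕜, E) M := fun g ↦ TotalSpace.mk' E g 0
  have sfg : ContMDiff 𝓘(𝕜, E) 𝓘(𝕜, E).tangent ∞ fg := contMDiff_zeroSection _ _
  let fv : M → TangentBundle 𝓘(𝕜, E') M' := fun _ ↦ TotalSpace.mk' E' x₀ v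
  have sfv : ContMDiff 𝓘(𝕜, E) 𝓘(𝕜, E').tangent ∞ fv := contMDiff_const
  let F₁ : M → (TangentBundle 𝓘(𝕜, E) M × TangentBundle 𝓘(𝕜, E') M') := fun g ↦ (fg g, fv g)
  have S₁ : ContMDiff 𝓘(𝕜, E) (𝓘(𝕜, E).tangent.prod 𝓘(𝕜, E').tangent) ∞ F₁ := sfg.prodMk sfv
  let F₂ : (TangentBundle 𝓘(𝕜, E) M × TangentBundle 𝓘(𝕜, E') M') →
      TangentBundle (𝓘(𝕜, E).prod 𝓘(𝕜, E')) (M × M') :=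
    (equivTangentBundleProd 𝓘(𝕜, E) M 𝓘(𝕜, E') M').symm
  have S₂ : ContMDiff (𝓘(𝕜, E).tangent.prod 𝓘(𝕜, E').tangent)
    (𝓘(𝕜, E).prod 𝓘(𝕜, E')).tangent ∞ F₂ := contMDiff_equivTangentBundleProd_symm
  let F₃ := tangentMap (𝓘(𝕜, E).prod 𝓘(𝕜, E')) 𝓘(𝕜, E'') c
  have S₃ : ContMDiff (𝓘(𝕜, E).prod 𝓘(𝕜, E')).tangent 𝓘(𝕜, E'').tangent ∞ F₃ :=
    hc.contMDiff_tangentMap (by simp)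
  have S := (S₃.comp S₂).comp S₁
  refine S.congr fun g => ?_
  have hmd := hc.mdifferentiableAt (by simp) (x := (g, x₀))
  have h := mfderiv_prod_eq_add_apply hmd (v := ((0, v) : E × E'))
  have h2 : modelDeriv 𝕜 E' E'' (fun x => c (g, x)) x₀ v =
      (mfderiv (𝓘(𝕜, E).prod 𝓘(𝕜, E')) 𝓘(𝕜, E'') c (g, x₀) ((0, v) : E × E') : E'') := by
    refine Eq.trans ?_ h.symm
    have : (mfderiv 𝓘(𝕜, E) 𝓘(𝕜, E'') (fun z => c (z, x₀)) g (0 : E) : E'') = 0 :=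
      map_zero (modelDeriv 𝕜 E E'' (fun z => c (z, x₀)) g)
    exact ((congrArg (· + modelDeriv 𝕜 E' E'' (fun x => c (g, x)) x₀ v) this).trans
      (zero_add _)).symm
  exact congrArg (fun z : E'' => (⟨c (g, x₀), z⟩ : TangentBundle 𝓘(𝕜, E'') N)) h2

end ParametricDerivative

/-! ### Operator-valued smooth maps. -/

section OperatorValued

variable {𝕜 : Type*} [RCLike 𝕜]
  {E : Type*} [NormedAddCommGroup E] [NormedSpace 𝕜 E] [FiniteDimensional 𝕜 E]
  {E' : Type*} [NormedAddCommGroup E'] [NormedSpace 𝕜 E']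
  {F : Type*} [NormedAddCommGroup F] [NormedSpace 𝕜 F]
  {M : Type*} [TopologicalSpace M] [ChartedSpace E' M]

/-- An operator-valued map on a finite-dimensional space is smooth as soon as it is so pointwise. -/
theorem contMDiffOn_of_forall_apply {f : M → E →L[𝕜] F} {S : Set M}
    (h : ∀ X, ContMDiffOn 𝓘(𝕜, E') 𝓘(𝕜, F) ∞ (fun m => f m X) S) :
    ContMDiffOn 𝓘(𝕜, E') 𝓘(𝕜, E →L[𝕜] F) ∞ f S := by
  let b := Module.finBasis 𝕜 E
  have e : f = fun m => ∑ i, ContinuousLinearMap.smulRightL 𝕜 E F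
      (LinearMap.toContinuousLinearMap (b.coord i)) (f m (b i)) := by
    funext m
    ext X
    conv_lhs => rw [← b.sum_repr X, map_sum]
    simp
  rw [e]
  refine contMDiffOn_finsetSum fun i _ => ?_
  exact (ContinuousLinearMap.contMDiff _).comp_contMDiffOn (h (b i))

end OperatorValued

/-! ### Derivatives computed in the preferred chart. -/

section ChartDerivative

variable {𝕜 : Type*} [RCLike 𝕜] {E : Type*} [NormedAddCommGroup E] [NormedSpace 𝕜 E]
  {M : Type*} [TopologicalSpace M] [ChartedSpace E M] [IsManifold 𝓘(𝕜, E) ∞ M]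

/-- The tangent space at `x` is identified with `E` through the preferred chart at `x` itself. This
turns identities between derivatives of that chart into identities between tangent vectors at `x`.
-/
theorem modelDeriv_extChartAt_self (x : M) :
    modelDeriv 𝕜 E E (extChartAt 𝓘(𝕜, E) x) x = ContinuousLinearMap.id 𝕜 E := by
  rw [modelDeriv_eq_fderiv_chart (mdifferentiableAt_extChartAt (mem_chart_source E x))]
  have : (extChartAt 𝓘(𝕜, E) x) ∘ (extChartAt 𝓘(𝕜, E) x).symm =ᶠ[𝓝 (extChartAt 𝓘(𝕜, E) x x)]
      id := by
    filter_upwards [(isOpen_extChartAt_target x).mem_nhds (mem_extChartAt_target x)] with y hy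
    exact (extChartAt 𝓘(𝕜, E) x).right_inv hy
  rw [this.fderiv_eq, fderiv_id]

theorem MDifferentiableAt.differentiableAt_comp_extChartAt_symm {F : Type*} [NormedAddCommGroup F]
    [NormedSpace 𝕜 F] {u : M → F} {x : M} (hu : MDifferentiableAt 𝓘(𝕜, E) 𝓘(𝕜, F) u x) :
    DifferentiableAt 𝕜 (u ∘ (extChartAt 𝓘(𝕜, E) x).symm) (extChartAt 𝓘(𝕜, E) x x) := by
  have h := hu.differentiableWithinAt_writtenInExtChartAt
  rw [ModelWithCorners.range_eq_univ, differentiableWithinAt_univ] at h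
  exact h

/-- The product rule for the application of an operator-valued function. -/
theorem modelDeriv_clm_apply {A B : Type*} [NormedAddCommGroup A] [NormedSpace 𝕜 A]
    [NormedAddCommGroup B] [NormedSpace 𝕜 B] {K : M → A →L[𝕜] B} {v : M → A} {x : M}
    (hK : MDifferentiableAt 𝓘(𝕜, E) 𝓘(𝕜, A →L[𝕜] B) K x)
    (hv : MDifferentiableAt 𝓘(𝕜, E) 𝓘(𝕜, A) v x) (X : E) :
    modelDeriv 𝕜 E B (fun y => K y (v y)) x X =
      modelDeriv 𝕜 E B (fun y => K y (v x)) x X + K x (modelDeriv 𝕜 E A v x X) := by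
  have hK' := hK.differentiableAt_comp_extChartAt_symm
  have hv' := hv.differentiableAt_comp_extChartAt_symm
  have hx : (extChartAt 𝓘(𝕜, E) x).symm (extChartAt 𝓘(𝕜, E) x x) = x := extChartAt_to_inv x
  rw [modelDeriv_eq_fderiv_chart (hK.clm_apply hv),
    modelDeriv_eq_fderiv_chart (hK.clm_apply mdifferentiableAt_const),
    modelDeriv_eq_fderiv_chart hv]
  have h1 := (hK'.hasFDerivAt.clm_apply hv'.hasFDerivAt).fderiv
  have h2 := (hK'.hasFDerivAt.clm_apply
    (hasFDerivAt_const (v x) (extChartAt 𝓘(𝕜, E) x x))).fderiv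
  simp only [Function.comp_def, hx] at h1 h2 ⊢
  rw [h1, h2]
  simp [add_comm]

end ChartDerivative

/-! ### Invariant vector fields and the derivative of the adjoint representation. -/

section LieGroupCalculus

variable {𝕜 : Type*} [RCLike 𝕜]
  {E : Type*} [NormedAddCommGroup E] [NormedSpace 𝕜 E]
  {G : Type*} [TopologicalSpace G] [ChartedSpace E G] [Group G]

variable (𝕜 E) in
/-- The left-invariant vector fields: the derivative at `1` of the left translation by `g`. -/
def leftField (g : G) : E →L[𝕜] E := modelDeriv 𝕜 E E (fun x : G => g * x) 1

variable (𝕜 E) in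
/-- The right-invariant vector fields: the derivative at `1` of the right translation by `g`. -/
def rightField (g : G) : E →L[𝕜] E := modelDeriv 𝕜 E E (fun x : G => x * g) 1

variable (𝕜 E) in
/-- The adjoint action on the model space. -/
def modelAd (g : G) : E →L[𝕜] E := modelDeriv 𝕜 E E (fun x : G => g * x * g⁻¹) 1

variable [LieGroup 𝓘(𝕜, E) ∞ G]

theorem mdifferentiableAt_leftMul (g x : G) :
    MDifferentiableAt 𝓘(𝕜, E) 𝓘(𝕜, E) (fun y : G => g * y) x :=
  (contMDiff_mul_left (I := 𝓘(𝕜, E)) (n := ∞) (a := g)).mdifferentiableAt (by simp)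

theorem mdifferentiableAt_rightMul (g x : G) :
    MDifferentiableAt 𝓘(𝕜, E) 𝓘(𝕜, E) (fun y : G => y * g) x :=
  (contMDiff_mul_right (I := 𝓘(𝕜, E)) (n := ∞) (a := g)).mdifferentiableAt (by simp)

theorem leftField_one : leftField 𝕜 E (1 : G) = ContinuousLinearMap.id 𝕜 E := by
  have : (fun x : G => 1 * x) = id := by funext x; simp
  rw [leftField, this, modelDeriv_id]

theorem modelDeriv_mul_left_leftField (h g : G) (X : E) :
    modelDeriv 𝕜 E E (fun x : G => h * x) g (leftField 𝕜 E g X) = leftField 𝕜 E (h * g) X := by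
  have e : (fun x : G => h * g * x) = (fun x : G => h * x) ∘ (fun x : G => g * x) := by
    funext x; simp [mul_assoc]
  rw [leftField, leftField, e, modelDeriv_comp_apply (1 : G)
    (by simpa using mdifferentiableAt_leftMul h (g * 1)) (mdifferentiableAt_leftMul g 1)]
  simp

/-- Since (gx)h = (gh)(h⁻¹xh), right translations act on left-invariant fields through `Ad(h⁻¹)`. -/
theorem modelDeriv_mul_right_leftField (h g : G) (X : E) :
    modelDeriv 𝕜 E E (fun x : G => x * h) g (leftField 𝕜 E g X) =
      leftField 𝕜 E (g * h) (modelAd 𝕜 E h⁻¹ X) := by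
  have e : (fun x : G => x * h) ∘ (fun x : G => g * x) =
      (fun x : G => g * h * x) ∘ (fun x : G => h⁻¹ * x * h⁻¹⁻¹) := by
    funext x; simp [mul_assoc]
  have h1 := modelDeriv_comp_apply (𝕜 := 𝕜) (1 : G)
    (by simpa using mdifferentiableAt_rightMul h (g * 1)) (mdifferentiableAt_leftMul g 1) X
  have h2 := modelDeriv_comp_apply (𝕜 := 𝕜) (1 : G)
    (by simpa using mdifferentiableAt_leftMul (g * h) (h⁻¹ * 1 * h⁻¹⁻¹))
    (mdifferentiableAt_conj h⁻¹ 1) X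
  rw [e, h2] at h1
  simp only [mul_one] at h1
  rw [leftField, leftField, modelAd, ← h1]
  simp

theorem leftField_eq_rightField_modelAd (g : G) (Y : E) :
    leftField 𝕜 E g Y = rightField 𝕜 E g (modelAd 𝕜 E g Y) := by
  have e : (fun x : G => g * x) = (fun x : G => x * g) ∘ (fun x : G => g * x * g⁻¹) := by
    funext x; simp [mul_assoc]
  rw [leftField, e, modelDeriv_comp_apply (1 : G)
    (by simpa using mdifferentiableAt_rightMul g (g * 1 * g⁻¹)) (mdifferentiableAt_conj g 1)]
  simp [rightField, modelAd]

theorem leftField_injective (g : G) : Function.Injective (leftField 𝕜 E g) := by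
  intro X Y h
  have := congrArg (modelDeriv 𝕜 E E (fun x : G => g⁻¹ * x) g) h
  simpa [modelDeriv_mul_left_leftField, leftField_one] using this

theorem leftField_surjective (g : G) : Function.Surjective (leftField 𝕜 E g) := by
  intro v
  refine ⟨modelDeriv 𝕜 E E (fun x : G => g⁻¹ * x) g v, ?_⟩
  have e : (fun x : G => g * x) ∘ (fun x : G => g⁻¹ * x) = id := by funext x; simp
  have h := modelDeriv_comp_apply (𝕜 := 𝕜) g (mdifferentiableAt_leftMul g (g⁻¹ * g))
    (mdifferentiableAt_leftMul g⁻¹ g) v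
  rw [e, modelDeriv_id] at h
  simp only [inv_mul_cancel] at h
  exact h.symm

theorem modelAd_one : modelAd 𝕜 E (1 : G) = 1 := by
  have e : (fun x : G => 1 * x * (1 : G)⁻¹) = id := by funext x; simp
  rw [modelAd, e, modelDeriv_id]; rfl

theorem modelAd_mul (g h : G) : modelAd 𝕜 E (g * h) = modelAd 𝕜 E g * modelAd 𝕜 E h := by
  ext X
  exact lieAd_mul (𝕜 := 𝕜) g h X

theorem isSmoothAlong_leftField (X : E) :
    IsSmoothAlong 𝕜 E E (id : G → G) (fun g => leftField 𝕜 E g X) Set.univ := by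
  have h := isSmoothAlong_modelDeriv_param (contMDiff_mul 𝓘(𝕜, E) ∞ (G := G)) 1 X
  simpa only [mul_one] using! h

theorem isSmoothAlong_rightField (X : E) :
    IsSmoothAlong 𝕜 E E (id : G → G) (fun g => rightField 𝕜 E g X) Set.univ := by
  have h := isSmoothAlong_modelDeriv_param
    (c := fun p : G × G => p.2 * p.1) (𝕜 := 𝕜) (E := E) (E' := E) (E'' := E)
    (contMDiff_snd.mul contMDiff_fst) 1 X
  simpa only [one_mul] using! h

/-- Conjugation fixes 1, so its derivative is a field along a constant map. Composing with the chart
at 1, whose derivative there is the identity, turns smoothness into the tangent bundle into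
smoothness of a vector-valued map. -/
theorem contMDiff_modelAd_apply (X : E) :
    ContMDiff 𝓘(𝕜, E) 𝓘(𝕜, E) ∞ (fun g : G => modelAd 𝕜 E g X) := by
  have h := isSmoothAlong_modelDeriv_param
    (c := fun p : G × G => p.1 * p.2 * p.1⁻¹) (𝕜 := 𝕜) (E := E) (E' := E) (E'' := E)
    ((contMDiff_fst.mul contMDiff_snd).mul contMDiff_fst.inv) 1 X
  simp only [mul_one, mul_inv_cancel] at h
  have h2 := h.contMDiffOn_modelDeriv (chartAt E (1 : G)).open_source
    (contMDiffOn_extChartAt (I := 𝓘(𝕜, E)) (x := (1 : G)))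
    (fun y _ => mem_chart_source E (1 : G))
  rw [contMDiffOn_univ, modelDeriv_extChartAt_self] at h2
  exact h2

theorem modelDeriv_mul_left_one_comp {N : Type*} [TopologicalSpace N] {E' : Type*}
    [NormedAddCommGroup E'] [NormedSpace 𝕜 E'] [ChartedSpace E' N] {f : G → N} {g : G}
    (hf : MDifferentiableAt 𝓘(𝕜, E) 𝓘(𝕜, E') f g) (X : E) :
    modelDeriv 𝕜 E E' (fun x => f (g * x)) 1 X = modelDeriv 𝕜 E E' f g (leftField 𝕜 E g X) := by
  have h := modelDeriv_comp_apply (𝕜 := 𝕜) (f := fun x : G => g * x) (g := f) (1 : G)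
    (by simpa using hf) (mdifferentiableAt_leftMul g 1) X
  simp only [mul_one] at h
  exact h

variable [FiniteDimensional 𝕜 E]

theorem contMDiff_modelAd : ContMDiff 𝓘(𝕜, E) 𝓘(𝕜, E →L[𝕜] E) ∞ (modelAd 𝕜 E : G → E →L[𝕜] E) :=
  contMDiffOn_univ.1
    (contMDiffOn_of_forall_apply fun X => (contMDiff_modelAd_apply X).contMDiffOn)

variable [CompleteSpace E]

variable (𝕜 E G) in
/-- The bracket of the Lie algebra of `G`, transported to the model space. -/
def modelBracket (X Y : E) : E :=
  Bracket.bracket (L := GroupLieAlgebra 𝓘(𝕜, E) G) (M := GroupLieAlgebra 𝓘(𝕜, E) G) X Y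

theorem fieldBracket_leftField (X Y : E) (g : G) :
    fieldBracket 𝕜 (fun x : G => leftField 𝕜 E x X) (fun x => leftField 𝕜 E x Y) g =
      leftField 𝕜 E g (modelBracket 𝕜 E G X Y) :=
  (congrFun (mulInvariantVector_mlieBracket (I := 𝓘(𝕜, E)) (G := G)
    (X : GroupLieAlgebra 𝓘(𝕜, E) G) (Y : GroupLieAlgebra 𝓘(𝕜, E) G)) g).symm

/-- Left-invariant and right-invariant vector fields commute at the identity. -/
theorem modelDeriv_rightField_leftField_swap {F : Type*} [NormedAddCommGroup F] [NormedSpace 𝕜 F]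
    {u : G → F} {U : Set G} (hU : IsOpen U) (h1 : (1 : G) ∈ U)
    (hu : ContMDiffOn 𝓘(𝕜, E) 𝓘(𝕜, F) ∞ u U) (X Y : E) :
    modelDeriv 𝕜 E F (fun g => modelDeriv 𝕜 E F u g (rightField 𝕜 E g Y)) 1 X =
      modelDeriv 𝕜 E F (fun g => modelDeriv 𝕜 E F u g (leftField 𝕜 E g X)) 1 Y := by
  set φ := extChartAt 𝓘(𝕜, E) (1 : G) with hφ
  set e := φ 1 with he
  have hto : φ.symm e = 1 := extChartAt_to_inv 1
  have het : e ∈ φ.target := mem_extChartAt_target 1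
  have hsm : ContMDiffAt 𝓘(𝕜, E) 𝓘(𝕜, E) ∞ φ.symm e :=
    (contMDiffOn_extChartAt_symm (1 : G)).contMDiffAt ((isOpen_extChartAt_target 1).mem_nhds het)
  -- Right-invariant fields differentiate u(xy) in x and left-invariant ones in y. Both sides are
  -- therefore mixed partials of this single function.
  have hw : ContDiffAt 𝕜 ∞ (fun p : E × E => u (φ.symm p.1 * φ.symm p.2)) (e, e) := by
    rw [← contMDiffAt_iff_contDiffAt]
    have hm : ContMDiffAt 𝓘(𝕜, E × E) 𝓘(𝕜, E) ∞
        (fun p : E × E => φ.symm p.1 * φ.symm p.2) (e, e) := by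
      refine ContMDiffAt.mul ?_ ?_
      · exact ContMDiffAt.comp (e, e) (g := φ.symm) hsm
          contDiffAt_fst.contMDiffAt
      · exact ContMDiffAt.comp (e, e) (g := φ.symm) hsm
          contDiffAt_snd.contMDiffAt
    refine ContMDiffAt.comp (e, e) (g := u) ?_ hm
    simp only [hto, mul_one]
    exact hu.contMDiffAt (hU.mem_nhds h1)
  have hsw := fderiv_fderiv_swap hw X Y
  have hev : ∀ᶠ y in 𝓝 e, φ.symm y ∈ U := by
    have := (continuousAt_extChartAt_symm (I := 𝓘(𝕜, E)) (1 : G)).preimage_mem_nhds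
      (t := U) (by rw [extChartAt_to_inv]; exact hU.mem_nhds h1)
    exact this
  have humd : ∀ g ∈ U, MDifferentiableAt 𝓘(𝕜, E) 𝓘(𝕜, F) u g := fun g hg =>
    (hu.contMDiffAt (hU.mem_nhds hg)).mdifferentiableAt (by simp)
  have hR : ∀ g ∈ U, modelDeriv 𝕜 E F u g (rightField 𝕜 E g Y) =
      fderiv 𝕜 (fun x => u (φ.symm x * g)) e Y := by
    intro g hg
    have h := modelDeriv_comp_apply (𝕜 := 𝕜) (f := fun x : G => x * g) (g := u) (1 : G)
      (by simpa using humd g hg) (mdifferentiableAt_rightMul g 1) Y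
    simp only [one_mul] at h
    rw [rightField, ← h, modelDeriv_eq_fderiv_chart]
    · rfl
    · exact MDifferentiableAt.comp (1 : G) (by simpa using humd g hg)
        (mdifferentiableAt_rightMul g 1)
  have hL : ∀ g ∈ U, modelDeriv 𝕜 E F u g (leftField 𝕜 E g X) =
      fderiv 𝕜 (fun x => u (g * φ.symm x)) e X := by
    intro g hg
    rw [← modelDeriv_mul_left_one_comp (humd g hg), modelDeriv_eq_fderiv_chart]
    · rfl
    · exact MDifferentiableAt.comp (1 : G) (g := u) (by simpa using humd g hg)
        (mdifferentiableAt_leftMul g 1)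
  have hRs := IsSmoothAlong.contMDiffOn_modelDeriv hU hu
    ((isSmoothAlong_rightField (𝕜 := 𝕜) (G := G) Y).mono (Set.subset_univ U)) (fun y hy => hy)
  have hLs := IsSmoothAlong.contMDiffOn_modelDeriv hU hu
    ((isSmoothAlong_leftField (𝕜 := 𝕜) (G := G) X).mono (Set.subset_univ U)) (fun y hy => hy)
  simp only [id] at hRs hLs
  rw [modelDeriv_eq_fderiv_chart
      ((hRs.contMDiffAt (hU.mem_nhds h1)).mdifferentiableAt (by simp)),
    modelDeriv_eq_fderiv_chart
      ((hLs.contMDiffAt (hU.mem_nhds h1)).mdifferentiableAt (by simp))]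
  refine Eq.trans ?_ (hsw.trans ?_)
  · refine congrArg (fun A : E →L[𝕜] F => A X) (Filter.EventuallyEq.fderiv_eq ?_)
    filter_upwards [hev] with y hy
    exact hR _ hy
  · refine congrArg (fun A : E →L[𝕜] F => A Y) (Filter.EventuallyEq.fderiv_eq ?_)
    filter_upwards [hev] with y hy
    exact (hL _ hy).symm

/-- The derivative of the adjoint representation at the identity is the Lie bracket. -/
theorem modelDeriv_modelAd_one (X Y : E) :
    modelDeriv 𝕜 E E (fun g : G => modelAd 𝕜 E g Y) 1 X = modelBracket 𝕜 E G X Y := by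
  set φ := extChartAt 𝓘(𝕜, E) (1 : G) with hφ
  set U := (chartAt E (1 : G)).source
  have hU : IsOpen U := (chartAt E (1 : G)).open_source
  have h1 : (1 : G) ∈ U := mem_chart_source E 1
  have hu : ContMDiffOn 𝓘(𝕜, E) 𝓘(𝕜, E) ∞ φ U := contMDiffOn_extChartAt
  have hb := modelDeriv_fieldBracket hU hu
    ((isSmoothAlong_leftField (𝕜 := 𝕜) (G := G) X).mono (Set.subset_univ _))
    ((isSmoothAlong_leftField (𝕜 := 𝕜) (G := G) Y).mono (Set.subset_univ _)) h1
  rw [fieldBracket_leftField, leftField_one, modelDeriv_extChartAt_self] at hb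
  simp only [ContinuousLinearMap.id_apply] at hb
  -- The bracket is now the derivative, in direction `X`, of `φ` along left-invariant minus
  -- right-invariant `Y`. As L_Y = R_{Ad(g)Y}, the product rule for `K g (modelAd 𝕜 E g Y)` leaves
  -- only the derivative of `Ad`.
  rw [← modelDeriv_rightField_leftField_swap hU h1 hu X Y] at hb
  set K : G → E →L[𝕜] E := fun g => (modelDeriv 𝕜 E E φ g).comp (rightField 𝕜 E g)
  have hK : ContMDiffOn 𝓘(𝕜, E) 𝓘(𝕜, E →L[𝕜] E) ∞ K U :=
    contMDiffOn_of_forall_apply fun Z => IsSmoothAlong.contMDiffOn_modelDeriv hU hu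
      ((isSmoothAlong_rightField (𝕜 := 𝕜) (G := G) Z).mono (Set.subset_univ U)) (fun y hy => hy)
  have hp := modelDeriv_clm_apply ((hK.contMDiffAt (hU.mem_nhds h1)).mdifferentiableAt (by simp))
    ((contMDiff_modelAd_apply (𝕜 := 𝕜) (G := G) Y).mdifferentiableAt (by simp) (x := 1)) X
  have e1 : (fun g => K g (modelAd 𝕜 E g Y)) =
      fun y => modelDeriv 𝕜 E E φ y (leftField 𝕜 E y Y) := by
    funext g
    rw [leftField_eq_rightField_modelAd]
    rfl
  have e2 : K 1 = ContinuousLinearMap.id 𝕜 E := by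
    have : (fun x : G => x * 1) = id := by funext x; simp
    simp only [K]
    rw [modelDeriv_extChartAt_self, rightField, this, modelDeriv_id]
    rfl
  have e3 : (fun g => K g (modelAd 𝕜 E (1 : G) Y)) =
      fun g => modelDeriv 𝕜 E E φ g (rightField 𝕜 E g Y) := by
    funext g
    rw [modelAd_one]
    rfl
  rw [e1, e2, e3] at hp
  rw [hb, hp]
  simp

end LieGroupCalculus

/-! ### The constant rank theorem. -/

section ConstantRank

variable {𝕜 : Type*} [RCLike 𝕜]
  {E : Type*} [NormedAddCommGroup E] [NormedSpace 𝕜 E] [FiniteDimensional 𝕜 E]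
  {R : Type*} [NormedAddCommGroup R] [NormedSpace 𝕜 R] [FiniteDimensional 𝕜 R]
  {V : Type*} [NormedAddCommGroup V] [NormedSpace 𝕜 V] [FiniteDimensional 𝕜 V]

/-- A linear map with values in a finite-dimensional space can be composed with a linear map to any
space `V` of dimension the rank, without changing the kernel. -/
theorem exists_comp_ker_eq (D : E →L[𝕜] R)
    (hV : Module.finrank 𝕜 V + Module.finrank 𝕜 D.ker = Module.finrank 𝕜 E) :
    ∃ q : R →L[𝕜] V, (q.comp D).ker = D.ker := by
  have h1 := LinearMap.finrank_range_add_finrank_ker D.toLinearMap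
  have h2 : Module.finrank 𝕜 (LinearMap.range D.toLinearMap) = Module.finrank 𝕜 V := by
    have : Module.finrank 𝕜 (LinearMap.ker D.toLinearMap) = Module.finrank 𝕜 D.ker := rfl
    omega
  obtain ⟨e⟩ := FiniteDimensional.nonempty_linearEquiv_iff_finrank_eq.2 h2
  obtain ⟨q, hq⟩ := LinearMap.exists_extend e.toLinearMap
  refine ⟨LinearMap.toContinuousLinearMap q, ?_⟩
  ext X
  simp only [LinearMap.mem_ker, ContinuousLinearMap.coe_coe, ContinuousLinearMap.comp_apply,
    LinearMap.coe_toContinuousLinearMap']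
  have h3 : q (D X) = e ⟨D X, X, rfl⟩ := (LinearMap.congr_fun hq ⟨D X, X, rfl⟩)
  rw [h3, LinearEquiv.map_eq_zero_iff]
  simp [Subtype.ext_iff]

/-- The constant rank theorem: a map of constant rank factors locally through a submersion `q ∘ h`,
which is the first component of a local chart. -/
theorem exists_chart_of_constant_rank {h : E → R} {O : Set E} (hO : IsOpen O) {e : E} (he : e ∈ O)
    (hh : ContDiffOn 𝕜 ∞ h O) (C : Submodule 𝕜 E) (hC : (fderiv 𝕜 h e).ker = C)
    (hrank : ∀ x ∈ O, Module.finrank 𝕜 (fderiv 𝕜 h x).ker = Module.finrank 𝕜 C)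
    (hV : Module.finrank 𝕜 V + Module.finrank 𝕜 C = Module.finrank 𝕜 E) :
    ∃ (Θ : OpenPartialHomeomorph E (V × C)) (B : Set V) (B' : Set C) (q : R →L[𝕜] V),
      e ∈ Θ.source ∧ Θ.source ⊆ O ∧ Θ.target = B ×ˢ B' ∧ ContDiffOn 𝕜 ∞ Θ Θ.source ∧
      ContDiffOn 𝕜 ∞ Θ.symm Θ.target ∧ (∀ x, (Θ x).1 = q (h x)) ∧
      (∀ x ∈ Θ.source, ∀ y ∈ Θ.source, (Θ x).1 = (Θ y).1 → h x = h y) ∧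
      (q.comp (fderiv 𝕜 h e)).ker = C := by
  have := FiniteDimensional.complete 𝕜 E
  have hd : ∀ x ∈ O, DifferentiableAt 𝕜 h x := fun x hx =>
    (hh.contDiffAt (hO.mem_nhds hx)).differentiableAt (by simp)
  obtain ⟨q, hq⟩ := exists_comp_ker_eq (V := V) (fderiv 𝕜 h e) (by rw [hC]; exact hV)
  rw [hC] at hq
  obtain ⟨κ, hκ⟩ := LinearMap.exists_leftInverse_of_injective C.subtype C.ker_subtype
  set κ' : E →L[𝕜] C := LinearMap.toContinuousLinearMap κ
  -- `q` detects the image of the derivative at `e` and `κ'` projects onto its kernel, so `F` is a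
  -- local diffeomorphism at `e`.
  set F : E → V × C := fun x => (q (h x), κ' x) with hF
  have hFd : ∀ x ∈ O, HasFDerivAt F ((q.comp (fderiv 𝕜 h x)).prod κ') x := fun x hx =>
    (q.hasFDerivAt.comp x (hd x hx).hasFDerivAt).prodMk κ'.hasFDerivAt
  have hFs : ContDiffOn 𝕜 ∞ F O := (q.contDiff.comp_contDiffOn hh).prodMk κ'.contDiff.contDiffOn
  have hfin : Module.finrank 𝕜 E = Module.finrank 𝕜 (V × C) := by
    rw [Module.finrank_prod, hV]
  have hinj : Function.Injective ((q.comp (fderiv 𝕜 h e)).prod κ').toLinearMap := by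
    rw [← LinearMap.ker_eq_bot, LinearMap.ker_eq_bot']
    intro X hX
    have hX1 : (q.comp (fderiv 𝕜 h e)) X = 0 := congrArg Prod.fst hX
    have hX2 : κ X = 0 := congrArg Prod.snd hX
    have hXC : X ∈ C := by rw [← hq]; exact hX1
    have h3 := LinearMap.congr_fun hκ ⟨X, hXC⟩
    have h4 : κ X = ⟨X, hXC⟩ := h3
    rw [hX2] at h4
    exact (congrArg Subtype.val h4).symm
  set L : E ≃L[𝕜] V × C :=
    (LinearEquiv.ofInjectiveOfFinrankEq _ hinj hfin).toContinuousLinearEquiv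
  have hL : ((L : E ≃L[𝕜] V × C) : E →L[𝕜] V × C) = (q.comp (fderiv 𝕜 h e)).prod κ' := by
    ext X <;> rfl
  have hFe : ContDiffAt 𝕜 ∞ F e := hFs.contDiffAt (hO.mem_nhds he)
  have hFL : HasFDerivAt F (L : E →L[𝕜] V × C) e := by rw [hL]; exact hFd e he
  set Θ₀ := hFe.toOpenPartialHomeomorph F hFL (by simp)
  have heΘ : e ∈ Θ₀.source := hFe.mem_toOpenPartialHomeomorph_source hFL (by simp)
  -- restrict to a neighbourhood where the derivative is invertible
  set O₁ : Set E := O ∩ (fderiv 𝕜 F) ⁻¹' Set.range ((↑) : (E ≃L[𝕜] V × C) → E →L[𝕜] V × C)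
  have hO₁ : IsOpen O₁ :=
    (hFs.continuousOn_fderiv_of_isOpen hO (by simp)).isOpen_inter_preimage hO
      (ContinuousLinearEquiv.isOpen)
  have heO₁ : e ∈ O₁ := ⟨he, L, hFL.fderiv.symm⟩
  set Θ₁ := Θ₀.restrOpen O₁ hO₁
  have heΘ₁ : e ∈ Θ₁.source := ⟨heΘ, heO₁⟩
  -- In the sup metric a ball of `V × C` is a product of balls. This gives the product form of the
  -- target, with convex fibres.
  obtain ⟨r, hr, hball⟩ := Metric.isOpen_iff.1 Θ₁.open_target _ (Θ₁.map_source heΘ₁)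
  set B := Metric.ball (Θ₁ e).1 r
  set B' := Metric.ball (Θ₁ e).2 r
  have hBB : B ×ˢ B' = Metric.ball (Θ₁ e) r := ball_prod_same _ _ _
  have hBo : IsOpen (B ×ˢ B') := by rw [hBB]; exact Metric.isOpen_ball
  set Θ := (Θ₁.symm.restrOpen (B ×ˢ B') hBo).symm
  have hΘt : Θ.target = B ×ˢ B' := by
    change Θ₁.target ∩ B ×ˢ B' = _
    rw [Set.inter_eq_right, hBB]
    exact hball
  have hΘ₁s : Θ.source ⊆ Θ₁.source := fun x hx => by
    have := Θ.map_source hx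
    have h2 := Θ.left_inv hx
    rw [← h2]
    exact Θ₁.map_target (by rw [hΘt, hBB] at this; exact hball this)
  have hΘF : ∀ x, Θ x = F x := fun x => rfl
  have hΘO₁ : Θ.source ⊆ O₁ := fun x hx => (hΘ₁s hx).2
  have heΘs : e ∈ Θ.source := by
    have h1 : Θ₁ e ∈ Θ.target := by rw [hΘt, hBB]; exact Metric.mem_ball_self hr
    have h2 := Θ.map_target h1
    have h3 : Θ.symm (Θ₁ e) = e := Θ₁.left_inv heΘ₁
    rwa [h3] at h2
  have hΘs : ContDiffOn 𝕜 ∞ Θ Θ.source := (hFs.mono fun x hx => (hΘO₁ hx).1).congr fun x _ => hΘF x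
  have hΘsymm : ∀ p ∈ Θ.target, ContDiffAt 𝕜 ∞ Θ.symm p := by
    intro p hp
    have hx := hΘO₁ (Θ.map_target hp)
    obtain ⟨L', hL'⟩ := hx.2
    refine Θ.contDiffAt_symm hp (f₀' := L') ?_ ?_
    · rw [hL']
      exact (hFd _ hx.1).differentiableAt.hasFDerivAt
    · exact hFs.contDiffAt (hO.mem_nhds hx.1)
  refine ⟨Θ, B, B', q, heΘs, fun x hx => (hΘO₁ hx).1, hΘt, hΘs,
    fun p hp => (hΘsymm p hp).contDiffWithinAt, fun x => rfl, ?_, hq⟩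
  -- the kernels of the derivatives of `h` and of `q ∘ h` agree
  have hker : ∀ x ∈ O₁, ∀ X, q (fderiv 𝕜 h x X) = 0 → fderiv 𝕜 h x X = 0 := by
    rintro x ⟨hx, L', hL'⟩ X hX
    have hsurj : Function.Surjective (q.comp (fderiv 𝕜 h x)) := by
      intro v
      obtain ⟨Y, hY⟩ := L'.surjective (v, 0)
      refine ⟨Y, ?_⟩
      have h1 : (L' : E →L[𝕜] V × C) Y = ((q.comp (fderiv 𝕜 h x)).prod κ') Y := by
        rw [hL', (hFd x hx).fderiv]
      exact congrArg Prod.fst (h1.symm.trans hY)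
    have h1 := LinearMap.finrank_range_add_finrank_ker (q.comp (fderiv 𝕜 h x)).toLinearMap
    rw [LinearMap.range_eq_top.2 hsurj, finrank_top] at h1
    have hle : (fderiv 𝕜 h x).ker ≤ (q.comp (fderiv 𝕜 h x)).ker := by
      intro Y hY
      have hY' : fderiv 𝕜 h x Y = 0 := hY
      change q (fderiv 𝕜 h x Y) = 0
      rw [hY', map_zero]
    -- Both kernels have the dimension of `C`: one by the constant rank hypothesis, the other by
    -- surjectivity onto `V`.
    have heq := Submodule.eq_of_le_of_finrank_eq hle (by
      have : Module.finrank 𝕜 (LinearMap.ker (q.comp (fderiv 𝕜 h x)).toLinearMap) =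
        Module.finrank 𝕜 (q.comp (fderiv 𝕜 h x)).ker := rfl
      have := hrank x hx
      omega)
    have : X ∈ (q.comp (fderiv 𝕜 h x)).ker := hX
    rw [← heq] at this
    exact this
  intro x hx y hy hxy
  -- Along a fibre `q ∘ h` is constant, so by equality of kernels the derivative of `h` vanishes
  -- there too, and the fibre is convex.
  have hconst : ∀ u ∈ B, ∀ v ∈ B', ∀ w ∈ B', h (Θ.symm (u, v)) = h (Θ.symm (u, w)) := by
    intro u hu v hv w hw
    let A : NormedSpace ℝ C := .restrictScalars ℝ 𝕜 C
    have hder : ∀ c ∈ B', HasFDerivAt (fun c => h (Θ.symm (u, c))) (0 : C →L[𝕜] R) c := by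
      intro c hc
      have hp : (u, c) ∈ Θ.target := by rw [hΘt]; exact ⟨hu, hc⟩
      have hxO := hΘO₁ (Θ.map_target hp)
      have h1 := ((hΘsymm _ hp).differentiableAt (by simp)).hasFDerivAt.comp c
        (hasFDerivAt_prodMk_right (𝕜 := 𝕜) u c)
      have h2 := (hd _ hxO.1).hasFDerivAt.comp c h1
      have h3 := (q.hasFDerivAt (x := h (Θ.symm (u, c)))).comp c h2
      have h4 : HasFDerivAt (fun c => q (h (Θ.symm (u, c)))) (0 : C →L[𝕜] V) c := by
        refine (hasFDerivAt_const u c).congr_of_eventuallyEq ?_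
        filter_upwards [Metric.isOpen_ball.mem_nhds hc] with z hz
        have hz' : (u, z) ∈ Θ.target := by rw [hΘt]; exact ⟨hu, hz⟩
        exact congrArg Prod.fst (Θ.right_inv hz')
      have h5 := h3.unique h4
      refine h2.congr_fderiv ?_
      ext X
      exact hker _ hxO _ (DFunLike.congr_fun h5 X)
    have hconv : Convex ℝ B' := convex_ball _ _
    exact hconv.is_const_of_fderivWithin_eq_zero (𝕜 := 𝕜) (f := fun c : C => h (Θ.symm (u, c)))
      (fun c hc => (hder c hc).differentiableAt.differentiableWithinAt)
      (fun c hc => by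
        rw [fderivWithin_of_isOpen Metric.isOpen_ball hc]
        exact (hder c hc).fderiv) hv hw
  have hx' := Θ.map_source hx
  have hy' := Θ.map_source hy
  rw [hΘt] at hx' hy'
  have := hconst _ hx'.1 _ hx'.2 _ hy'.2
  rw [Prod.mk.eta, Θ.left_inv hx, hxy, Prod.mk.eta, Θ.left_inv hy] at this
  exact this

end ConstantRank

/-! ### Charts of a Lie group adapted to the cosets of a subgroup. -/

section Slice

variable {𝕜 : Type*} [RCLike 𝕜]
  {E : Type*} [NormedAddCommGroup E] [NormedSpace 𝕜 E] [FiniteDimensional 𝕜 E]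
  {G : Type*} [TopologicalSpace G] [ChartedSpace E G] [Group G] [LieGroup 𝓘(𝕜, E) ∞ G]

theorem finrank_ker_of_injective {R : Type*} [AddCommGroup R] [Module 𝕜 R] {C : Submodule 𝕜 E}
    {A : E →ₗ[𝕜] R} {S : E →ₗ[𝕜] E} (hS : Function.Injective S) (h : ∀ v, A v = 0 ↔ S v ∈ C) :
    Module.finrank 𝕜 (LinearMap.ker A) = Module.finrank 𝕜 C := by
  have e : LinearMap.ker A = C.comap (LinearEquiv.ofInjectiveEndo S hS).toLinearMap := by
    ext v; exact h v
  rw [e]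
  exact (LinearEquiv.ofSubmodule' (LinearEquiv.ofInjectiveEndo S hS) C).finrank_eq

theorem modelDeriv_chart_symm_injective {M : Type*} [TopologicalSpace M] [ChartedSpace E M]
    [IsManifold 𝓘(𝕜, E) ∞ M] (x : M) {y : E} (hy : y ∈ (chartAt E x).target) :
    Function.Injective (modelDeriv 𝕜 E E (chartAt E x).symm y) := by
  set φ := chartAt E x
  have h1 : MDifferentiableAt 𝓘(𝕜, E) 𝓘(𝕜, E) φ.symm y :=
    ((contMDiffOn_chart_symm (I := 𝓘(𝕜, E)) (n := ∞) (x := x)).contMDiffAt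
      (φ.open_target.mem_nhds hy)).mdifferentiableAt (by simp)
  have h2 : MDifferentiableAt 𝓘(𝕜, E) 𝓘(𝕜, E) φ (φ.symm y) :=
    ((contMDiffOn_chart (I := 𝓘(𝕜, E)) (n := ∞) (x := x)).contMDiffAt
      (φ.open_source.mem_nhds (φ.map_target hy))).mdifferentiableAt (by simp)
  have h3 : modelDeriv 𝕜 E E (φ ∘ φ.symm) y = ContinuousLinearMap.id 𝕜 E := by
    rw [modelDeriv_congr (g := id), modelDeriv_id]
    filter_upwards [φ.open_target.mem_nhds hy] with z hz
    exact φ.right_inv hz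
  intro a b hab
  have h4 := fun v => modelDeriv_comp_apply y h2 h1 v
  rw [h3] at h4
  have := (h4 a).trans ((congrArg _ hab).trans (h4 b).symm)
  exact this

/-- A map which separates the cosets of a subgroup and whose derivative has constant kernel in the
left-invariant trivialization gives a chart adapted to the cosets. -/
theorem exists_slice_chart {R : Type*} [NormedAddCommGroup R] [NormedSpace 𝕜 R]
    [FiniteDimensional 𝕜 R] {V : Type*} [NormedAddCommGroup V] [NormedSpace 𝕜 V]
    [FiniteDimensional 𝕜 V] {f : G → R} {U : Set G} (hU : IsOpen U) (h1 : (1 : G) ∈ U)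
    (hf : ContMDiffOn 𝓘(𝕜, E) 𝓘(𝕜, R) ∞ f U) {P : Subgroup G}
    (hP : ∀ g ∈ U, ∀ h ∈ U, f g = f h ↔ g⁻¹ * h ∈ P) {C : Submodule 𝕜 E}
    (hC : ∀ g ∈ U, ∀ X, modelDeriv 𝕜 E R f g (leftField 𝕜 E g X) = 0 ↔ X ∈ C)
    (hV : Module.finrank 𝕜 V + Module.finrank 𝕜 C = Module.finrank 𝕜 E) :
    ∃ (Ψ : OpenPartialHomeomorph G (V × C)) (B : Set V) (B' : Set C),
      1 ∈ Ψ.source ∧ Ψ.target = B ×ˢ B' ∧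
      ContMDiffOn 𝓘(𝕜, E) 𝓘(𝕜, V × C) ∞ Ψ Ψ.source ∧
      ContMDiffOn 𝓘(𝕜, V × C) 𝓘(𝕜, E) ∞ Ψ.symm Ψ.target ∧
      (∀ g ∈ Ψ.source, ∀ h ∈ Ψ.source, (Ψ g).1 = (Ψ h).1 ↔ g⁻¹ * h ∈ P) ∧
      (∀ X, modelDeriv 𝕜 E V (fun g => (Ψ g).1) 1 X = 0 ↔ X ∈ C) := by
  set φ := chartAt E (1 : G) with hφ
  have hφs : ContMDiffOn 𝓘(𝕜, E) 𝓘(𝕜, E) ∞ φ φ.source := contMDiffOn_chart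
  have hφt : ContMDiffOn 𝓘(𝕜, E) 𝓘(𝕜, E) ∞ φ.symm φ.target := contMDiffOn_chart_symm
  have h1s : (1 : G) ∈ φ.source := mem_chart_source E 1
  have hfd : ∀ g ∈ U, MDifferentiableAt 𝓘(𝕜, E) 𝓘(𝕜, R) f g := fun g hg =>
    (hf.contMDiffAt (hU.mem_nhds hg)).mdifferentiableAt (by simp)
  set O : Set E := φ.target ∩ φ.symm ⁻¹' U
  have hO : IsOpen O := φ.symm.isOpen_inter_preimage hU
  have heO : φ 1 ∈ O := ⟨φ.map_source h1s, by rw [Set.mem_preimage, φ.left_inv h1s]; exact h1⟩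
  have hh : ContDiffOn 𝕜 ∞ (f ∘ φ.symm) O := by
    rw [← contMDiffOn_iff_contDiffOn]
    exact hf.comp (hφt.mono Set.inter_subset_left) fun x hx => hx.2
  have hd : ∀ x ∈ O, fderiv 𝕜 (f ∘ φ.symm) x =
      (modelDeriv 𝕜 E R f (φ.symm x)).comp (modelDeriv 𝕜 E E φ.symm x) := by
    intro x hx
    rw [← modelDeriv_eq_fderiv, modelDeriv_comp x (hfd _ hx.2)
      ((hφt.contMDiffAt (φ.open_target.mem_nhds hx.1)).mdifferentiableAt (by simp))]
  have hf1 : modelDeriv 𝕜 E R f 1 = fderiv 𝕜 (f ∘ φ.symm) (φ 1) :=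
    modelDeriv_eq_fderiv_chart (hfd 1 h1)
  have hCe : (fderiv 𝕜 (f ∘ φ.symm) (φ 1)).ker = C := by
    ext X
    have := hC 1 h1 X
    rw [leftField_one] at this
    rw [← this, ← hf1]
    rfl
  have hrank : ∀ x ∈ O, Module.finrank 𝕜 (fderiv 𝕜 (f ∘ φ.symm) x).ker =
      Module.finrank 𝕜 C := by
    intro x hx
    -- In the left trivialization the kernel is always `C`; here it is its preimage under an
    -- isomorphism, which gives constant rank.
    set θ := LinearEquiv.ofBijective (leftField 𝕜 E (φ.symm x)).toLinearMap
      ⟨leftField_injective _, leftField_surjective _⟩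
    refine finrank_ker_of_injective
      (S := θ.symm.toLinearMap.comp (modelDeriv 𝕜 E E φ.symm x).toLinearMap) ?_ ?_
    · exact θ.symm.injective.comp (modelDeriv_chart_symm_injective 1 hx.1)
    · intro v
      have h3 := hC _ hx.2 (θ.symm (modelDeriv 𝕜 E E φ.symm x v))
      have h4 : leftField 𝕜 E (φ.symm x) (θ.symm (modelDeriv 𝕜 E E φ.symm x v)) =
        modelDeriv 𝕜 E E φ.symm x v := θ.apply_symm_apply _
      rw [h4] at h3
      rw [hd x hx]
      exact h3
  obtain ⟨Θ, B, B', q, heΘ, hΘO, hΘt, hΘs, hΘsymm, hΘq, hΘinj, hΘker⟩ :=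
    exists_chart_of_constant_rank hO heO hh C hCe hrank hV
  have hsrc : ∀ g ∈ (φ.trans Θ).source, g ∈ φ.source ∧ φ g ∈ Θ.source ∧ g ∈ U := by
    intro g hg
    rw [OpenPartialHomeomorph.trans_source] at hg
    refine ⟨hg.1, hg.2, ?_⟩
    have := (hΘO hg.2).2
    rwa [Set.mem_preimage, φ.left_inv hg.1] at this
  have hval : ∀ g ∈ (φ.trans Θ).source, ((φ.trans Θ) g).1 = q (f g) := by
    intro g hg
    have h2 : ((φ.trans Θ) g).1 = q (f (φ.symm (φ g))) := hΘq (φ g)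
    rw [h2, φ.left_inv (hsrc g hg).1]
  have h1Ψ : (1 : G) ∈ (φ.trans Θ).source := by
    rw [OpenPartialHomeomorph.trans_source]; exact ⟨h1s, heΘ⟩
  refine ⟨φ.trans Θ, B, B', h1Ψ, ?_, ?_, ?_, ?_, ?_⟩
  · rw [OpenPartialHomeomorph.trans_target, hΘt, Set.inter_eq_left]
    intro p hp
    exact (hΘO (Θ.map_target (hΘt ▸ hp))).1
  · exact (contMDiffOn_iff_contDiffOn.2 hΘs).comp (hφs.mono fun g hg => (hsrc g hg).1)
      fun g hg => (hsrc g hg).2.1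
  · refine hφt.comp ((contMDiffOn_iff_contDiffOn.2 hΘsymm).mono ?_) ?_
    · rw [OpenPartialHomeomorph.trans_target]; exact Set.inter_subset_left
    · intro p hp
      rw [OpenPartialHomeomorph.trans_target] at hp
      exact hp.2
  · intro g hg h hh'
    rw [← hP g (hsrc g hg).2.2 h (hsrc h hh').2.2]
    constructor
    · intro heq
      have := hΘinj _ (hsrc g hg).2.1 _ (hsrc h hh').2.1 heq
      simpa only [Function.comp, φ.left_inv (hsrc g hg).1, φ.left_inv (hsrc h hh').1] using this
    · intro heq
      rw [hval g hg, hval h hh', heq]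
  · intro X
    have h2 : modelDeriv 𝕜 E V (fun g => ((φ.trans Θ) g).1) 1 = modelDeriv 𝕜 E V (q ∘ f) 1 := by
      apply modelDeriv_congr
      filter_upwards [(φ.trans Θ).open_source.mem_nhds h1Ψ] with g hg
      exact hval g hg
    rw [h2, modelDeriv_comp 1 (q.mdifferentiableAt) (hfd 1 h1), modelDeriv_eq_fderiv,
      q.fderiv, hf1, ← hΘker]
    rfl

end Slice

/-! ### A smooth map separating the cosets of the stabilizer of an idempotent's image. -/

section StabilizerMap

variable {𝕜 : Type*} [RCLike 𝕜]
  {E : Type*} [NormedAddCommGroup E] [NormedSpace 𝕜 E]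
  {G : Type*} [TopologicalSpace G] [ChartedSpace E G] [Group G] [LieGroup 𝓘(𝕜, E) ∞ G]
  {R : Type*} [NormedRing R] [NormedAlgebra 𝕜 R]

/-- The product rule for functions with values in a normed algebra. -/
theorem modelDeriv_mul {M : Type*} [TopologicalSpace M] [ChartedSpace E M]
    [IsManifold 𝓘(𝕜, E) ∞ M] {u v : M → R} {x : M}
    (hu : MDifferentiableAt 𝓘(𝕜, E) 𝓘(𝕜, R) u x)
    (hv : MDifferentiableAt 𝓘(𝕜, E) 𝓘(𝕜, R) v x) (X : E) :
    modelDeriv 𝕜 E R (fun y => u y * v y) x X =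
      u x * modelDeriv 𝕜 E R v x X + modelDeriv 𝕜 E R u x X * v x := by
  have hu' := hu.differentiableAt_comp_extChartAt_symm
  have hv' := hv.differentiableAt_comp_extChartAt_symm
  have hx : (extChartAt 𝓘(𝕜, E) x).symm (extChartAt 𝓘(𝕜, E) x x) = x := extChartAt_to_inv x
  have huv : MDifferentiableAt 𝓘(𝕜, E) 𝓘(𝕜, R) (fun y => u y * v y) x :=
    DifferentiableAt.comp_mdifferentiableAt (g := fun p : R × R => p.1 * p.2)
      (differentiableAt_fst.mul differentiableAt_snd) (hu.prodMk_space hv)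
  rw [modelDeriv_eq_fderiv_chart huv, modelDeriv_eq_fderiv_chart hu, modelDeriv_eq_fderiv_chart hv]
  have h1 := (hu'.hasFDerivAt.mul' hv'.hasFDerivAt).fderiv
  simp only [Function.comp_def, Pi.mul_def, hx] at h1 ⊢
  rw [h1]
  simp

variable [CompleteSpace R]

/-- For a representation `A` of `G` in the algebra `R` and an idempotent `π`, the element
`A g * π + (1 - π)` of `R`. -/
def frameElement (A : G → R) (π : R) (g : G) : R := A g * π + (1 - π)

/-- The idempotent whose image is that of `A g * π` and whose kernel is that of `π`. -/
def movedIdempotent (A : G → R) (π : R) (g : G) : R :=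
  frameElement A π g * π * Ring.inverse (frameElement A π g)

variable {A : G → R} {π : R}

theorem frameElement_mul_idempotent (hπ : π * π = π) (g : G) :
    frameElement A π g * π = A g * π := by
  simp [frameElement, add_mul, sub_mul, mul_assoc, hπ]

theorem movedIdempotent_mul {g : G} (hg : IsUnit (frameElement A π g)) :
    movedIdempotent A π g * frameElement A π g = frameElement A π g * π := by
  rw [movedIdempotent, mul_assoc, Ring.inverse_mul_cancel _ hg, mul_one]

/-- All moved idempotents share the kernel of `π`, so they agree iff their images do, that is, iff
`A (g⁻¹ * h)` preserves the image of `π`. Inclusion of images suffices because the frame elements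
are units. -/
theorem movedIdempotent_eq_iff (hπ : π * π = π) (A1 : A 1 = 1)
    (Amul : ∀ g h, A (g * h) = A g * A h) {g h : G} (hg : IsUnit (frameElement A π g))
    (hh : IsUnit (frameElement A π h)) :
    movedIdempotent A π g = movedIdempotent A π h ↔ π * A (g⁻¹ * h) * π = A (g⁻¹ * h) * π := by
  set M := frameElement A π g with hM
  set N := frameElement A π h with hN
  have hMπ : M * π = A g * π := frameElement_mul_idempotent hπ g
  have hNπ : N * π = A h * π := frameElement_mul_idempotent hπ h
  have hMM : Ring.inverse M * M = 1 := Ring.inverse_mul_cancel _ hg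
  have hNN : Ring.inverse N * N = 1 := Ring.inverse_mul_cancel _ hh
  have hgg : A g⁻¹ * A g = 1 := by rw [← Amul, inv_mul_cancel, A1]
  have hgg' : A g * A g⁻¹ = 1 := by rw [← Amul, mul_inv_cancel, A1]
  have e1 : movedIdempotent A π g = movedIdempotent A π h ↔
      M * π * Ring.inverse M * N = N * π := by
    constructor
    · intro he
      have := congrArg (· * N) he
      simp only [movedIdempotent_mul hh, hN] at this
      exact this
    · intro he
      have := congrArg (· * Ring.inverse N) he
      simp only [mul_assoc, Ring.mul_inverse_cancel _ hh, mul_one] at this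
      simpa only [movedIdempotent, mul_assoc] using this
  rw [e1, Amul]
  constructor
  · intro he
    -- `A h * π = A g * π * Y`
    have h2 : A h * π = A g * π * (Ring.inverse M * N * π) := by
      have := congrArg (· * π) he
      simp only [mul_assoc, hπ] at this
      rw [← hNπ, ← this, ← hMπ]
      simp only [mul_assoc]
    have h3 : A g⁻¹ * A h * π = π * (Ring.inverse M * N * π) := by
      rw [mul_assoc, h2, mul_assoc (A g), ← mul_assoc, hgg, one_mul]
    rw [mul_assoc π, h3, ← mul_assoc, hπ]
  · intro he
    have h2 : N * π = M * (π * A g⁻¹ * A h * π) := by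
      have := congrArg (A g * ·) he
      simp only [← mul_assoc, hgg', one_mul] at this
      rw [hNπ, ← this, ← hMπ]
      simp only [mul_assoc]
    have h3 : N * π = M * π * Ring.inverse M * N * π := by
      rw [mul_assoc _ N, h2]
      simp only [mul_assoc]
      rw [← mul_assoc (Ring.inverse M) M, hMM, one_mul]
      simp only [← mul_assoc π π, hπ]
    -- The identity to prove was checked after multiplication by `π`; after multiplication by `1 -
    -- π` both sides vanish.
    have hc : ∀ g, frameElement A π g * (1 - π) = 1 - π := fun g => by
      simp [frameElement, mul_sub, add_mul, mul_assoc, hπ, sub_mul]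
    have h4 : Ring.inverse M * (1 - π) = 1 - π := by
      have := congrArg (Ring.inverse M * ·) (hc g)
      simp only [← mul_assoc] at this
      rw [← hM, hMM, one_mul] at this
      exact this.symm
    have h5 : M * π * Ring.inverse M * N * (1 - π) = 0 := by
      rw [mul_assoc _ N, hN, hc, mul_assoc _ (Ring.inverse M), h4, mul_assoc, mul_sub, mul_one, hπ,
        sub_self, mul_zero]
    rw [mul_sub, mul_one, ← h3, sub_eq_zero] at h5
    exact h5

theorem isOpen_isUnit_frameElement (hA : ContMDiff 𝓘(𝕜, E) 𝓘(𝕜, R) ∞ A) :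
    IsOpen {g | IsUnit (frameElement A π g)} :=
  Units.isOpen.preimage ((hA.continuous.mul continuous_const).add continuous_const)

theorem isUnit_frameElement_one (A1 : A 1 = 1) : IsUnit (frameElement A π 1) := by
  simp [frameElement, A1]

theorem contMDiff_frameElement (hA : ContMDiff 𝓘(𝕜, E) 𝓘(𝕜, R) ∞ A) :
    ContMDiff 𝓘(𝕜, E) 𝓘(𝕜, R) ∞ (frameElement A π) := by
  have : ContDiff 𝕜 ∞ (fun r : R => r * π + (1 - π)) := by fun_prop
  exact this.contMDiff.comp hA

theorem contMDiffOn_movedIdempotent (hA : ContMDiff 𝓘(𝕜, E) 𝓘(𝕜, R) ∞ A) :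
    ContMDiffOn 𝓘(𝕜, E) 𝓘(𝕜, R) ∞ (movedIdempotent A π) {g | IsUnit (frameElement A π g)} := by
  intro g hg
  obtain ⟨m, hm⟩ : IsUnit (frameElement A π g) := hg
  have h1 : ContDiffAt 𝕜 ∞ (fun r : R => r * π * Ring.inverse r) (frameElement A π g) := by
    rw [← hm]
    exact (contDiffAt_id.mul contDiffAt_const).mul (contDiffAt_ringInverse 𝕜 m)
  exact (h1.comp_contMDiffAt (contMDiff_frameElement hA g)).contMDiffWithinAt

/-- Infinitesimal form of the coset criterion, valid at every g and with a condition independent of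
g. This independence is what gives constant rank. -/
theorem modelDeriv_movedIdempotent_eq_zero_iff (hπ : π * π = π) (A1 : A 1 = 1)
    (Amul : ∀ g h, A (g * h) = A g * A h) (hA : ContMDiff 𝓘(𝕜, E) 𝓘(𝕜, R) ∞ A) {g : G}
    (hg : IsUnit (frameElement A π g)) (X : E) :
    modelDeriv 𝕜 E R (movedIdempotent A π) g (leftField 𝕜 E g X) = 0 ↔
      π * modelDeriv 𝕜 E R A 1 X * π = modelDeriv 𝕜 E R A 1 X * π := by
  set a := modelDeriv 𝕜 E R A 1 X with ha
  set M := frameElement A π g with hM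
  set D := modelDeriv 𝕜 E R (movedIdempotent A π) g (leftField 𝕜 E g X)
  have hMπ : M * π = A g * π := frameElement_mul_idempotent hπ g
  have hMM : Ring.inverse M * M = 1 := Ring.inverse_mul_cancel _ hg
  have hMM' : M * Ring.inverse M = 1 := Ring.mul_inverse_cancel _ hg
  have hgg : A g⁻¹ * A g = 1 := by rw [← Amul, inv_mul_cancel, A1]
  have hU := isOpen_isUnit_frameElement (𝕜 := 𝕜) (E := E) (π := π) hA
  have hMd : MDifferentiableAt 𝓘(𝕜, E) 𝓘(𝕜, R) (frameElement A π) g :=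
    (contMDiff_frameElement hA).mdifferentiableAt (by simp)
  have hfd : MDifferentiableAt 𝓘(𝕜, E) 𝓘(𝕜, R) (movedIdempotent A π) g :=
    ((contMDiffOn_movedIdempotent hA).contMDiffAt (hU.mem_nhds hg)).mdifferentiableAt (by simp)
  have hdM : modelDeriv 𝕜 E R (frameElement A π) g (leftField 𝕜 E g X) = A g * a * π := by
    rw [← modelDeriv_mul_left_one_comp hMd]
    have e : (fun x => frameElement A π (g * x)) = (fun r : R => A g * r * π + (1 - π)) ∘ A := by
      funext x; simp [frameElement, Amul]
    have h1 : HasFDerivAt (fun r : R => A g * r * π + (1 - π))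
        (((ContinuousLinearMap.mul 𝕜 R).flip π).comp (ContinuousLinearMap.mul 𝕜 R (A g))) (A 1) :=
      (((ContinuousLinearMap.mul 𝕜 R).flip π).comp
        (ContinuousLinearMap.mul 𝕜 R (A g))).hasFDerivAt.add_const _
    rw [e, modelDeriv_comp_apply 1 h1.differentiableAt.mdifferentiableAt
      (hA.mdifferentiableAt (by simp)), modelDeriv_eq_fderiv, h1.fderiv]
    rfl
  -- Differentiating `movedIdempotent * frameElement = frameElement * π` avoids the derivative of
  -- the inverse.
  have hp := modelDeriv_mul hfd hMd (leftField 𝕜 E g X)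
  have hp' := modelDeriv_mul hMd (mdifferentiableAt_const (c := π)) (leftField 𝕜 E g X)
  have e : (fun y => movedIdempotent A π y * frameElement A π y) =ᶠ[𝓝 g]
      fun y => frameElement A π y * π := by
    filter_upwards [hU.mem_nhds hg] with y hy
    exact movedIdempotent_mul hy
  rw [modelDeriv_congr e, hp', hdM] at hp
  rw [show modelDeriv 𝕜 E R (fun _ : G => π) g = 0 from modelDeriv_const π g] at hp
  simp only [zero_apply, mul_zero, zero_add, mul_assoc _ π π, hπ] at hp
  -- `A g * a * π = f * (A g * a * π) + D * M`
  have hD : D = 0 ↔ A g * a * π = movedIdempotent A π g * (A g * a * π) := by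
    constructor
    · intro h0
      have := hp
      change _ = _ + D * M at this
      rwa [h0, zero_mul, add_zero] at this
    · intro h0
      have h1 : D * M = 0 := by
        have := hp
        change _ = _ + D * M at this
        rw [← h0] at this
        simpa using this
      have := congrArg (· * Ring.inverse M) h1
      simpa [mul_assoc, hMM'] using this
  rw [hD, movedIdempotent, ← hM, hMπ]
  constructor
  · intro h
    have h1 : a * π = π * (Ring.inverse M * (A g * a * π)) := by
      have := congrArg (A g⁻¹ * ·) h
      simp only [← mul_assoc, hgg, one_mul] at this
      simpa only [mul_assoc] using this
    rw [mul_assoc, h1, ← mul_assoc, hπ]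
  · intro h
    have h1 : A g * a * π = M * (π * (a * π)) := by
      rw [← mul_assoc, hMπ, mul_assoc (A g), mul_assoc (A g), ← mul_assoc π, h]
    rw [h1, ← hMπ, mul_assoc _ (Ring.inverse M), ← mul_assoc (Ring.inverse M), hMM, one_mul,
      mul_assoc, ← mul_assoc π π, hπ]

end StabilizerMap

/-! ### Algebra of |k|-gradings. -/

section GradingAlgebra

namespace KGrading

variable {𝕜 : Type*} [Field 𝕜] {L : Type*} [LieRing L] [LieAlgebra 𝕜 L] {k : ℕ}
  (𝔤 : KGrading 𝕜 L k)

theorem comp_le_filt {i j : ℤ} (h : i ≤ j) : 𝔤.comp j ≤ 𝔤.filt i := le_iSup₂_of_le j h le_rfl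

theorem filt_le_iff {i : ℤ} {S : Submodule 𝕜 L} :
    𝔤.filt i ≤ S ↔ ∀ j, i ≤ j → 𝔤.comp j ≤ S := iSup₂_le_iff

theorem filt_antitone {i j : ℤ} (h : i ≤ j) : 𝔤.filt j ≤ 𝔤.filt i :=
  𝔤.filt_le_iff.2 fun _ hl => 𝔤.comp_le_filt (h.trans hl)

theorem lie_mem_filt {i j : ℤ} {X Y : L} (hX : X ∈ 𝔤.filt i) (hY : Y ∈ 𝔤.filt j) :
    ⁅X, Y⁆ ∈ 𝔤.filt (i + j) := by
  have h1 : ∀ l, j ≤ l → ∀ Z ∈ 𝔤.comp l, ⁅X, Z⁆ ∈ 𝔤.filt (i + j) := by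
    intro l hl Z hZ
    have : 𝔤.filt i ≤ (𝔤.filt (i + j)).comap (LieModule.toEnd 𝕜 L L Z) := by
      refine 𝔤.filt_le_iff.2 fun m hm W hW => ?_
      exact 𝔤.comp_le_filt (by omega) (𝔤.lie_mem l m Z W hZ hW)
    rw [← lie_skew]
    exact neg_mem (this hX)
  have : 𝔤.filt j ≤ (𝔤.filt (i + j)).comap (LieModule.toEnd 𝕜 L L X) :=
    𝔤.filt_le_iff.2 fun l hl Z hZ => h1 l hl Z hZ
  exact this hY

theorem iSup_comp : ⨆ i, 𝔤.comp i = ⊤ := 𝔤.isInternal.submodule_iSup_eq_top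

theorem comp_eq_bot_of_lt {i : ℤ} (h : i < -k) : 𝔤.comp i = ⊥ :=
  𝔤.comp_eq_bot i (by rw [abs_of_neg (by omega)]; omega)

theorem filt_eq_top {i : ℤ} (h : i ≤ -k) : 𝔤.filt i = ⊤ := by
  rw [eq_top_iff, ← 𝔤.iSup_comp]
  refine iSup_le fun j => ?_
  rcases lt_or_ge j i with hj | hj
  · rw [𝔤.comp_eq_bot_of_lt (hj.trans_le h)]; exact bot_le
  · exact 𝔤.comp_le_filt hj

theorem filt_eq_bot {i : ℤ} (h : k < i) : 𝔤.filt i = ⊥ := by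
  rw [eq_bot_iff]
  refine 𝔤.filt_le_iff.2 fun j hj => ?_
  rw [𝔤.comp_eq_bot j (by rw [abs_of_pos (by omega)]; omega)]

/-- The sum of the components of degree less than `i`. -/
def low (i : ℤ) : Submodule 𝕜 L := ⨆ (j : ℤ) (_ : j < i), 𝔤.comp j

theorem comp_le_low {i j : ℤ} (h : j < i) : 𝔤.comp j ≤ 𝔤.low i := le_iSup₂_of_le j h le_rfl

theorem isCompl_filt_low (i : ℤ) : IsCompl (𝔤.filt i) (𝔤.low i) := by
  constructor
  · refine iSupIndep.disjoint_biSup_biSup (s := {j | i ≤ j}) (t := {j | j < i})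
      𝔤.isInternal.submodule_iSupIndep ?_
    rw [Set.disjoint_left]
    intro j (h1 : i ≤ j) (h2 : j < i)
    omega
  · rw [codisjoint_iff, eq_top_iff, ← 𝔤.iSup_comp]
    refine iSup_le fun j => ?_
    rcases lt_or_ge j i with hj | hj
    · exact (𝔤.comp_le_low hj).trans le_sup_right
    · exact (𝔤.comp_le_filt hj).trans le_sup_left

theorem comp_sup_filt (i : ℤ) : 𝔤.comp i ⊔ 𝔤.filt (i + 1) = 𝔤.filt i := by
  apply le_antisymm
  · exact sup_le (𝔤.comp_le_filt le_rfl) (𝔤.filt_antitone (by omega))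
  · refine 𝔤.filt_le_iff.2 fun j hj => ?_
    rcases hj.eq_or_lt with rfl | hj
    · exact le_sup_left
    · exact (𝔤.comp_le_filt (by omega)).trans le_sup_right

theorem disjoint_comp_filt {i j : ℤ} (h : i < j) : Disjoint (𝔤.comp i) (𝔤.filt j) :=
  ((𝔤.isCompl_filt_low j).disjoint.mono_right (𝔤.comp_le_low h)).symm

theorem eq_zero_of_mem_comp_of_mem_filt {i j : ℤ} (h : i < j) {X : L} (h1 : X ∈ 𝔤.comp i)
    (h2 : X ∈ 𝔤.filt j) : X = 0 :=
  Submodule.disjoint_def.1 (𝔤.disjoint_comp_filt h) X h1 h2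

theorem exists_add_of_mem_filt {i : ℤ} {X : L} (hX : X ∈ 𝔤.filt i) :
    ∃ Y ∈ 𝔤.comp i, ∃ Z ∈ 𝔤.filt (i + 1), Y + Z = X := by
  rwa [← 𝔤.comp_sup_filt, Submodule.mem_sup] at hX

theorem comp_le_neg {i : ℤ} (h : i < 0) : 𝔤.comp i ≤ 𝔤.neg.toSubmodule := 𝔤.comp_le_low h

theorem isCompl_filt_zero_neg : IsCompl (𝔤.filt 0) 𝔤.neg.toSubmodule := 𝔤.isCompl_filt_low 0

theorem finrank_neg_add_finrank_filt [FiniteDimensional 𝕜 L] :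
    Module.finrank 𝕜 𝔤.neg + Module.finrank 𝕜 (𝔤.filt 0) = Module.finrank 𝕜 L := by
  rw [add_comm]
  exact Submodule.finrank_add_eq_of_isCompl 𝔤.isCompl_filt_zero_neg

/-- The subalgebra of degree zero of the filtration is the stabilizer of the filtration. -/
theorem mem_filt_zero_iff (hc : LieAlgebra.center 𝕜 L = ⊥) (X : L) :
    X ∈ 𝔤.filt 0 ↔ ∀ i, ∀ Y ∈ 𝔤.filt i, ⁅X, Y⁆ ∈ 𝔤.filt i := by
  constructor
  · intro hX i Y hY
    have := 𝔤.lie_mem_filt hX hY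
    rwa [zero_add] at this
  · intro h
    have key : ∀ m : ℕ, X ∈ 𝔤.filt (-m) → X ∈ 𝔤.filt 0 := by
      intro m
      induction m with
      | zero => intro hX; simpa using hX
      | succ m ih =>
        intro hX
        apply ih
        obtain ⟨A, hA, B, hB, rfl⟩ := 𝔤.exists_add_of_mem_filt hX
        rw [show (-((m + 1 : ℕ) : ℤ) + 1) = -m by push_cast; ring] at hB
        -- The bracket is homogeneous of degree `j - m - 1`. As `A + B` preserves the filtration and
        -- `B` has degrees at least `-m`, it also lies in the filtration component `j - m`; so it
        -- vanishes.
        have h1 : ∀ j, ∀ Y ∈ 𝔤.comp j, ⁅A, Y⁆ = 0 := by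
          intro j Y hY
          refine 𝔤.eq_zero_of_mem_comp_of_mem_filt (j := -m + j) ?_
            (𝔤.lie_mem _ _ A Y hA hY) ?_
          · push_cast; omega
          · have e : ⁅A, Y⁆ = ⁅A + B, Y⁆ - ⁅B, Y⁆ := by rw [add_lie]; abel
            rw [e]
            have hY' := 𝔤.comp_le_filt le_rfl hY
            exact sub_mem (𝔤.filt_antitone (by omega) (h j Y hY')) (𝔤.lie_mem_filt hB hY')
        have h2 : (⊤ : Submodule 𝕜 L) ≤ LinearMap.ker (LieModule.toEnd 𝕜 L L A) := by
          rw [← 𝔤.iSup_comp]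
          exact iSup_le fun j Y hY => h1 j Y hY
        have h3 : A ∈ LieAlgebra.center 𝕜 L := by
          rw [LieAlgebra.center, LieModule.mem_maxTrivSubmodule]
          intro Y
          rw [← lie_skew, show ⁅A, Y⁆ = 0 from h2 (Submodule.mem_top (x := Y)), neg_zero]
        rw [hc, LieSubmodule.mem_bot] at h3
        rw [h3, zero_add]
        exact hB
    apply key k
    rw [𝔤.filt_eq_top le_rfl]
    trivial

/-- The iterated brackets with elements of degree `-1`. -/
def iteratedComp : ℕ → Submodule 𝕜 L
  | 0 => 𝔤.comp (-1)
  | n + 1 => Submodule.span 𝕜 {Z | ∃ X ∈ iteratedComp n, ∃ Y ∈ 𝔤.comp (-1), ⁅X, Y⁆ = Z}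

theorem iteratedComp_le (n : ℕ) : 𝔤.iteratedComp n ≤ 𝔤.comp (-(n + 1 : ℕ)) := by
  induction n with
  | zero => exact le_rfl
  | succ n ih =>
    refine Submodule.span_le.2 ?_
    rintro _ ⟨X, hX, Y, hY, rfl⟩
    have := 𝔤.lie_mem _ _ X Y (ih hX) hY
    rwa [show (-((n + 1 : ℕ) : ℤ) + -1) = -((n + 1 + 1 : ℕ) : ℤ) by push_cast; ring] at this

/-- The elements whose adjoint action preserves the sum W of iterated brackets form a subalgebra
containing degree −1, hence all of 𝔤₋. Since W ⊆ 𝔤₋, W is closed under the bracket, and generation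
by degree −1 applies again. -/
theorem neg_le_iSup_iteratedComp : 𝔤.neg.toSubmodule ≤ ⨆ n, 𝔤.iteratedComp n := by
  set W := ⨆ n, 𝔤.iteratedComp n with hW
  have hn : ∀ n, 𝔤.iteratedComp n ≤ W := fun n => le_iSup _ n
  have hadd : ∀ {X Y Z : L}, ⁅⁅X, Y⁆, Z⁆ = ⁅X, ⁅Y, Z⁆⁆ - ⁅Y, ⁅X, Z⁆⁆ := fun {X Y Z} =>
    lie_lie X Y Z
  let N : LieSubalgebra 𝕜 L :=
    { carrier := {Y | ∀ X ∈ W, ⁅Y, X⁆ ∈ W}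
      add_mem' := fun {a b} ha hb X hX => by rw [add_lie]; exact add_mem (ha X hX) (hb X hX)
      zero_mem' := fun X _ => by rw [zero_lie]; exact zero_mem _
      smul_mem' := fun c a ha X hX => by rw [smul_lie]; exact W.smul_mem c (ha X hX)
      lie_mem' := fun {a b} ha hb X hX => by
        rw [hadd]; exact sub_mem (ha _ (hb X hX)) (hb _ (ha X hX)) }
  have h1 : (𝔤.comp (-1) : Set L) ⊆ N := by
    intro Y hY
    change ∀ X ∈ W, ⁅Y, X⁆ ∈ W
    have : W ≤ W.comap (LieModule.toEnd 𝕜 L L Y) := by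
      refine iSup_le fun n X hX => ?_
      change ⁅Y, X⁆ ∈ W
      rw [← lie_skew]
      exact neg_mem (hn (n + 1) (Submodule.subset_span ⟨X, hX, Y, hY, rfl⟩))
    exact fun X hX => this hX
  have h2 : ∀ X ∈ 𝔤.neg, X ∈ N := by
    intro X hX
    have : X ∈ (LieSubalgebra.lieSpan 𝕜 L (𝔤.comp (-1) : Set L)).toSubmodule := by
      rw [𝔤.generated]; exact hX
    exact LieSubalgebra.lieSpan_le.2 h1 this
  have hWneg : W ≤ 𝔤.neg.toSubmodule :=
    iSup_le fun n => (𝔤.iteratedComp_le n).trans (𝔤.comp_le_neg (by push_cast; omega))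
  let W' : LieSubalgebra 𝕜 L :=
    { W with lie_mem' := fun {a b} ha hb => h2 a (hWneg ha) b hb }
  have h3 : LieSubalgebra.lieSpan 𝕜 L (𝔤.comp (-1) : Set L) ≤ W' :=
    LieSubalgebra.lieSpan_le.2 fun X hX => hn 0 hX
  change ⨆ (i : ℤ) (_ : i < 0), 𝔤.comp i ≤ W
  rw [← 𝔤.generated]
  exact h3

/-- Each `iteratedComp` sits in a single degree and together they fill 𝔤₋, so directness of the
grading forces equality degree by degree. -/
theorem comp_eq_iteratedComp (n : ℕ) : 𝔤.comp (-(n + 1 : ℕ)) = 𝔤.iteratedComp n := by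
  refine le_antisymm ?_ (𝔤.iteratedComp_le n)
  intro X hX
  have hX' := 𝔤.neg_le_iSup_iteratedComp (𝔤.comp_le_neg (by push_cast; omega) hX)
  have hle : ⨆ m, 𝔤.iteratedComp m ≤ 𝔤.iteratedComp n ⊔
      ⨆ (j : ℤ) (_ : j ≠ -(n + 1 : ℕ)), 𝔤.comp j := by
    refine iSup_le fun m => ?_
    rcases eq_or_ne m n with rfl | hm
    · exact le_sup_left
    · refine ((𝔤.iteratedComp_le m).trans ?_).trans le_sup_right
      exact le_iSup₂_of_le _ (by push_cast; omega) le_rfl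
  obtain ⟨Y, hY, Z, hZ, rfl⟩ := Submodule.mem_sup.1 (hle hX')
  have hZ' : Z ∈ 𝔤.comp (-(n + 1 : ℕ)) := by
    have := sub_mem hX (𝔤.iteratedComp_le n hY)
    rwa [add_sub_cancel_left] at this
  have hd := 𝔤.isInternal.submodule_iSupIndep (-(n + 1 : ℕ))
  rw [Submodule.disjoint_def.1 hd Z hZ' hZ, add_zero]
  exact hY

/-- The component of degree `-(n+2)` is spanned by brackets of elements of degree `-(n+1)` with
elements of degree `-1`. -/
theorem comp_le_span_lie (n : ℕ) : 𝔤.comp (-(n + 2 : ℕ)) ≤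
    Submodule.span 𝕜 {Z | ∃ X ∈ 𝔤.comp (-(n + 1 : ℕ)), ∃ Y ∈ 𝔤.comp (-1), ⁅X, Y⁆ = Z} := by
  rw [𝔤.comp_eq_iteratedComp (n + 1), 𝔤.comp_eq_iteratedComp n]
  exact le_rfl

end KGrading

end GradingAlgebra

/-! ### The slice chart for the parabolic subgroup, and the Hausdorff property. -/

section FlagSlice

variable {𝕜 : Type*} [RCLike 𝕜]
  {E : Type*} [NormedAddCommGroup E] [NormedSpace 𝕜 E] [FiniteDimensional 𝕜 E] [CompleteSpace E]
  {G : Type*} [TopologicalSpace G] [ChartedSpace E G] [Group G] [LieGroup 𝓘(𝕜, E) ∞ G]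
  {k : ℕ} (𝔤 : KGrading 𝕜 (GroupLieAlgebra 𝓘(𝕜, E) G) k)

/-- The filtration component `𝔤ⁱ` as a subspace of the model space. -/
def modelFilt (i : ℤ) : Submodule 𝕜 E := 𝔤.filt i

/-- The complement `⋯ ⊕ 𝔤ᵢ₋₁` of `𝔤ⁱ` as a subspace of the model space. -/
def modelLow (i : ℤ) : Submodule 𝕜 E := 𝔤.low i

theorem modelFilt_antitone {i j : ℤ} (h : i ≤ j) : modelFilt 𝔤 j ≤ modelFilt 𝔤 i :=
  𝔤.filt_antitone h

theorem modelBracket_mem_modelFilt {i j : ℤ} {X Y : E} (hX : X ∈ modelFilt 𝔤 i)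
    (hY : Y ∈ modelFilt 𝔤 j) : modelBracket 𝕜 E G X Y ∈ modelFilt 𝔤 (i + j) :=
  𝔤.lie_mem_filt hX hY

theorem isCompl_modelFilt_modelLow (i : ℤ) : IsCompl (modelFilt 𝔤 i) (modelLow 𝔤 i) :=
  𝔤.isCompl_filt_low i

theorem modelFilt_eq_top {i : ℤ} (h : i ≤ -k) : modelFilt 𝔤 i = ⊤ := 𝔤.filt_eq_top h

theorem modelFilt_eq_bot {i : ℤ} (h : k < i) : modelFilt 𝔤 i = ⊥ := 𝔤.filt_eq_bot h

theorem finrank_flagModel_add :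
    Module.finrank 𝕜 (FlagModel 𝔤) + Module.finrank 𝕜 (modelFilt 𝔤 0) = Module.finrank 𝕜 E := by
  have : FiniteDimensional 𝕜 (GroupLieAlgebra 𝓘(𝕜, E) G) := ‹FiniteDimensional 𝕜 E›
  rw [finrank_euclideanSpace_fin]
  exact 𝔤.finrank_neg_add_finrank_filt

theorem mem_parabolicSubgroup_iff (g : G) : g ∈ parabolicSubgroup 𝔤 ↔
    ∀ i, ∀ X ∈ modelFilt 𝔤 i, modelAd 𝕜 E g X ∈ modelFilt 𝔤 i := Iff.rfl

theorem modelAd_mem {g : G} (hg : g ∈ parabolicSubgroup 𝔤) {i : ℤ} {X : E}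
    (hX : X ∈ modelFilt 𝔤 i) : modelAd 𝕜 E g X ∈ modelFilt 𝔤 i :=
  (mem_parabolicSubgroup_iff 𝔤 g).1 hg i X hX

/-- Semisimplicity enters only through the vanishing of the centre. -/
theorem mem_modelFilt_zero_iff [LieAlgebra.IsSemisimple 𝕜 (GroupLieAlgebra 𝓘(𝕜, E) G)] (X : E) :
    X ∈ modelFilt 𝔤 0 ↔
      ∀ i, ∀ Y ∈ modelFilt 𝔤 i, modelBracket 𝕜 E G X Y ∈ modelFilt 𝔤 i :=
  𝔤.mem_filt_zero_iff (LieAlgebra.center_eq_bot 𝕜 _) X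

/-- The projection onto `𝔤ⁱ` along the components of lower degree. -/
def filtProj (i : ℤ) : E →L[𝕜] E :=
  ((modelFilt 𝔤 i).projection (modelLow 𝔤 i)
    (isCompl_modelFilt_modelLow 𝔤 i)).toContinuousLinearMap

theorem filtProj_mem (i : ℤ) (X : E) : filtProj 𝔤 i X ∈ modelFilt 𝔤 i :=
  Submodule.projection_apply_mem (isCompl_modelFilt_modelLow 𝔤 i) X

theorem filtProj_eq_self_iff {i : ℤ} {X : E} : filtProj 𝔤 i X = X ↔ X ∈ modelFilt 𝔤 i :=
  Submodule.projection_eq_self_iff (isCompl_modelFilt_modelLow 𝔤 i) X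

/-- The projections onto all the filtration components. -/
def filtProjs : Finset.Icc (-k : ℤ) k → (E →L[𝕜] E) := fun i => filtProj 𝔤 i

theorem filtProjs_mul_self : filtProjs 𝔤 * filtProjs 𝔤 = filtProjs 𝔤 := by
  funext i
  ext X
  exact (filtProj_eq_self_iff 𝔤).2 (filtProj_mem 𝔤 i X)

theorem filtProjs_mul_iff (a : E →L[𝕜] E) :
    (filtProjs 𝔤 * (fun _ => a) * filtProjs 𝔤 = (fun _ => a) * filtProjs 𝔤) ↔
      ∀ i, ∀ X ∈ modelFilt 𝔤 i, a X ∈ modelFilt 𝔤 i := by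
  constructor
  · intro h i X hX
    -- Outside this range the filtration component is everything or zero, so finitely many
    -- projections encode the condition for all i.
    by_cases hi : i ∈ Finset.Icc (-k : ℤ) k
    · have := congrArg (fun F : Finset.Icc (-k : ℤ) k → (E →L[𝕜] E) => F ⟨i, hi⟩ X) h
      have h2 : filtProj 𝔤 i (a (filtProj 𝔤 i X)) = a (filtProj 𝔤 i X) := this
      rwa [filtProj_eq_self_iff, (filtProj_eq_self_iff 𝔤).2 hX] at h2
    · rw [Finset.mem_Icc, not_and_or] at hi
      rcases hi with hi | hi
      · rw [modelFilt_eq_top 𝔤 (by omega)]; trivial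
      · rw [modelFilt_eq_bot 𝔤 (by omega), Submodule.mem_bot] at hX
        rw [hX, map_zero]; exact zero_mem _
  · intro h
    funext i
    ext X
    exact (filtProj_eq_self_iff 𝔤).2 (h _ _ (filtProj_mem 𝔤 i X))

/-- Apply the stabilizer map in a finite power of the endomorphism algebra, with `Ad(g)` in every
factor and the i-th filtration projection in the i-th. One idempotent of the product algebra then
records the whole filtration. -/
theorem exists_flag_slice [LieAlgebra.IsSemisimple 𝕜 (GroupLieAlgebra 𝓘(𝕜, E) G)] :
    ∃ (Ψ : OpenPartialHomeomorph G (FlagModel 𝔤 × modelFilt 𝔤 0)) (B : Set (FlagModel 𝔤))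
      (B' : Set (modelFilt 𝔤 0)),
      1 ∈ Ψ.source ∧ Ψ.target = B ×ˢ B' ∧
      ContMDiffOn 𝓘(𝕜, E) 𝓘(𝕜, FlagModel 𝔤 × modelFilt 𝔤 0) ∞ Ψ Ψ.source ∧
      ContMDiffOn 𝓘(𝕜, FlagModel 𝔤 × modelFilt 𝔤 0) 𝓘(𝕜, E) ∞ Ψ.symm Ψ.target ∧
      (∀ g ∈ Ψ.source, ∀ h ∈ Ψ.source,
        (Ψ g).1 = (Ψ h).1 ↔ g⁻¹ * h ∈ parabolicSubgroup 𝔤) ∧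
      (∀ X, modelDeriv 𝕜 E (FlagModel 𝔤) (fun g => (Ψ g).1) 1 X = 0 ↔ X ∈ modelFilt 𝔤 0) := by
  have hfd : FiniteDimensional 𝕜 (E →L[𝕜] E) := inferInstance
  set A : G → (Finset.Icc (-k : ℤ) k → (E →L[𝕜] E)) := fun g _ => modelAd 𝕜 E g with hA
  have A1 : A 1 = 1 := by funext i; exact modelAd_one
  have Amul : ∀ g h, A (g * h) = A g * A h := fun g h => by funext i; exact modelAd_mul g h
  have hAs : ContMDiff 𝓘(𝕜, E) 𝓘(𝕜, Finset.Icc (-k : ℤ) k → (E →L[𝕜] E)) ∞ A :=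
    contMDiff_pi_space.2 fun _ => contMDiff_modelAd
  have hAd : MDifferentiableAt 𝓘(𝕜, E) 𝓘(𝕜, E →L[𝕜] E) (modelAd 𝕜 E : G → E →L[𝕜] E) 1 :=
    contMDiff_modelAd.mdifferentiableAt (by simp)
  have hA' : ∀ X, modelDeriv 𝕜 E (Finset.Icc (-k : ℤ) k → (E →L[𝕜] E)) A 1 X =
      fun _ => modelDeriv 𝕜 E (E →L[𝕜] E) (modelAd 𝕜 E : G → E →L[𝕜] E) 1 X := by
    intro X
    have := modelDeriv_comp_apply (1 : G)
      (ContinuousLinearMap.pi (fun _ : Finset.Icc (-k : ℤ) k =>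
        ContinuousLinearMap.id 𝕜 (E →L[𝕜] E))).mdifferentiableAt hAd X
    rw [modelDeriv_eq_fderiv, ContinuousLinearMap.fderiv] at this
    exact this
  have hbr : ∀ X Y, modelDeriv 𝕜 E (E →L[𝕜] E) (modelAd 𝕜 E : G → E →L[𝕜] E) 1 X Y =
      modelBracket 𝕜 E G X Y := by
    intro X Y
    rw [← modelDeriv_modelAd_one]
    have := modelDeriv_comp_apply (1 : G)
      (ContinuousLinearMap.apply 𝕜 E Y).mdifferentiableAt hAd X
    rw [modelDeriv_eq_fderiv, ContinuousLinearMap.fderiv] at this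
    exact this.symm
  refine exists_slice_chart (isOpen_isUnit_frameElement (π := filtProjs 𝔤) hAs)
    (isUnit_frameElement_one A1) (contMDiffOn_movedIdempotent hAs) ?_ ?_ (finrank_flagModel_add 𝔤)
  · intro g hg h hh
    rw [movedIdempotent_eq_iff (filtProjs_mul_self 𝔤) A1 Amul hg hh, mem_parabolicSubgroup_iff]
    exact filtProjs_mul_iff 𝔤 _
  · intro g hg X
    rw [modelDeriv_movedIdempotent_eq_zero_iff (filtProjs_mul_self 𝔤) A1 Amul hAs hg, hA' X,
      filtProjs_mul_iff, mem_modelFilt_zero_iff]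
    simp only [hbr]

theorem isClosed_parabolicSubgroup : IsClosed (parabolicSubgroup 𝔤 : Set G) := by
  have : (parabolicSubgroup 𝔤 : Set G) =
      ⋂ i, ⋂ X ∈ modelFilt 𝔤 i, (fun g => modelAd 𝕜 E g X) ⁻¹' (modelFilt 𝔤 i : Set E) := by
    ext g
    simp only [Set.mem_iInter]
    exact mem_parabolicSubgroup_iff 𝔤 g
  rw [this]
  refine isClosed_iInter fun i => isClosed_iInter fun X => isClosed_iInter fun _ => ?_
  exact (Submodule.closed_of_finiteDimensional _).preimage (contMDiff_modelAd_apply X).continuous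

/-- The projection is an open quotient map, and its equivalence relation is the preimage of the
closed set P under (g, h) ↦ g⁻¹h. -/
theorem t2Space_flagManifold : T2Space (FlagManifold 𝔤) := by
  have : IsTopologicalGroup G := topologicalGroup_of_lieGroup 𝓘(𝕜, E) ∞
  rw [t2Space_iff_of_isOpenQuotientMap (π := (QuotientGroup.mk : G → FlagManifold 𝔤))
    QuotientGroup.isOpenQuotientMap_mk]
  have : {q : G × G | (QuotientGroup.mk q.1 : FlagManifold 𝔤) = QuotientGroup.mk q.2} =
      (fun q : G × G => q.1⁻¹ * q.2) ⁻¹' (parabolicSubgroup 𝔤 : Set G) := by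
    ext q
    exact QuotientGroup.eq
  rw [this]
  exact (isClosed_parabolicSubgroup 𝔤).preimage (continuous_fst.inv.mul continuous_snd)

end FlagSlice

/-! ### Recognizing members of the maximal atlas. -/

section Charts

variable {𝕜 : Type*} [RCLike 𝕜] {E : Type*} [NormedAddCommGroup E] [NormedSpace 𝕜 E]
  {M : Type*} [TopologicalSpace M] [ChartedSpace E M]

theorem mem_contDiffGroupoid_of_contMDiffOn {e : OpenPartialHomeomorph E E}
    (h : ContMDiffOn 𝓘(𝕜, E) 𝓘(𝕜, E) ∞ e e.source)
    (h' : ContMDiffOn 𝓘(𝕜, E) 𝓘(𝕜, E) ∞ e.symm e.target) : e ∈ contDiffGroupoid ∞ 𝓘(𝕜, E) := by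
  rw [contMDiffOn_iff_contDiffOn] at h h'
  rw [contDiffGroupoid, mem_groupoid_of_pregroupoid]
  constructor
  · change ContDiffOn 𝕜 ∞ _ _
    simpa using h
  · change ContDiffOn 𝕜 ∞ _ _
    simpa using h'

theorem mem_maximalAtlas_of_contMDiffOn [IsManifold 𝓘(𝕜, E) ∞ M] {e : OpenPartialHomeomorph M E}
    (h : ContMDiffOn 𝓘(𝕜, E) 𝓘(𝕜, E) ∞ e e.source)
    (h' : ContMDiffOn 𝓘(𝕜, E) 𝓘(𝕜, E) ∞ e.symm e.target) :
    e ∈ IsManifold.maximalAtlas 𝓘(𝕜, E) ∞ M := by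
  rw [IsManifold.maximalAtlas, mem_maximalAtlas_iff]
  have aux : ∀ f ∈ atlas E M, ContMDiffOn 𝓘(𝕜, E) 𝓘(𝕜, E) ∞ (e.symm.trans f)
      (e.symm.trans f).source ∧ ContMDiffOn 𝓘(𝕜, E) 𝓘(𝕜, E) ∞ (f.symm.trans e)
      (f.symm.trans e).source := by
    intro f hf
    have hf' := IsManifold.subset_maximalAtlas (I := 𝓘(𝕜, E)) (n := ∞) hf
    constructor
    · refine (contMDiffOn_of_mem_maximalAtlas hf').comp (h'.mono ?_) ?_
      · rw [OpenPartialHomeomorph.trans_source]; exact Set.inter_subset_left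
      · rw [OpenPartialHomeomorph.trans_source]; exact Set.inter_subset_right
    · refine h.comp ((contMDiffOn_symm_of_mem_maximalAtlas hf').mono ?_) ?_
      · rw [OpenPartialHomeomorph.trans_source]; exact Set.inter_subset_left
      · rw [OpenPartialHomeomorph.trans_source]; exact Set.inter_subset_right
  intro f hf
  obtain ⟨h1, h2⟩ := aux f hf
  exact ⟨mem_contDiffGroupoid_of_contMDiffOn h1
      (by simpa only [OpenPartialHomeomorph.trans_symm_eq_symm_trans_symm,
        OpenPartialHomeomorph.symm_symm, ← OpenPartialHomeomorph.symm_source] using h2),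
    mem_contDiffGroupoid_of_contMDiffOn h2
      (by simpa only [OpenPartialHomeomorph.trans_symm_eq_symm_trans_symm,
        OpenPartialHomeomorph.symm_symm, ← OpenPartialHomeomorph.symm_source] using h1)⟩

end Charts

/-! ### The manifold structure on the coset space defined by a slice. -/

section CosetManifold

variable {𝕜 : Type*} [RCLike 𝕜]
  {E : Type*} [NormedAddCommGroup E] [NormedSpace 𝕜 E]
  {G : Type*} [TopologicalSpace G] [ChartedSpace E G] [Group G] [LieGroup 𝓘(𝕜, E) ∞ G]
  {V : Type*} [NormedAddCommGroup V] [NormedSpace 𝕜 V]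
  {C : Type*} [NormedAddCommGroup C] [NormedSpace 𝕜 C] {P : Subgroup G}

variable (𝕜 E V C P) in
/-- A chart of a Lie group around the identity which is adapted to the cosets of a subgroup. -/
structure CosetSlice where
  /-- the chart -/
  chart : OpenPartialHomeomorph G (V × C)
  /-- the values of the coordinates transversal to the cosets -/
  base : Set V
  /-- the values of the coordinates along the cosets -/
  fiber : Set C
  one_mem : 1 ∈ chart.source
  target_eq : chart.target = base ×ˢ fiber
  contMDiffOn : ContMDiffOn 𝓘(𝕜, E) 𝓘(𝕜, V × C) ∞ chart chart.source
  contMDiffOn_symm : ContMDiffOn 𝓘(𝕜, V × C) 𝓘(𝕜, E) ∞ chart.symm chart.target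
  fst_eq_iff : ∀ g ∈ chart.source, ∀ h ∈ chart.source, (chart g).1 = (chart h).1 ↔ g⁻¹ * h ∈ P

namespace CosetSlice

variable (Ψ : CosetSlice 𝕜 E V C P)

theorem mk_eq_iff {g h : G} (hg : g ∈ Ψ.chart.source) (hh : h ∈ Ψ.chart.source) :
    (QuotientGroup.mk g : G ⧸ P) = QuotientGroup.mk h ↔ (Ψ.chart g).1 = (Ψ.chart h).1 := by
  rw [QuotientGroup.eq, Ψ.fst_eq_iff g hg h hh]

/-- The point of the slice with a given transversal coordinate. -/
def point (v : V) : G := Ψ.chart.symm (v, (Ψ.chart 1).2)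

theorem mem_target {v : V} (hv : v ∈ Ψ.base) : (v, (Ψ.chart 1).2) ∈ Ψ.chart.target := by
  have h := Ψ.chart.map_source Ψ.one_mem
  rw [Ψ.target_eq] at h ⊢
  exact ⟨hv, h.2⟩

theorem fst_mem_base {g : G} (hg : g ∈ Ψ.chart.source) : (Ψ.chart g).1 ∈ Ψ.base := by
  have h := Ψ.chart.map_source hg
  rw [Ψ.target_eq] at h
  exact h.1

theorem point_mem_source {v : V} (hv : v ∈ Ψ.base) : Ψ.point v ∈ Ψ.chart.source :=
  Ψ.chart.map_target (Ψ.mem_target hv)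

theorem fst_chart_point {v : V} (hv : v ∈ Ψ.base) : (Ψ.chart (Ψ.point v)).1 = v := by
  rw [point, Ψ.chart.right_inv (Ψ.mem_target hv)]

theorem isOpen_base : IsOpen Ψ.base := by
  have : Ψ.base = (fun v => (v, (Ψ.chart 1).2)) ⁻¹' Ψ.chart.target := by
    ext v
    refine ⟨Ψ.mem_target, fun h => ?_⟩
    rw [Set.mem_preimage, Ψ.target_eq] at h
    exact h.1
  rw [this]
  exact Ψ.chart.open_target.preimage (by fun_prop)

theorem contMDiffOn_point : ContMDiffOn 𝓘(𝕜, V) 𝓘(𝕜, E) ∞ Ψ.point Ψ.base := by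
  have h : ContDiff 𝕜 ∞ (fun v : V => (v, (Ψ.chart 1).2)) := by fun_prop
  exact Ψ.contMDiffOn_symm.comp h.contMDiff.contMDiffOn fun v hv => Ψ.mem_target hv

/-- The transversal coordinate of a coset. -/
def coord (q : G ⧸ P) : V :=
  (Ψ.chart (Function.invFunOn (QuotientGroup.mk : G → G ⧸ P) Ψ.chart.source q)).1

theorem coord_mk {g : G} (hg : g ∈ Ψ.chart.source) : Ψ.coord (QuotientGroup.mk g) =
    (Ψ.chart g).1 := by
  have h : ∃ a ∈ Ψ.chart.source, (QuotientGroup.mk a : G ⧸ P) = QuotientGroup.mk g := ⟨g, hg, rfl⟩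
  exact (Ψ.mk_eq_iff (Function.invFunOn_mem h) hg).1 (Function.invFunOn_eq h)

/-- The chart of `G ⧸ P` around the base point. -/
def baseChart : OpenPartialHomeomorph (G ⧸ P) V :=
  have : IsTopologicalGroup G := topologicalGroup_of_lieGroup 𝓘(𝕜, E) ∞
  { toFun := Ψ.coord
    invFun := fun v => QuotientGroup.mk (Ψ.point v)
    source := QuotientGroup.mk '' Ψ.chart.source
    target := Ψ.base
    map_source' := by
      rintro _ ⟨g, hg, rfl⟩
      rw [Ψ.coord_mk hg]
      exact Ψ.fst_mem_base hg
    map_target' := fun v hv => ⟨_, Ψ.point_mem_source hv, rfl⟩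
    left_inv' := by
      rintro _ ⟨g, hg, rfl⟩
      rw [Ψ.coord_mk hg, Ψ.mk_eq_iff (Ψ.point_mem_source (Ψ.fst_mem_base hg)) hg,
        Ψ.fst_chart_point (Ψ.fst_mem_base hg)]
    right_inv' := fun v hv => by
      rw [Ψ.coord_mk (Ψ.point_mem_source hv), Ψ.fst_chart_point hv]
    open_source := QuotientGroup.isOpenMap_coe _ Ψ.chart.open_source
    open_target := Ψ.isOpen_base
    continuousOn_toFun := by
      rintro _ ⟨g, hg, rfl⟩
      refine ContinuousAt.continuousWithinAt ?_
      rw [ContinuousAt, ← QuotientGroup.isOpenQuotientMap_mk.map_nhds_eq, Filter.tendsto_map'_iff,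
        Ψ.coord_mk hg]
      refine Filter.Tendsto.congr' ?_ (continuous_fst.continuousAt.comp (Ψ.chart.continuousAt hg))
      filter_upwards [Ψ.chart.open_source.mem_nhds hg] with h hh
      exact (Ψ.coord_mk hh).symm
    continuousOn_invFun :=
      QuotientGroup.continuous_mk.comp_continuousOn Ψ.contMDiffOn_point.continuousOn }

/-- The translate by `g` of the chart of `G ⧸ P` around the base point. -/
def quotientChart (g : G) : OpenPartialHomeomorph (G ⧸ P) V :=
  have : IsTopologicalGroup G := topologicalGroup_of_lieGroup 𝓘(𝕜, E) ∞
  (Homeomorph.smul g⁻¹ : G ⧸ P ≃ₜ G ⧸ P).transOpenPartialHomeomorph Ψ.baseChart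

theorem quotientChart_apply (g : G) (q : G ⧸ P) : Ψ.quotientChart g q = Ψ.coord (g⁻¹ • q) := rfl

theorem quotientChart_symm_apply (g : G) (v : V) :
    (Ψ.quotientChart g).symm v = QuotientGroup.mk (g * Ψ.point v) := by
  change (g⁻¹)⁻¹ • (QuotientGroup.mk (Ψ.point v) : G ⧸ P) = _
  rw [inv_inv]
  rfl

theorem mem_quotientChart_source_iff {g h : G} :
    (QuotientGroup.mk h : G ⧸ P) ∈ (Ψ.quotientChart g).source ↔
      ∃ p ∈ P, g⁻¹ * h * p ∈ Ψ.chart.source := by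
  change (QuotientGroup.mk (g⁻¹ * h) : G ⧸ P) ∈ QuotientGroup.mk '' Ψ.chart.source ↔ _
  constructor
  · rintro ⟨x, hx, he⟩
    rw [eq_comm, QuotientGroup.eq] at he
    exact ⟨_, he, by rwa [mul_inv_cancel_left]⟩
  · rintro ⟨p, hp, hs⟩
    exact ⟨_, hs, QuotientGroup.mk_mul_of_mem _ hp⟩

theorem quotientChart_mk_mul {g h p : G} (hp : p ∈ P) (hs : g⁻¹ * h * p ∈ Ψ.chart.source) :
    Ψ.quotientChart g (QuotientGroup.mk h) = (Ψ.chart (g⁻¹ * h * p)).1 := by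
  rw [quotientChart_apply, ← Ψ.coord_mk hs, QuotientGroup.mk_mul_of_mem _ hp]
  rfl

/-- In the charts of `G ⧸ P`, the class of a smooth map to `G` is smooth. -/
theorem contMDiffAt_quotientChart_mk {E' : Type*} [NormedAddCommGroup E'] [NormedSpace 𝕜 E']
    {N : Type*} [TopologicalSpace N] [ChartedSpace E' N] {γ : N → G} {y : N}
    (hγ : ContMDiffAt 𝓘(𝕜, E') 𝓘(𝕜, E) ∞ γ y) {g : G}
    (hy : (QuotientGroup.mk (γ y) : G ⧸ P) ∈ (Ψ.quotientChart g).source) :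
    ContMDiffAt 𝓘(𝕜, E') 𝓘(𝕜, V) ∞
      (fun z => Ψ.quotientChart g (QuotientGroup.mk (γ z))) y := by
  -- Right multiplication by `p` moves the translated representative into the slice chart without
  -- changing its class, and the same `p` works near `y`.
  obtain ⟨p, hp, hs⟩ := Ψ.mem_quotientChart_source_iff.1 hy
  have h1 : ContMDiffAt 𝓘(𝕜, E') 𝓘(𝕜, E) ∞ (fun z => g⁻¹ * γ z * p) y :=
    (contMDiffAt_const.mul hγ).mul contMDiffAt_const
  have h2 : ContMDiffAt 𝓘(𝕜, E') 𝓘(𝕜, V × C) ∞ (fun z => Ψ.chart (g⁻¹ * γ z * p)) y :=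
    (Ψ.contMDiffOn.contMDiffAt (Ψ.chart.open_source.mem_nhds hs)).comp y h1
  have h3 := (contDiff_fst (𝕜 := 𝕜) (n := ∞) (E := V) (F := C)).contMDiff.contMDiffAt.comp y h2
  refine h3.congr_of_eventuallyEq ?_
  filter_upwards [h1.continuousAt.preimage_mem_nhds (Ψ.chart.open_source.mem_nhds hs)] with z hz
  exact Ψ.quotientChart_mk_mul hp hz

/-- The atlas of `G ⧸ P` given by a slice. -/
abbrev chartedSpace : ChartedSpace V (G ⧸ P) where
  atlas := Set.range Ψ.quotientChart
  chartAt q := Ψ.quotientChart q.out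
  mem_chart_source q := by
    have h := (Ψ.mem_quotientChart_source_iff (g := q.out) (h := q.out)).2
      ⟨1, P.one_mem, by simpa using Ψ.one_mem⟩
    rwa [QuotientGroup.out_eq'] at h
  chart_mem_atlas q := ⟨_, rfl⟩

/-- A transition map is a chart applied to the class of the smooth map v ↦ g · point(v), so the
smoothness of classes of maps to G covers it. -/
theorem isManifold : letI := Ψ.chartedSpace; IsManifold 𝓘(𝕜, V) ∞ (G ⧸ P) := by
  let _ := Ψ.chartedSpace
  refine isManifold_of_contDiffOn _ _ _ ?_
  rintro _ _ ⟨g, rfl⟩ ⟨h, rfl⟩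
  have : ContDiffOn 𝕜 ∞ ((Ψ.quotientChart g).symm.trans (Ψ.quotientChart h))
      ((Ψ.quotientChart g).symm.trans (Ψ.quotientChart h)).source := by
    rw [← contMDiffOn_iff_contDiffOn]
    intro v hv
    rw [OpenPartialHomeomorph.trans_source] at hv
    have hvb : v ∈ Ψ.base := hv.1
    have hv2 := hv.2
    rw [Set.mem_preimage, quotientChart_symm_apply] at hv2
    have h1 : ContMDiffAt 𝓘(𝕜, V) 𝓘(𝕜, E) ∞ (fun v => g * Ψ.point v) v :=
      contMDiffAt_const.mul (Ψ.contMDiffOn_point.contMDiffAt (Ψ.isOpen_base.mem_nhds hvb))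
    refine ((Ψ.contMDiffAt_quotientChart_mk h1 hv2).congr_of_eventuallyEq ?_).contMDiffWithinAt
    refine Filter.Eventually.of_forall fun w => ?_
    rw [OpenPartialHomeomorph.trans_apply, quotientChart_symm_apply]
  simpa using this

/-- The translate by `g` of the adapted chart of `G`, with values in the model space of `G`. -/
def groupChart (e : E ≃L[𝕜] V × C) (g : G) : OpenPartialHomeomorph G E :=
  have : IsTopologicalGroup G := topologicalGroup_of_lieGroup 𝓘(𝕜, E) ∞
  ((Homeomorph.mulLeft g⁻¹).transOpenPartialHomeomorph Ψ.chart).trans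
    e.symm.toHomeomorph.toOpenPartialHomeomorph

theorem groupChart_symm_apply (e : E ≃L[𝕜] V × C) (g : G) (x : E) :
    (Ψ.groupChart e g).symm x = g * Ψ.chart.symm (e x) := by
  change (g⁻¹)⁻¹ * Ψ.chart.symm (e x) = _
  rw [inv_inv]

theorem groupChart_source (e : E ≃L[𝕜] V × C) (g : G) :
    (Ψ.groupChart e g).source = (fun h => g⁻¹ * h) ⁻¹' Ψ.chart.source := by
  simp only [groupChart, OpenPartialHomeomorph.trans_source]
  exact Set.inter_univ _

theorem groupChart_target (e : E ≃L[𝕜] V × C) (g : G) :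
    (Ψ.groupChart e g).target = e ⁻¹' Ψ.chart.target := by
  simp only [groupChart, OpenPartialHomeomorph.trans_target]
  exact Set.univ_inter _

theorem groupChart_mem_maximalAtlas (e : E ≃L[𝕜] V × C) (g : G) :
    Ψ.groupChart e g ∈ IsManifold.maximalAtlas 𝓘(𝕜, E) ∞ G := by
  apply mem_maximalAtlas_of_contMDiffOn
  · rw [groupChart_source]
    refine e.symm.contDiff.contMDiff.comp_contMDiffOn (Ψ.contMDiffOn.comp ?_ fun h hh => hh)
    exact contMDiff_mul_left.contMDiffOn
  · rw [groupChart_target]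
    have : ((Ψ.groupChart e g).symm : E → G) = fun x => g * Ψ.chart.symm (e x) :=
      funext (Ψ.groupChart_symm_apply e g)
    rw [this]
    exact contMDiff_mul_left.comp_contMDiffOn
      (Ψ.contMDiffOn_symm.comp e.contDiff.contMDiff.contMDiffOn fun x hx => hx)

/-- In the two charts translated by the same g, the projection is literally the first coordinate of
`V × C`. -/
theorem isSubmersion (e : E ≃L[𝕜] V × C) :
    letI := Ψ.chartedSpace
    Manifold.IsSubmersion 𝓘(𝕜, E) 𝓘(𝕜, V) ∞ (fun g : G => (QuotientGroup.mk g : G ⧸ P)) := by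
  let _ := Ψ.chartedSpace
  have := Ψ.isManifold
  refine Manifold.IsSubmersionOfComplement.isSubmersion (F := C) fun g => ?_
  refine Manifold.IsSubmersionAtOfComplement.mk_of_continuousAt
    QuotientGroup.continuous_mk.continuousAt e (Ψ.groupChart e g) (Ψ.quotientChart g) ?_ ?_
    (Ψ.groupChart_mem_maximalAtlas e g) (IsManifold.subset_maximalAtlas ⟨g, rfl⟩) ?_
  · rw [groupChart_source, Set.mem_preimage, inv_mul_cancel]
    exact Ψ.one_mem
  · rw [mem_quotientChart_source_iff]
    exact ⟨1, P.one_mem, by simpa using Ψ.one_mem⟩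
  · intro x hx
    have hx' : e x ∈ Ψ.chart.target := by
      have : x ∈ (Ψ.groupChart e g).target := by simpa using hx
      rwa [groupChart_target] at this
    change Ψ.quotientChart g (QuotientGroup.mk ((Ψ.groupChart e g).symm x)) = (e x).1
    rw [groupChart_symm_apply, Ψ.quotientChart_mk_mul P.one_mem] <;>
      rw [mul_one, inv_mul_cancel_left]
    · rw [Ψ.chart.right_inv hx']
    · exact Ψ.chart.map_target hx'

end CosetSlice

end CosetManifold

/-! ### Existence of the homogeneous structure on G/P. -/

section FlagManifoldStructure

variable {𝕜 : Type*} [RCLike 𝕜]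
  {E : Type*} [NormedAddCommGroup E] [NormedSpace 𝕜 E] [FiniteDimensional 𝕜 E] [CompleteSpace E]
  {G : Type*} [TopologicalSpace G] [ChartedSpace E G] [Group G] [LieGroup 𝓘(𝕜, E) ∞ G]
  {k : ℕ} (𝔤 : KGrading 𝕜 (GroupLieAlgebra 𝓘(𝕜, E) G) k)

theorem exists_isHomogeneousStructure
    [LieAlgebra.IsSemisimple 𝕜 (GroupLieAlgebra 𝓘(𝕜, E) G)] :
    ∃ _ : ChartedSpace (FlagModel 𝔤) (FlagManifold 𝔤), IsHomogeneousStructure 𝔤 := by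
  obtain ⟨Ψ, B, B', h1, ht, hs, hs', hP, -⟩ := exists_flag_slice 𝔤
  let Φ : CosetSlice 𝕜 E (FlagModel 𝔤) (modelFilt 𝔤 0) (parabolicSubgroup 𝔤) :=
    ⟨Ψ, B, B', h1, ht, hs, hs', hP⟩
  have e : E ≃L[𝕜] FlagModel 𝔤 × modelFilt 𝔤 0 := by
    apply ContinuousLinearEquiv.ofFinrankEq
    rw [Module.finrank_prod, finrank_flagModel_add]
  let _ := Φ.chartedSpace
  exact ⟨Φ.chartedSpace, ⟨Φ.isManifold, Φ.isSubmersion e⟩⟩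

end FlagManifoldStructure

/-! ### Local sections of submersions. -/

section Submersions

variable {𝕜 : Type*} [RCLike 𝕜]
  {E : Type*} [NormedAddCommGroup E] [NormedSpace 𝕜 E]
  {M : Type*} [TopologicalSpace M] [ChartedSpace E M] [IsManifold 𝓘(𝕜, E) ∞ M]
  {V : Type*} [NormedAddCommGroup V] [NormedSpace 𝕜 V]
  {N : Type*} [TopologicalSpace N] [ChartedSpace V N] [IsManifold 𝓘(𝕜, V) ∞ N]

/-- A submersion has smooth local sections. -/
theorem Manifold.IsSubmersionAt.exists_section {f : M → N} {x : M}
    (h : Manifold.IsSubmersionAt 𝓘(𝕜, E) 𝓘(𝕜, V) ∞ f x) :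
    ∃ (U : Set N) (σ : N → M), IsOpen U ∧ f x ∈ U ∧ ContMDiffOn 𝓘(𝕜, V) 𝓘(𝕜, E) ∞ σ U ∧
      (∀ y ∈ U, f (σ y) = y) ∧ σ (f x) = x := by
  set φ := h.domChart
  set ψ := h.codChart
  set e := h.equiv
  have hw : ∀ z ∈ φ.target, ψ (f (φ.symm z)) = (e z).1 := by
    intro z hz
    have hz' : z ∈ (h.domChart.extend 𝓘(𝕜, E)).target := by simpa using hz
    exact h.writtenInCharts hz'
  have hx := h.mem_domChart_source
  have hfx := h.mem_codChart_source
  set c := (e (φ x)).2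
  -- In normal-form charts the map is the first coordinate. Freezing the second coordinate at its
  -- value at `x` gives a section through `x`.
  let τ : V → E := fun v => e.symm (v, c)
  have hτ : ContDiff 𝕜 ∞ τ := e.symm.contDiff.comp (by fun_prop)
  have heτ : ∀ v, e (τ v) = (v, c) := fun v => e.apply_symm_apply _
  have hψx : τ (ψ (f x)) = φ x := by
    have h1 := hw (φ x) (φ.map_source hx)
    rw [φ.left_inv hx] at h1
    apply e.injective
    rw [heτ, h1]
  have hτψ : ContinuousOn (fun y => τ (ψ y)) ψ.source :=
    hτ.continuous.comp_continuousOn ψ.continuousOn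
  refine ⟨ψ.source ∩ (fun y => τ (ψ y)) ⁻¹' φ.target, fun y => φ.symm (τ (ψ y)),
    hτψ.isOpen_inter_preimage ψ.open_source φ.open_target, ⟨hfx, ?_⟩, ?_, ?_, ?_⟩
  · rw [Set.mem_preimage, hψx]
    exact φ.map_source hx
  · refine (contMDiffOn_symm_of_mem_maximalAtlas h.domChart_mem_maximalAtlas).comp
      (t := φ.target) ?_ fun y hy => hy.2
    exact hτ.contMDiff.comp_contMDiffOn
      ((contMDiffOn_of_mem_maximalAtlas h.codChart_mem_maximalAtlas).mono Set.inter_subset_left)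
  · intro y hy
    have h1 : f (φ.symm (τ (ψ y))) ∈ ψ.source :=
      h.source_subset_preimage_source (φ.map_target hy.2)
    apply ψ.injOn h1 hy.1
    rw [hw _ hy.2, heτ]
  · change φ.symm (τ (ψ (f x))) = x
    rw [hψx, φ.left_inv hx]

end Submersions

/-! ### The derivative of the projection and its equivariance. -/

section HomogeneousSpace

variable {𝕜 : Type*} [RCLike 𝕜]
  {E : Type*} [NormedAddCommGroup E] [NormedSpace 𝕜 E]
  {G : Type*} [TopologicalSpace G] [ChartedSpace E G] [Group G] [LieGroup 𝓘(𝕜, E) ∞ G]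
  {V : Type*} [NormedAddCommGroup V] [NormedSpace 𝕜 V] {P : Subgroup G}
  [ChartedSpace V (G ⧸ P)] [IsManifold 𝓘(𝕜, V) ∞ (G ⧸ P)]

variable (𝕜 E V P) in
/-- The derivative of the projection `G → G ⧸ P`, in the left-invariant trivialization. -/
def quotientDeriv (g : G) : E →L[𝕜] V :=
  (modelDeriv 𝕜 E V (QuotientGroup.mk : G → G ⧸ P) g).comp (leftField 𝕜 E g)

theorem quotientDeriv_apply (g : G) (X : E) : quotientDeriv 𝕜 E V P g X =
    modelDeriv 𝕜 E V (QuotientGroup.mk : G → G ⧸ P) g (leftField 𝕜 E g X) := rfl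

variable (hp : Manifold.IsSubmersion 𝓘(𝕜, E) 𝓘(𝕜, V) ∞ (QuotientGroup.mk : G → G ⧸ P))

include hp

theorem mdifferentiableAt_quotientMk (g : G) :
    MDifferentiableAt 𝓘(𝕜, E) 𝓘(𝕜, V) (QuotientGroup.mk : G → G ⧸ P) g :=
  hp.contMDiff.mdifferentiableAt (by simp)

theorem quotientDeriv_surjective (g : G) : Function.Surjective (quotientDeriv 𝕜 E V P g) := by
  obtain ⟨U, σ, hU, hgU, hσ, hpσ, hσg⟩ := (hp.isSubmersionAt g).exists_section
  intro v
  obtain ⟨X, hX⟩ := leftField_surjective (𝕜 := 𝕜) (E := E) g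
    (modelDeriv 𝕜 V E σ (QuotientGroup.mk g) v)
  refine ⟨X, ?_⟩
  have h1 : modelDeriv 𝕜 V V ((QuotientGroup.mk : G → G ⧸ P) ∘ σ) (QuotientGroup.mk g) =
      ContinuousLinearMap.id 𝕜 V := by
    rw [modelDeriv_congr (g := id), modelDeriv_id]
    filter_upwards [hU.mem_nhds hgU] with y hy
    exact hpσ y hy
  have h2 := modelDeriv_comp_apply (QuotientGroup.mk g : G ⧸ P)
    (mdifferentiableAt_quotientMk hp _)
    ((hσ.contMDiffAt (hU.mem_nhds hgU)).mdifferentiableAt (by simp)) v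
  rw [h1, hσg] at h2
  rw [quotientDeriv_apply, hX, ← h2]
  rfl

/-- The projection is unchanged by right translation by h ∈ P, which acts on the left trivialization
by `Ad(h⁻¹)`. Hence Ad(P)-invariant subspaces give well-defined subspaces of the tangent spaces of
the quotient. -/
theorem quotientDeriv_mul_of_mem (g : G) {h : G} (hh : h ∈ P) (X : E) :
    quotientDeriv 𝕜 E V P (g * h) (modelAd 𝕜 E h⁻¹ X) = quotientDeriv 𝕜 E V P g X := by
  have e : (QuotientGroup.mk : G → G ⧸ P) ∘ (fun x : G => x * h) = QuotientGroup.mk := by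
    funext x; exact QuotientGroup.mk_mul_of_mem x hh
  have h1 := modelDeriv_comp_apply (𝕜 := 𝕜) g (mdifferentiableAt_quotientMk hp (g * h))
    (mdifferentiableAt_rightMul h g) (leftField 𝕜 E g X)
  rw [e, modelDeriv_mul_right_leftField] at h1
  exact h1.symm

theorem quotientDeriv_eq_of_mk_eq {g g' : G}
    (h : (QuotientGroup.mk g : G ⧸ P) = QuotientGroup.mk g') (X : E) :
    quotientDeriv 𝕜 E V P g X = quotientDeriv 𝕜 E V P g' (modelAd 𝕜 E (g'⁻¹ * g) X) := by
  rw [eq_comm, QuotientGroup.eq] at h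
  have h1 := quotientDeriv_mul_of_mem hp g (inv_mem h) X
  rw [inv_inv, mul_inv_rev, inv_inv, mul_inv_cancel_left] at h1
  exact h1.symm

/-- Locally the translation is y ↦ p(gσ(y)) for a smooth local section σ. -/
theorem contMDiff_quotient_smul (g : G) :
    ContMDiff 𝓘(𝕜, V) 𝓘(𝕜, V) ∞ (fun x : G ⧸ P => g • x) := by
  intro x
  obtain ⟨h, rfl⟩ := QuotientGroup.mk_surjective x
  obtain ⟨U, σ, hU, hgU, hσ, hpσ, hσg⟩ := (hp.isSubmersionAt h).exists_section
  have h1 : ContMDiffAt 𝓘(𝕜, V) 𝓘(𝕜, V) ∞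
      (fun y => (QuotientGroup.mk (g * σ y) : G ⧸ P)) (QuotientGroup.mk h) :=
    hp.contMDiff.contMDiffAt.comp _
      (contMDiffAt_const.mul (hσ.contMDiffAt (hU.mem_nhds hgU)))
  refine h1.congr_of_eventuallyEq ?_
  filter_upwards [hU.mem_nhds hgU] with y hy
  conv_lhs => rw [← hpσ y hy]
  rfl

theorem modelDeriv_smul_quotientDeriv (g h : G) (X : E) :
    modelDeriv 𝕜 V V (fun x : G ⧸ P => g • x) (QuotientGroup.mk h) (quotientDeriv 𝕜 E V P h X) =
      quotientDeriv 𝕜 E V P (g * h) X := by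
  have e : (fun x : G ⧸ P => g • x) ∘ (QuotientGroup.mk : G → G ⧸ P) =
      (QuotientGroup.mk : G → G ⧸ P) ∘ (fun x : G => g * x) := rfl
  have h1 := modelDeriv_comp_apply (𝕜 := 𝕜) h
    ((contMDiff_quotient_smul hp g).mdifferentiableAt (by simp))
    (mdifferentiableAt_quotientMk hp h) (leftField 𝕜 E h X)
  have h2 := modelDeriv_comp_apply (𝕜 := 𝕜) h (mdifferentiableAt_quotientMk hp (g * h))
    (mdifferentiableAt_leftMul g h) (leftField 𝕜 E h X)
  rw [e] at h1
  rw [modelDeriv_mul_left_leftField] at h2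
  exact h1.symm.trans h2

theorem quotientDeriv_eq_zero_iff_one (g : G) (X : E) :
    quotientDeriv 𝕜 E V P g X = 0 ↔ quotientDeriv 𝕜 E V P 1 X = 0 := by
  constructor
  · intro h
    have := modelDeriv_smul_quotientDeriv hp g⁻¹ g X
    rw [h, map_zero, inv_mul_cancel] at this
    exact this.symm
  · intro h
    have := modelDeriv_smul_quotientDeriv hp g 1 X
    rw [h, map_zero, mul_one] at this
    exact this.symm

/-- The kernel of the derivative of the projection is determined by any map which separates the
cosets and has a derivative with the correct kernel. -/
theorem quotientDeriv_eq_zero_iff [FiniteDimensional 𝕜 E] {V' : Type*} [NormedAddCommGroup V']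
    [NormedSpace 𝕜 V'] {C : Submodule 𝕜 E} {u : G → V'} {O : Set G} (hO : IsOpen O) (h1 : 1 ∈ O)
    (hu : ContMDiffOn 𝓘(𝕜, E) 𝓘(𝕜, V') ∞ u O)
    (huP : ∀ g ∈ O, ∀ h ∈ O, g⁻¹ * h ∈ P → u g = u h)
    (huC : ∀ X, modelDeriv 𝕜 E V' u 1 X = 0 ↔ X ∈ C)
    (hV : Module.finrank 𝕜 V + Module.finrank 𝕜 C = Module.finrank 𝕜 E) (g : G) (X : E) :
    quotientDeriv 𝕜 E V P g X = 0 ↔ X ∈ C := by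
  rw [quotientDeriv_eq_zero_iff_one hp]
  obtain ⟨U, σ, hU, hgU, hσ, hpσ, hσg⟩ := (hp.isSubmersionAt 1).exists_section
  have hle : (quotientDeriv 𝕜 E V P 1).ker ≤ C := by
    intro Y hY
    rw [LinearMap.mem_ker] at hY
    have hY' : modelDeriv 𝕜 E V (QuotientGroup.mk : G → G ⧸ P) 1 Y = 0 := by
      have h2 := quotientDeriv_apply (𝕜 := 𝕜) (V := V) (P := P) (1 : G) Y
      rw [leftField_one] at h2
      exact h2.symm.trans hY
    rw [← huC]
    have hσ1 : ContMDiffAt 𝓘(𝕜, V) 𝓘(𝕜, E) ∞ σ (QuotientGroup.mk 1) :=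
      hσ.contMDiffAt (hU.mem_nhds hgU)
    have hu1 : ContMDiffAt 𝓘(𝕜, E) 𝓘(𝕜, V') ∞ u (σ (QuotientGroup.mk 1)) := by
      rw [hσg]; exact hu.contMDiffAt (hO.mem_nhds h1)
    -- Near 1 the points g and σ(p(g)) lie in the same coset, so `u` factors through the projection.
    -- This gives one inclusion of kernels; dimensions give equality.
    have e : u =ᶠ[𝓝 1] (u ∘ σ) ∘ (QuotientGroup.mk : G → G ⧸ P) := by
      have hc : ContinuousAt (fun g : G => σ (QuotientGroup.mk g : G ⧸ P)) 1 :=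
        ContinuousAt.comp (g := σ) hσ1.continuousAt hp.contMDiff.continuous.continuousAt
      filter_upwards [hO.mem_nhds h1, hc.preimage_mem_nhds (hO.mem_nhds (by rw [hσg]; exact h1)),
        hp.contMDiff.continuous.continuousAt.preimage_mem_nhds (hU.mem_nhds hgU)] with g hg hg' hgU
      refine huP _ hg _ hg' ?_
      rw [← QuotientGroup.eq]
      exact (hpσ _ hgU).symm
    rw [modelDeriv_congr e, modelDeriv_comp_apply (1 : G)
      ((hu1.comp _ hσ1).mdifferentiableAt (by simp)) (mdifferentiableAt_quotientMk hp 1), hY',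
      map_zero]
  have heq : (quotientDeriv 𝕜 E V P 1).ker = C := by
    apply Submodule.eq_of_le_of_finrank_eq hle
    have h2 := LinearMap.finrank_range_add_finrank_ker (quotientDeriv 𝕜 E V P 1).toLinearMap
    rw [LinearMap.range_eq_top.2 (quotientDeriv_surjective hp 1), finrank_top] at h2
    exact Nat.add_left_cancel (h2.trans hV.symm)
  rw [← heq]
  rfl

/-- The vector fields on `G ⧸ P` obtained from left-invariant vector fields along a section. -/
theorem isSmoothAlong_quotientDeriv {U : Set (G ⧸ P)} {σ : G ⧸ P → G}
    (hσ : ContMDiffOn 𝓘(𝕜, V) 𝓘(𝕜, E) ∞ σ U) (hpσ : ∀ y ∈ U, QuotientGroup.mk (σ y) = y) (X : E) :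
    IsSmoothAlong 𝕜 V V id (fun y : G ⧸ P => quotientDeriv 𝕜 E V P (σ y) X) U := by
  have h1 : IsSmoothAlong 𝕜 V E σ (fun y => leftField 𝕜 E (σ y) X) U :=
    (isSmoothAlong_leftField (𝕜 := 𝕜) (G := G) X).comp hσ fun _ _ => Set.mem_univ _
  have h2 := IsSmoothAlong.modelDeriv isOpen_univ hp.contMDiff.contMDiffOn h1
    fun _ _ => Set.mem_univ _
  refine ContMDiffOn.congr h2 fun y hy => ?_
  have hy' := hpσ y hy
  exact congrArg (fun z => (⟨z, quotientDeriv 𝕜 E V P (σ y) X⟩ : TangentBundle 𝓘(𝕜, V) (G ⧸ P)))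
    hy'.symm

end HomogeneousSpace

/-! ### Subspace-valued maps and smooth families of linear equations. -/

section Lifts

variable {𝕜 : Type*} [RCLike 𝕜] {E : Type*} [NormedAddCommGroup E] [NormedSpace 𝕜 E]
  {M : Type*} [TopologicalSpace M] [ChartedSpace E M] [IsManifold 𝓘(𝕜, E) ∞ M]
  {A : Type*} [NormedAddCommGroup A] [NormedSpace 𝕜 A] [FiniteDimensional 𝕜 A]

/-- The derivative of a map with values in a subspace has values in this subspace. -/
theorem modelDeriv_mem {F : Submodule 𝕜 A} {Z : M → A} {x : M}
    (hZ : MDifferentiableAt 𝓘(𝕜, E) 𝓘(𝕜, A) Z x) (h : ∀ᶠ y in 𝓝 x, Z y ∈ F) (v : E) :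
    modelDeriv 𝕜 E A Z x v ∈ F := by
  obtain ⟨F', hF'⟩ := Submodule.exists_isCompl F
  let q : A →L[𝕜] A := (F'.projection F hF'.symm).toContinuousLinearMap
  have hq : ∀ a, q a = 0 ↔ a ∈ F := fun a => Submodule.projection_apply_eq_zero_iff hF'.symm
  have h1 : modelDeriv 𝕜 E A (q ∘ Z) x = 0 := by
    rw [modelDeriv_congr (g := fun _ => (0 : A)), modelDeriv_const]
    filter_upwards [h] with y hy
    exact (hq _).2 hy
  have h2 := modelDeriv_comp_apply x q.mdifferentiableAt hZ v
  rw [h1, modelDeriv_eq_fderiv, q.fderiv] at h2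
  exact (hq _).1 h2.symm

/-- Solving smooth families of linear equations. -/
theorem exists_contMDiffOn_solution {B : Type*} [NormedAddCommGroup B] [NormedSpace 𝕜 B]
    {𝔪 : Submodule 𝕜 A} {K : M → A →L[𝕜] B} {b : M → B} {W : Set M}
    (hK : ContMDiffOn 𝓘(𝕜, E) 𝓘(𝕜, A →L[𝕜] B) ∞ K W)
    (hb : ContMDiffOn 𝓘(𝕜, E) 𝓘(𝕜, B) ∞ b W)
    (hinj : ∀ x ∈ W, ∀ a ∈ 𝔪, K x a = 0 → a = 0) (hsurj : ∀ x ∈ W, ∀ c, ∃ a ∈ 𝔪, K x a = c) :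
    ∃ Z : M → A, ContMDiffOn 𝓘(𝕜, E) 𝓘(𝕜, A) ∞ Z W ∧ (∀ x, Z x ∈ 𝔪) ∧
      ∀ x ∈ W, K x (Z x) = b x := by
  have : CompleteSpace 𝔪 := FiniteDimensional.complete 𝕜 𝔪
  have he : ∀ x ∈ W, ∃ e : 𝔪 ≃L[𝕜] B, (e : 𝔪 →L[𝕜] B) = (K x).comp 𝔪.subtypeL := by
    intro x hx
    let l : 𝔪 ≃ₗ[𝕜] B := LinearEquiv.ofBijective ((K x).comp 𝔪.subtypeL).toLinearMap
      ⟨(injective_iff_map_eq_zero _).2 fun a ha => Subtype.ext (hinj x hx a a.2 ha),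
        fun c => by
          obtain ⟨a, ha, hc⟩ := hsurj x hx c
          exact ⟨⟨a, ha⟩, hc⟩⟩
    have : FiniteDimensional 𝕜 B := l.finiteDimensional
    exact ⟨l.toContinuousLinearEquiv, by ext a; rfl⟩
  refine ⟨fun x => ((K x).comp 𝔪.subtypeL).inverse (b x), ?_, fun x => Subtype.mem _, ?_⟩
  · have h1 : ContMDiffOn 𝓘(𝕜, E) 𝓘(𝕜, 𝔪 →L[𝕜] B) ∞ (fun x => (K x).comp 𝔪.subtypeL) W :=
      ((ContinuousLinearMap.compL 𝕜 𝔪 A B).flip 𝔪.subtypeL).contDiff.contMDiff.comp_contMDiffOn hK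
    have h2 : ContMDiffOn 𝓘(𝕜, E) 𝓘(𝕜, B →L[𝕜] 𝔪) ∞
        (fun x => ((K x).comp 𝔪.subtypeL).inverse) W := by
      intro x hx
      obtain ⟨e, he⟩ := he x hx
      have h3 : ContDiffAt 𝕜 ∞ (ContinuousLinearMap.inverse : (𝔪 →L[𝕜] B) → _)
          ((K x).comp 𝔪.subtypeL) := by
        rw [← he]
        exact contDiffAt_map_inverse e
      exact ContDiffAt.comp_contMDiffWithinAt (f := fun x => (K x).comp 𝔪.subtypeL) h3 (h1 x hx)
    exact 𝔪.subtypeL.contDiff.contMDiff.comp_contMDiffOn (h2.clm_apply hb)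
  · intro x hx
    obtain ⟨e, he⟩ := he x hx
    have h4 : ((K x).comp 𝔪.subtypeL) (((K x).comp 𝔪.subtypeL).inverse (b x)) = b x := by
      rw [← he, ContinuousLinearMap.inverse_equiv]
      exact e.apply_symm_apply _
    exact h4

end Lifts

/-! ### Brackets on a homogeneous space through lifts to the group. -/

section HomogeneousBracket

variable {𝕜 : Type*} [RCLike 𝕜]
  {E : Type*} [NormedAddCommGroup E] [NormedSpace 𝕜 E] [FiniteDimensional 𝕜 E] [CompleteSpace E]
  {G : Type*} [TopologicalSpace G] [ChartedSpace E G] [Group G] [LieGroup 𝓘(𝕜, E) ∞ G]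
  {V : Type*} [NormedAddCommGroup V] [NormedSpace 𝕜 V] [CompleteSpace V] {P : Subgroup G}
  [ChartedSpace V (G ⧸ P)] [IsManifold 𝓘(𝕜, V) ∞ (G ⧸ P)]
  (hp : Manifold.IsSubmersion 𝓘(𝕜, E) 𝓘(𝕜, V) ∞ (QuotientGroup.mk : G → G ⧸ P))

include hp

/-- The Lie bracket of two vector fields on a homogeneous space, in terms of lifts to the group. -/
theorem fieldBracket_eq_quotientDeriv {O : Set (G ⧸ P)} (hO : IsOpen O) {ξ η : G ⧸ P → V}
    (hξ : IsSmoothAlong 𝕜 V V id ξ O) (hη : IsSmoothAlong 𝕜 V V id η O) {Z W : G → E}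
    (hZ : ContMDiffOn 𝓘(𝕜, E) 𝓘(𝕜, E) ∞ Z (QuotientGroup.mk ⁻¹' O))
    (hW : ContMDiffOn 𝓘(𝕜, E) 𝓘(𝕜, E) ∞ W (QuotientGroup.mk ⁻¹' O))
    (hZξ : ∀ g, (QuotientGroup.mk g : G ⧸ P) ∈ O →
      quotientDeriv 𝕜 E V P g (Z g) = ξ (QuotientGroup.mk g))
    (hWη : ∀ g, (QuotientGroup.mk g : G ⧸ P) ∈ O →
      quotientDeriv 𝕜 E V P g (W g) = η (QuotientGroup.mk g)) {g : G}
    (hg : (QuotientGroup.mk g : G ⧸ P) ∈ O) :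
    fieldBracket 𝕜 ξ η (QuotientGroup.mk g : G ⧸ P) = quotientDeriv 𝕜 E V P g
      (modelBracket 𝕜 E G (Z g) (W g) + modelDeriv 𝕜 E E W g (leftField 𝕜 E g (Z g)) -
        modelDeriv 𝕜 E E Z g (leftField 𝕜 E g (W g))) := by
  set p : G → G ⧸ P := QuotientGroup.mk with hpdef
  set ψ := extChartAt 𝓘(𝕜, V) (p g) with hψ
  set U := O ∩ (chartAt V (p g)).source with hUdef
  have hU : IsOpen U := hO.inter (chartAt V (p g)).open_source
  have hgU : p g ∈ U := ⟨hg, mem_chart_source V (p g)⟩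
  have hψs : ContMDiffOn 𝓘(𝕜, V) 𝓘(𝕜, V) ∞ ψ U :=
    (contMDiffOn_extChartAt (I := 𝓘(𝕜, V)) (x := p g)).mono Set.inter_subset_right
  have hUO : U ⊆ O := Set.inter_subset_left
  have hpc : Continuous p := hp.contMDiff.continuous
  have hU' : IsOpen (p ⁻¹' U) := hU.preimage hpc
  have hφs : ContMDiffOn 𝓘(𝕜, E) 𝓘(𝕜, V) ∞ (ψ ∘ p) (p ⁻¹' U) :=
    hψs.comp hp.contMDiff.contMDiffOn fun x hx => hx
  -- the derivative of `ψ ∘ p` in the left trivialization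
  let K : G → E →L[𝕜] V := fun h => (modelDeriv 𝕜 E V (ψ ∘ p) h).comp (leftField 𝕜 E h)
  have hψd : ∀ h ∈ p ⁻¹' U, MDifferentiableAt 𝓘(𝕜, V) 𝓘(𝕜, V) ψ (p h) := fun h hh =>
    (hψs.contMDiffAt (hU.mem_nhds hh)).mdifferentiableAt (by simp)
  have hKT : ∀ h ∈ p ⁻¹' U, ∀ X, K h X = modelDeriv 𝕜 V V ψ (p h) (quotientDeriv 𝕜 E V P h X) :=
    fun h hh X => modelDeriv_comp_apply h (hψd h hh) (mdifferentiableAt_quotientMk hp h) _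
  have hLs : ∀ X : E, IsSmoothAlong 𝕜 E E (id : G → G) (fun h => leftField 𝕜 E h X) (p ⁻¹' U) :=
    fun X => (isSmoothAlong_leftField X).mono (Set.subset_univ _)
  have hKs : ContMDiffOn 𝓘(𝕜, E) 𝓘(𝕜, E →L[𝕜] V) ∞ K (p ⁻¹' U) :=
    contMDiffOn_of_forall_apply fun X =>
      IsSmoothAlong.contMDiffOn_modelDeriv hU' hφs (hLs X) fun y hy => hy
  have hKd : MDifferentiableAt 𝓘(𝕜, E) 𝓘(𝕜, E →L[𝕜] V) K g :=
    (hKs.contMDiffAt (hU'.mem_nhds hgU)).mdifferentiableAt (by simp)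
  have hO' : IsOpen (p ⁻¹' O) := hO.preimage hpc
  have hZd := (hZ.contMDiffAt (hO'.mem_nhds hg)).mdifferentiableAt (n := ∞) (by simp)
  have hWd := (hW.contMDiffAt (hO'.mem_nhds hg)).mdifferentiableAt (n := ∞) (by simp)
  -- differentiating a vector field on `G ⧸ P` through its lift
  have hderiv : ∀ (ζ : G ⧸ P → V) (Y : G → E), IsSmoothAlong 𝕜 V V id ζ O →
      MDifferentiableAt 𝓘(𝕜, E) 𝓘(𝕜, E) Y g →
      (∀ h, p h ∈ O → quotientDeriv 𝕜 E V P h (Y h) = ζ (p h)) → ∀ X : E,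
      modelDeriv 𝕜 V V (fun y => modelDeriv 𝕜 V V ψ y (ζ y)) (p g) (quotientDeriv 𝕜 E V P g X) =
        modelDeriv 𝕜 E V (fun h => K h (Y g)) g (leftField 𝕜 E g X) +
          K g (modelDeriv 𝕜 E E Y g (leftField 𝕜 E g X)) := by
    intro ζ Y hζ hY hYζ X
    have hs : ContMDiffOn 𝓘(𝕜, V) 𝓘(𝕜, V) ∞ (fun y => modelDeriv 𝕜 V V ψ y (ζ y)) U :=
      IsSmoothAlong.contMDiffOn_modelDeriv hU hψs (hζ.mono hUO) fun y hy => hy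
    have h1 := modelDeriv_comp_apply g
      ((hs.contMDiffAt (hU.mem_nhds hgU)).mdifferentiableAt (by simp))
      (mdifferentiableAt_quotientMk hp g) (leftField 𝕜 E g X)
    rw [quotientDeriv_apply, ← h1, ← modelDeriv_clm_apply hKd hY]
    refine congrArg (fun L : E →L[𝕜] V => L _) (modelDeriv_congr ?_)
    filter_upwards [hU'.mem_nhds hgU] with h hh
    rw [hKT h hh, hYζ h (hUO hh)]
    rfl
  have hKg : ∀ X, K g X = quotientDeriv 𝕜 E V P g X := by
    intro X
    rw [hKT g hgU, hψ, modelDeriv_extChartAt_self]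
    rfl
  have hbr := modelDeriv_fieldBracket hU hψs (hξ.mono hUO) (hη.mono hUO) hgU
  -- On the group only the left-invariant fields with the frozen values `Z g` and `W g` are
  -- bracketed; the variation of `Z` and `W` enters through the product rule in `hderiv`.
  have hbrG := modelDeriv_fieldBracket hU' hφs (hLs (Z g)) (hLs (W g)) hgU
  rw [fieldBracket_leftField] at hbrG
  have hbrG' : K g (modelBracket 𝕜 E G (Z g) (W g)) =
      modelDeriv 𝕜 E V (fun h => K h (W g)) g (leftField 𝕜 E g (Z g)) -
        modelDeriv 𝕜 E V (fun h => K h (Z g)) g (leftField 𝕜 E g (W g)) := hbrG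
  rw [← hZξ g hg, ← hWη g hg, hderiv η W hη hWd hWη, hderiv ξ Z hξ hZd hZξ, hψ,
    modelDeriv_extChartAt_self] at hbr
  rw [← hKg, map_sub, map_add, hbrG']
  refine Eq.trans (b := ContinuousLinearMap.id 𝕜 V (fieldBracket 𝕜 ξ η (p g))) rfl ?_
  rw [hbr]
  abel

variable {C : Submodule 𝕜 E} (hC : ∀ g X, quotientDeriv 𝕜 E V P g X = 0 ↔ X ∈ C)

include hC

/-- Smooth vector fields on a homogeneous space have smooth lifts to the group. -/
theorem exists_contMDiffOn_lift {O : Set (G ⧸ P)} (hO : IsOpen O) {ξ : G ⧸ P → V}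
    (hξ : IsSmoothAlong 𝕜 V V id ξ O) (x : G ⧸ P) :
    ∃ Z : G → E, ContMDiffOn 𝓘(𝕜, E) 𝓘(𝕜, E) ∞ Z
        (QuotientGroup.mk ⁻¹' (O ∩ (chartAt V x).source)) ∧
      ∀ g, (QuotientGroup.mk g : G ⧸ P) ∈ O ∩ (chartAt V x).source →
        quotientDeriv 𝕜 E V P g (Z g) = ξ (QuotientGroup.mk g) := by
  set p : G → G ⧸ P := QuotientGroup.mk with hpdef
  set ψ := extChartAt 𝓘(𝕜, V) x with hψ
  set U := O ∩ (chartAt V x).source with hUdef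
  have hU : IsOpen U := hO.inter (chartAt V x).open_source
  have hψs : ContMDiffOn 𝓘(𝕜, V) 𝓘(𝕜, V) ∞ ψ U :=
    (contMDiffOn_extChartAt (I := 𝓘(𝕜, V)) (x := x)).mono Set.inter_subset_right
  have hU' : IsOpen (p ⁻¹' U) := hU.preimage hp.contMDiff.continuous
  have hφs : ContMDiffOn 𝓘(𝕜, E) 𝓘(𝕜, V) ∞ (ψ ∘ p) (p ⁻¹' U) :=
    hψs.comp hp.contMDiff.contMDiffOn fun x hx => hx
  let K : G → E →L[𝕜] V := fun h => (modelDeriv 𝕜 E V (ψ ∘ p) h).comp (leftField 𝕜 E h)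
  have hKT : ∀ h ∈ p ⁻¹' U, ∀ X, K h X = modelDeriv 𝕜 V V ψ (p h) (quotientDeriv 𝕜 E V P h X) :=
    fun h hh X => modelDeriv_comp_apply h
      ((hψs.contMDiffAt (hU.mem_nhds hh)).mdifferentiableAt (by simp))
      (mdifferentiableAt_quotientMk hp h) _
  have hKs : ContMDiffOn 𝓘(𝕜, E) 𝓘(𝕜, E →L[𝕜] V) ∞ K (p ⁻¹' U) :=
    contMDiffOn_of_forall_apply fun X =>
      IsSmoothAlong.contMDiffOn_modelDeriv hU' hφs
        ((isSmoothAlong_leftField X).mono (Set.subset_univ _)) fun y hy => hy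
  have hψinv : ∀ y ∈ U, (modelDeriv 𝕜 V V ψ y).IsInvertible := fun y hy =>
    isInvertible_mfderiv_extChartAt (I := 𝓘(𝕜, V)) (by rw [extChartAt_source]; exact hy.2)
  have hψinj : ∀ y ∈ U, Function.Injective (modelDeriv 𝕜 V V ψ y) := fun y hy => by
    obtain ⟨e, he⟩ := hψinv y hy
    rw [← he]; exact e.injective
  have hψsurj : ∀ y ∈ U, Function.Surjective (modelDeriv 𝕜 V V ψ y) := fun y hy => by
    obtain ⟨e, he⟩ := hψinv y hy
    rw [← he]; exact e.surjective
  have hb : ContMDiffOn 𝓘(𝕜, E) 𝓘(𝕜, V) ∞ (fun h => modelDeriv 𝕜 V V ψ (p h) (ξ (p h)))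
      (p ⁻¹' U) := by
    have : ContMDiffOn 𝓘(𝕜, V) 𝓘(𝕜, V) ∞ (fun y => modelDeriv 𝕜 V V ψ y (ξ y)) U :=
      IsSmoothAlong.contMDiffOn_modelDeriv hU hψs (hξ.mono Set.inter_subset_left) fun y hy => hy
    exact this.comp hp.contMDiff.contMDiffOn fun y hy => hy
  -- A lift is unique only modulo `C`; requiring values in a complement makes the linear equation
  -- uniquely solvable.
  obtain ⟨𝔪, h𝔪⟩ := Submodule.exists_isCompl C
  have hinj : ∀ h ∈ (p ⁻¹' U), ∀ a ∈ 𝔪, K h a = 0 → a = 0 := by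
    intro h hh a ha h0
    rw [hKT h hh] at h0
    have h1 := hψinj _ hh (h0.trans (map_zero _).symm)
    exact Submodule.disjoint_def.1 h𝔪.disjoint a ((hC h a).1 h1) ha
  have hsurj : ∀ h ∈ (p ⁻¹' U), ∀ c, ∃ a ∈ 𝔪, K h a = c := by
    intro h hh c
    obtain ⟨v, rfl⟩ := hψsurj _ hh c
    obtain ⟨X, rfl⟩ := quotientDeriv_surjective hp h v
    obtain ⟨Y, hY, a, ha, rfl⟩ := Submodule.mem_sup.1
      (show X ∈ C ⊔ 𝔪 from h𝔪.sup_eq_top ▸ Submodule.mem_top)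
    refine ⟨a, ha, ?_⟩
    rw [hKT h hh, map_add (quotientDeriv 𝕜 E V P h), (hC h Y).2 hY, zero_add]
  obtain ⟨Z, hZ, -, hKZ⟩ := exists_contMDiffOn_solution (𝔪 := 𝔪) hKs hb hinj hsurj
  refine ⟨Z, hZ, fun g hg => hψinj _ hg ?_⟩
  rw [← hKT g hg, hKZ g hg]

/-- The Lie bracket of sections of two invariant distributions. -/
theorem exists_fieldBracket_eq {O : Set (G ⧸ P)} (hO : IsOpen O) {ξ η : G ⧸ P → V}
    (hξ : IsSmoothAlong 𝕜 V V id ξ O) (hη : IsSmoothAlong 𝕜 V V id η O) {F F' : Submodule 𝕜 E}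
    (hF : C ≤ F) (hF' : C ≤ F')
    (hξF : ∀ g, (QuotientGroup.mk g : G ⧸ P) ∈ O →
      ∃ X ∈ F, quotientDeriv 𝕜 E V P g X = ξ (QuotientGroup.mk g))
    (hηF : ∀ g, (QuotientGroup.mk g : G ⧸ P) ∈ O →
      ∃ X ∈ F', quotientDeriv 𝕜 E V P g X = η (QuotientGroup.mk g)) {g : G}
    (hg : (QuotientGroup.mk g : G ⧸ P) ∈ O) :
    ∃ Z ∈ F, ∃ W ∈ F', ∃ A ∈ F, ∃ B ∈ F',
      quotientDeriv 𝕜 E V P g Z = ξ (QuotientGroup.mk g) ∧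
      quotientDeriv 𝕜 E V P g W = η (QuotientGroup.mk g) ∧
      fieldBracket 𝕜 ξ η (QuotientGroup.mk g : G ⧸ P) =
        quotientDeriv 𝕜 E V P g (modelBracket 𝕜 E G Z W + B - A) := by
  set x : G ⧸ P := QuotientGroup.mk g
  set U := O ∩ (chartAt V x).source
  have hU : IsOpen U := hO.inter (chartAt V x).open_source
  have hgU : x ∈ U := ⟨hg, mem_chart_source V x⟩
  have hUO : U ⊆ O := Set.inter_subset_left
  obtain ⟨Z, hZs, hZ⟩ := exists_contMDiffOn_lift hp hC hO hξ x
  obtain ⟨W, hWs, hW⟩ := exists_contMDiffOn_lift hp hC hO hη x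
  -- Two lifts of a vector differ by an element of `C ≤ S`, so every lift of a section takes values
  -- in `S`, and then so do its derivatives.
  have hmem : ∀ (ζ : G ⧸ P → V) (Y : G → E) (S : Submodule 𝕜 E), C ≤ S →
      (∀ h, (QuotientGroup.mk h : G ⧸ P) ∈ U →
        quotientDeriv 𝕜 E V P h (Y h) = ζ (QuotientGroup.mk h)) →
      (∀ h, (QuotientGroup.mk h : G ⧸ P) ∈ O →
        ∃ X ∈ S, quotientDeriv 𝕜 E V P h X = ζ (QuotientGroup.mk h)) →
      ∀ h, (QuotientGroup.mk h : G ⧸ P) ∈ U → Y h ∈ S := by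
    intro ζ Y S hS h1 h2 h hh
    obtain ⟨X, hX, hXζ⟩ := h2 h (hUO hh)
    have : Y h - X ∈ C := by rw [← hC h, map_sub, h1 h hh, hXζ, sub_self]
    have := add_mem (hS this) hX
    rwa [sub_add_cancel] at this
  have hZF := hmem ξ Z F hF hZ hξF
  have hWF := hmem η W F' hF' hW hηF
  have hU' : IsOpen ((QuotientGroup.mk : G → G ⧸ P) ⁻¹' U) := hU.preimage hp.contMDiff.continuous
  have hev : ∀ᶠ h in 𝓝 g, (QuotientGroup.mk h : G ⧸ P) ∈ U := hU'.mem_nhds hgU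
  refine ⟨Z g, hZF g hgU, W g, hWF g hgU, modelDeriv 𝕜 E E Z g (leftField 𝕜 E g (W g)), ?_,
    modelDeriv 𝕜 E E W g (leftField 𝕜 E g (Z g)), ?_, hZ g hgU, hW g hgU, ?_⟩
  · exact modelDeriv_mem ((hZs.contMDiffAt (hU'.mem_nhds hgU)).mdifferentiableAt (n := ∞) (by simp))
      (hev.mono fun h hh => hZF h hh) _
  · exact modelDeriv_mem ((hWs.contMDiffAt (hU'.mem_nhds hgU)).mdifferentiableAt (n := ∞) (by simp))
      (hev.mono fun h hh => hWF h hh) _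
  · exact fieldBracket_eq_quotientDeriv hp hU (hξ.mono hUO) (hη.mono hUO) hZs hWs hZ hW hgU

end HomogeneousBracket

/-! ### Smoothness and locality of the bracket. -/

section SmoothBracket

variable {𝕜 : Type*} [RCLike 𝕜] {E : Type*} [NormedAddCommGroup E] [NormedSpace 𝕜 E]
  [CompleteSpace E]
  {M : Type*} [TopologicalSpace M] [ChartedSpace E M] [IsManifold 𝓘(𝕜, E) ∞ M]

theorem IsSmoothAlong.fieldBracket {V W : M → E} {U : Set M} (hU : IsOpen U)
    (hV : IsSmoothAlong 𝕜 E E id V U) (hW : IsSmoothAlong 𝕜 E E id W U) :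
    IsSmoothAlong 𝕜 E E id (fieldBracket 𝕜 V W) U := by
  intro x hx
  have hV' : ContMDiffAt 𝓘(𝕜, E) 𝓘(𝕜, E).tangent ((⊤ : ℕ∞) : WithTop ℕ∞)
      (fun y => (⟨y, V y⟩ : TangentBundle 𝓘(𝕜, E) M)) x := hV.contMDiffAt (hU.mem_nhds hx)
  have hW' : ContMDiffAt 𝓘(𝕜, E) 𝓘(𝕜, E).tangent ((⊤ : ℕ∞) : WithTop ℕ∞)
      (fun y => (⟨y, W y⟩ : TangentBundle 𝓘(𝕜, E) M)) x := hW.contMDiffAt (hU.mem_nhds hx)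
  have : IsManifold 𝓘(𝕜, E) (((⊤ : ℕ∞) : WithTop ℕ∞) + 1) M := ‹IsManifold 𝓘(𝕜, E) ∞ M›
  have h := ContMDiffAt.mlieBracket_vectorField (m := ⊤) hV' hW' (by
    rw [minSmoothness_of_isRCLikeNormedField]; exact le_rfl)
  exact h.contMDiffWithinAt

theorem fieldBracket_congr {V V' W W' : M → E} {x : M} (hV : V =ᶠ[𝓝 x] V') (hW : W =ᶠ[𝓝 x] W') :
    fieldBracket 𝕜 V W x = fieldBracket 𝕜 V' W' x :=
  Filter.EventuallyEq.mlieBracket_vectorField_eq (I := 𝓘(𝕜, E)) (V := V') (W := W') hV hW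

theorem fieldBracket_zero_left (W : M → E) (x : M) :
    fieldBracket 𝕜 (fun _ : M => (0 : E)) W x = 0 :=
  congrFun (VectorField.mlieBracket_zero_left (I := 𝓘(𝕜, E)) (W := W)) x

theorem fieldBracket_zero_right (V : M → E) (x : M) :
    fieldBracket 𝕜 V (fun _ : M => (0 : E)) x = 0 :=
  congrFun (VectorField.mlieBracket_zero_right (I := 𝓘(𝕜, E)) (W := V)) x

end SmoothBracket

/-! ### The invariant distributions on G/P and brackets of their sections. -/

section FlagDistribution

variable {𝕜 : Type*} [RCLike 𝕜]
  {E : Type*} [NormedAddCommGroup E] [NormedSpace 𝕜 E] [FiniteDimensional 𝕜 E] [CompleteSpace E]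
  {G : Type*} [TopologicalSpace G] [ChartedSpace E G] [Group G] [LieGroup 𝓘(𝕜, E) ∞ G]
  {k : ℕ} {𝔤 : KGrading 𝕜 (GroupLieAlgebra 𝓘(𝕜, E) G) k}

theorem modelBracket_sub_left (X X' Y : E) :
    modelBracket 𝕜 E G (X - X') Y = modelBracket 𝕜 E G X Y - modelBracket 𝕜 E G X' Y :=
  sub_lie (L := GroupLieAlgebra 𝓘(𝕜, E) G) (M := GroupLieAlgebra 𝓘(𝕜, E) G) X X' Y

theorem modelBracket_sub_right (X Y Y' : E) :
    modelBracket 𝕜 E G X (Y - Y') = modelBracket 𝕜 E G X Y - modelBracket 𝕜 E G X Y' :=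
  lie_sub (L := GroupLieAlgebra 𝓘(𝕜, E) G) (M := GroupLieAlgebra 𝓘(𝕜, E) G) X Y Y'

variable [ChartedSpace (FlagModel 𝔤) (FlagManifold 𝔤)]
  [IsManifold 𝓘(𝕜, FlagModel 𝔤) ∞ (FlagManifold 𝔤)]

variable (𝔤) in
/-- The derivative of the projection `G → G/P`, in the left-invariant trivialization. -/
abbrev flagDeriv (g : G) : E →L[𝕜] FlagModel 𝔤 :=
  quotientDeriv 𝕜 E (FlagModel 𝔤) (parabolicSubgroup 𝔤) g

theorem IsHomogeneousStructure.isSubmersion_mk (h : IsHomogeneousStructure 𝔤) :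
    Manifold.IsSubmersion 𝓘(𝕜, E) 𝓘(𝕜, FlagModel 𝔤) ∞
      (QuotientGroup.mk : G → FlagManifold 𝔤) := h.isSubmersion

theorem flagDeriv_eq_zero_iff [LieAlgebra.IsSemisimple 𝕜 (GroupLieAlgebra 𝓘(𝕜, E) G)]
    (h : IsHomogeneousStructure 𝔤) (g : G) (X : E) :
    flagDeriv 𝔤 g X = 0 ↔ X ∈ modelFilt 𝔤 0 := by
  obtain ⟨Ψ, B, B', h1, ht, hs, hs', hP, hd⟩ := exists_flag_slice 𝔤
  refine quotientDeriv_eq_zero_iff h.isSubmersion_mk Ψ.open_source h1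
    (u := fun g => (Ψ g).1) ?_ (fun g hg h hh hgh => (hP g hg h hh).2 hgh) hd
    (finrank_flagModel_add 𝔤) g X
  exact (contDiff_fst (𝕜 := 𝕜) (n := ∞)).contMDiff.comp_contMDiffOn hs

variable (𝔤) in
/-- The invariant distribution on `G/P` which corresponds to `𝔤⁻ⁿ / 𝔭`. -/
def flagDist (n : ℕ) (x : FlagManifold 𝔤) : Submodule 𝕜 (FlagModel 𝔤) :=
  (modelFilt 𝔤 (-n)).map (flagDeriv 𝔤 x.out).toLinearMap

/-- Frees the definition from its chosen representative: two representatives differ by an element of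
P, whose adjoint action preserves the filtration. -/
theorem mem_flagDist_iff (h : IsHomogeneousStructure 𝔤) {n : ℕ} {g : G} {x : FlagManifold 𝔤}
    (hg : QuotientGroup.mk g = x) {v : FlagModel 𝔤} :
    v ∈ flagDist 𝔤 n x ↔ ∃ X ∈ modelFilt 𝔤 (-n), flagDeriv 𝔤 g X = v := by
  have aux : ∀ a b : G, (QuotientGroup.mk a : FlagManifold 𝔤) = QuotientGroup.mk b →
      (∃ X ∈ modelFilt 𝔤 (-n), flagDeriv 𝔤 a X = v) →
        ∃ X ∈ modelFilt 𝔤 (-n), flagDeriv 𝔤 b X = v := by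
    rintro a b hab ⟨X, hX, rfl⟩
    refine ⟨_, modelAd_mem 𝔤 ?_ hX, (quotientDeriv_eq_of_mk_eq h.isSubmersion_mk hab X).symm⟩
    rw [← QuotientGroup.eq, hab]
  have hout : (QuotientGroup.mk x.out : FlagManifold 𝔤) = QuotientGroup.mk g := by
    rw [QuotientGroup.out_eq', hg]
  exact ⟨fun hv => aux _ _ hout hv, fun hv => aux _ _ hout.symm hv⟩

theorem flagDeriv_mem_flagDist (h : IsHomogeneousStructure 𝔤) {n : ℕ} {g : G}
    {x : FlagManifold 𝔤} (hg : QuotientGroup.mk g = x) {X : E} (hX : X ∈ modelFilt 𝔤 (-n)) :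
    flagDeriv 𝔤 g X ∈ flagDist 𝔤 n x :=
  (mem_flagDist_iff h hg).2 ⟨X, hX, rfl⟩

theorem flagDist_mono {m n : ℕ} (hmn : m ≤ n) (x : FlagManifold 𝔤) :
    flagDist 𝔤 m x ≤ flagDist 𝔤 n x :=
  Submodule.map_mono (modelFilt_antitone 𝔤 (by omega))

theorem flagDist_eq_top (h : IsHomogeneousStructure 𝔤) {n : ℕ} (hn : k ≤ n) (x : FlagManifold 𝔤) :
    flagDist 𝔤 n x = ⊤ := by
  rw [flagDist, modelFilt_eq_top 𝔤 (by omega), Submodule.map_top]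
  exact LinearMap.range_eq_top.2 (quotientDeriv_surjective h.isSubmersion_mk _)

variable [LieAlgebra.IsSemisimple 𝕜 (GroupLieAlgebra 𝓘(𝕜, E) G)]

theorem flagDist_zero (h : IsHomogeneousStructure 𝔤) (x : FlagManifold 𝔤) :
    flagDist 𝔤 0 x = ⊥ := by
  rw [eq_bot_iff]
  rintro _ ⟨X, hX, rfl⟩
  exact (flagDeriv_eq_zero_iff h _ X).2 (by simpa using hX)

/-- A vector field on `G/P` which is a smooth section of the distribution `flagDist 𝔤 n`. -/
structure IsFlagSection (n : ℕ) (U : Set (FlagManifold 𝔤)) (ξ : FlagManifold 𝔤 → FlagModel 𝔤) :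
    Prop where
  isSmoothAlong : IsSmoothAlong 𝕜 (FlagModel 𝔤) (FlagModel 𝔤) id ξ U
  mem : ∀ y ∈ U, ξ y ∈ flagDist 𝔤 n y

/-- The bracket of sections is given by the algebraic bracket up to terms of higher degree. -/
theorem IsFlagSection.exists_fieldBracket_eq (h : IsHomogeneousStructure 𝔤) {i j : ℕ}
    {U : Set (FlagManifold 𝔤)} (hU : IsOpen U) {ξ η : FlagManifold 𝔤 → FlagModel 𝔤}
    (hξ : IsFlagSection (i + 1) U ξ) (hη : IsFlagSection (j + 1) U η) {g : G}
    {x : FlagManifold 𝔤} (hg : QuotientGroup.mk g = x) (hx : x ∈ U) {X Y : E}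
    (hX : X ∈ modelFilt 𝔤 (-(i + 1 : ℕ)))
    (hXξ : flagDeriv 𝔤 g X = ξ x) (hYη : flagDeriv 𝔤 g Y = η x) :
    ∃ R ∈ modelFilt 𝔤 (-(i + j + 1 : ℕ)),
      fieldBracket 𝕜 ξ η x = flagDeriv 𝔤 g (modelBracket 𝕜 E G X Y + R) := by
  subst hg
  have hC := flagDeriv_eq_zero_iff h
  obtain ⟨Z, hZ, W, hW, A, hA, B, hB, hZξ, hWη, hbr⟩ :=
    _root_.exists_fieldBracket_eq h.isSubmersion_mk hC hU hξ.isSmoothAlong hη.isSmoothAlong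
      (modelFilt_antitone 𝔤 (i := -(i + 1 : ℕ)) (by omega))
      (modelFilt_antitone 𝔤 (i := -(j + 1 : ℕ)) (by omega))
      (fun a ha => (mem_flagDist_iff h rfl).1 (hξ.mem _ ha))
      (fun a ha => (mem_flagDist_iff h rfl).1 (hη.mem _ ha)) hx
  -- Lifts of the same vector differ in degree at least 0. All errors then have degree at least
  -- −(i+1) or −(j+1), hence at least −(i+j+1); this is why both degrees are written as successors.
  have hZX : Z - X ∈ modelFilt 𝔤 0 := by
    rw [← hC g, map_sub, hXξ, sub_eq_zero]; exact hZξ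
  have hWY : W - Y ∈ modelFilt 𝔤 0 := by
    rw [← hC g, map_sub, hYη, sub_eq_zero]; exact hWη
  refine ⟨modelBracket 𝕜 E G (Z - X) W + modelBracket 𝕜 E G X (W - Y) + B - A, ?_, ?_⟩
  · have h1 := modelBracket_mem_modelFilt 𝔤 hZX hW
    have h2 := modelBracket_mem_modelFilt 𝔤 hX hWY
    refine sub_mem (add_mem (add_mem ?_ ?_) ?_) ?_
    · exact modelFilt_antitone 𝔤 (by push_cast; omega) h1
    · exact modelFilt_antitone 𝔤 (by push_cast; omega) h2
    · exact modelFilt_antitone 𝔤 (by push_cast; omega) hB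
    · exact modelFilt_antitone 𝔤 (by push_cast; omega) hA
  · rw [hbr, modelBracket_sub_left, modelBracket_sub_right]
    congr 1
    abel

theorem IsFlagSection.fieldBracket (h : IsHomogeneousStructure 𝔤) {i j : ℕ}
    {U : Set (FlagManifold 𝔤)} (hU : IsOpen U) {ξ η : FlagManifold 𝔤 → FlagModel 𝔤}
    (hξ : IsFlagSection (i + 1) U ξ) (hη : IsFlagSection (j + 1) U η) :
    IsFlagSection (i + j + 2) U (fieldBracket 𝕜 ξ η) := by
  refine ⟨hξ.isSmoothAlong.fieldBracket hU hη.isSmoothAlong, fun y hy => ?_⟩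
  obtain ⟨g, hg⟩ := QuotientGroup.mk_surjective y
  obtain ⟨X, hX, hXξ⟩ := (mem_flagDist_iff h hg).1 (hξ.mem y hy)
  obtain ⟨Y, hY, hYη⟩ := (mem_flagDist_iff h hg).1 (hη.mem y hy)
  obtain ⟨R, hR, hbr⟩ := hξ.exists_fieldBracket_eq h hU hη hg hy hX hXξ hYη
  rw [hbr]
  refine flagDeriv_mem_flagDist h hg (add_mem ?_ ?_)
  · exact modelFilt_antitone 𝔤 (by push_cast; omega) (modelBracket_mem_modelFilt 𝔤 hX hY)
  · exact modelFilt_antitone 𝔤 (by push_cast; omega) hR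

/-- The sections of `flagDist 𝔤 n` obtained from elements of `𝔤⁻ⁿ` and a local section of the
projection `G → G/P`. -/
theorem isFlagSection_flagDeriv (h : IsHomogeneousStructure 𝔤) {U : Set (FlagManifold 𝔤)}
    {σ : FlagManifold 𝔤 → G} (hσ : ContMDiffOn 𝓘(𝕜, FlagModel 𝔤) 𝓘(𝕜, E) ∞ σ U)
    (hpσ : ∀ y ∈ U, QuotientGroup.mk (σ y) = y) {n : ℕ} {X : E} (hX : X ∈ modelFilt 𝔤 (-n)) :
    IsFlagSection n U (fun y => flagDeriv 𝔤 (σ y) X) :=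
  ⟨isSmoothAlong_quotientDeriv h.isSubmersion_mk hσ hpσ X,
    fun y hy => flagDeriv_mem_flagDist h (hpσ y hy) hX⟩

theorem exists_flag_local_section (h : IsHomogeneousStructure 𝔤) (x : FlagManifold 𝔤) :
    ∃ (U : Set (FlagManifold 𝔤)) (σ : FlagManifold 𝔤 → G), IsOpen U ∧ x ∈ U ∧
      ContMDiffOn 𝓘(𝕜, FlagModel 𝔤) 𝓘(𝕜, E) ∞ σ U ∧ ∀ y ∈ U, QuotientGroup.mk (σ y) = y := by
  obtain ⟨g, rfl⟩ := QuotientGroup.mk_surjective x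
  obtain ⟨U, σ, hU, hgU, hσ, hpσ, -⟩ := (h.isSubmersion_mk.isSubmersionAt g).exists_section
  exact ⟨U, σ, hU, hgU, hσ, hpσ⟩

end FlagDistribution

/-! ### The filtration by brackets, regularity and bracket generation. -/

section FlagFiltration

variable {𝕜 : Type*} [RCLike 𝕜]
  {E : Type*} [NormedAddCommGroup E] [NormedSpace 𝕜 E] [FiniteDimensional 𝕜 E] [CompleteSpace E]
  {G : Type*} [TopologicalSpace G] [ChartedSpace E G] [Group G] [LieGroup 𝓘(𝕜, E) ∞ G]
  {k : ℕ} {𝔤 : KGrading 𝕜 (GroupLieAlgebra 𝓘(𝕜, E) G) k}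

variable (𝔤) in
/-- The component `𝔤ᵢ` as a subspace of the model space. -/
def modelComp (i : ℤ) : Submodule 𝕜 E := 𝔤.comp i

theorem modelComp_le_modelFilt (i : ℤ) : modelComp 𝔤 i ≤ modelFilt 𝔤 i := 𝔤.comp_le_filt le_rfl

theorem exists_add_of_mem_modelFilt {i : ℤ} {X : E} (hX : X ∈ modelFilt 𝔤 i) :
    ∃ Y ∈ modelComp 𝔤 i, ∃ Z ∈ modelFilt 𝔤 (i + 1), Y + Z = X :=
  𝔤.exists_add_of_mem_filt hX

theorem modelComp_le_span (n : ℕ) : modelComp 𝔤 (-(n + 2 : ℕ)) ≤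
    Submodule.span 𝕜 {Z : E | ∃ X ∈ modelComp 𝔤 (-(n + 1 : ℕ)), ∃ Y ∈ modelComp 𝔤 (-1),
      modelBracket 𝕜 E G X Y = Z} :=
  𝔤.comp_le_span_lie n

theorem eq_zero_of_mem_modelComp {i j : ℤ} (hij : i < j) {X : E} (h1 : X ∈ modelComp 𝔤 i)
    (h2 : X ∈ modelFilt 𝔤 j) : X = 0 :=
  𝔤.eq_zero_of_mem_comp_of_mem_filt hij h1 h2

variable [ChartedSpace (FlagModel 𝔤) (FlagManifold 𝔤)]
  [IsManifold 𝓘(𝕜, FlagModel 𝔤) ∞ (FlagManifold 𝔤)]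

variable (𝔤) in
/-- The distribution `flagDist 𝔤 n` as a field of tangent subspaces. -/
def flagTangent (n : ℕ) : TangentSubspaces 𝓘(𝕜, FlagModel 𝔤) (FlagManifold 𝔤) := flagDist 𝔤 n

variable [LieAlgebra.IsSemisimple 𝕜 (GroupLieAlgebra 𝓘(𝕜, E) G)]

theorem isSectionOn_flagTangent_iff {n : ℕ} {U : Set (FlagManifold 𝔤)}
    {ξ : FlagManifold 𝔤 → FlagModel 𝔤} :
    IsSectionOn (flagTangent 𝔤 n) U ξ ↔ IsFlagSection n U ξ :=
  ⟨fun h => ⟨h.1, h.2⟩, fun h => ⟨h.1, h.2⟩⟩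

/-- Brackets of sections cannot leave the expected filtration degree. Conversely, the new component
of each degree is spanned by algebraic brackets with degree −1, which sections realize up to lower
filtration steps. -/
theorem symbolFiltration_flagTangent (h : IsHomogeneousStructure 𝔤) (n : ℕ) :
    symbolFiltration (flagTangent 𝔤 1) n = flagTangent 𝔤 n := by
  rcases n with _ | n
  · funext x
    exact (flagDist_zero h x).symm
  induction n with
  | zero => rfl
  | succ n ih =>
    funext x
    change symbolFiltration (flagTangent 𝔤 1) (n + 1) x ⊔ _ = _
    rw [ih]
    apply le_antisymm
    · refine sup_le (flagDist_mono (by omega) x) (Submodule.span_le.2 ?_)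
      rintro _ ⟨U, hU, hx, ξ, η, hξ, hη, rfl⟩
      exact (IsFlagSection.fieldBracket h hU (isSectionOn_flagTangent_iff.1 hξ)
        (isSectionOn_flagTangent_iff.1 hη)).mem x hx
    · obtain ⟨U, σ, hU, hxU, hσ, hpσ⟩ := exists_flag_local_section h x
      intro v hv
      obtain ⟨X, hX, rfl⟩ := (mem_flagDist_iff h (hpσ x hxU)).1 hv
      set S : Submodule 𝕜 (FlagModel 𝔤) := flagDist 𝔤 (n + 1) x ⊔
        Submodule.span 𝕜 {v : FlagModel 𝔤 | ∃ U : Set (FlagManifold 𝔤), IsOpen U ∧ x ∈ U ∧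
          ∃ ξ η : FlagManifold 𝔤 → FlagModel 𝔤, IsSectionOn (flagTangent 𝔤 (n + 1)) U ξ ∧
            IsSectionOn (flagTangent 𝔤 1) U η ∧ v = fieldBracket 𝕜 ξ η x} with hS
      change flagDeriv 𝔤 (σ x) X ∈ S
      have h1 : ∀ Z ∈ modelFilt 𝔤 (-(n + 1 : ℕ)), flagDeriv 𝔤 (σ x) Z ∈ S := fun Z hZ =>
        Submodule.mem_sup_left (flagDeriv_mem_flagDist h (hpσ x hxU) hZ)
      obtain ⟨Y, hY, Z, hZ, rfl⟩ := exists_add_of_mem_modelFilt hX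
      rw [map_add]
      refine add_mem ?_ (h1 Z (by convert hZ using 2; push_cast; ring))
      refine ((modelComp_le_span n).trans (Submodule.span_le.2 ?_) :
        _ ≤ S.comap (flagDeriv 𝔤 (σ x)).toLinearMap) hY
      rintro _ ⟨A, hA, B, hB, rfl⟩
      have hA' := modelComp_le_modelFilt _ hA
      have hB' : B ∈ modelFilt 𝔤 (-(0 + 1 : ℕ)) := modelComp_le_modelFilt _ hB
      have hsA := isFlagSection_flagDeriv h hσ hpσ hA'
      have hsB := isFlagSection_flagDeriv h hσ hpσ hB'
      obtain ⟨R, hR, hbr⟩ := hsA.exists_fieldBracket_eq h hU hsB (hpσ x hxU) hxU hA' rfl rfl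
      have h2 : flagDeriv 𝔤 (σ x) (modelBracket 𝕜 E G A B + R) ∈ S := by
        rw [← hbr]
        exact Submodule.mem_sup_right (Submodule.subset_span
          ⟨U, hU, hxU, _, _, isSectionOn_flagTangent_iff.2 hsA, isSectionOn_flagTangent_iff.2 hsB,
            rfl⟩)
      -- The error `R` projects into the previous step of the filtration, already contained in `S`.
      have h3 := sub_mem h2 (h1 R hR)
      rw [← map_sub, add_sub_cancel_right] at h3
      exact h3

/-- A basis of a complement of 𝔤⁰ in 𝔤⁻ⁿ, moved along a local section of p, is a frame. The
complement is left free so that 𝔤₋₁ itself computes the rank when n = 1. -/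
theorem isSmoothSubbundle_flagTangent (h : IsHomogeneousStructure 𝔤) {n : ℕ} {𝔫 : Submodule 𝕜 E}
    (hd : Disjoint 𝔫 (modelFilt 𝔤 0)) (hsup : 𝔫 ⊔ modelFilt 𝔤 0 = modelFilt 𝔤 (-n)) :
    IsSmoothSubbundle (flagTangent 𝔤 n) (Module.finrank 𝕜 𝔫) := by
  intro x
  obtain ⟨U, σ, hU, hxU, hσ, hpσ⟩ := exists_flag_local_section h x
  let b := Module.finBasis 𝕜 𝔫
  have hb : ∀ i, (b i : E) ∈ modelFilt 𝔤 (-n) := fun i => hsup ▸ Submodule.mem_sup_left (b i).2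
  refine ⟨U, hU, hxU, fun i y => flagDeriv 𝔤 (σ y) (b i), fun i =>
    isSectionOn_flagTangent_iff.2 (isFlagSection_flagDeriv h hσ hpσ (hb i)), fun y hy => ⟨?_, ?_⟩⟩
  · have hli : LinearIndependent 𝕜 fun i =>
        ((flagDeriv 𝔤 (σ y)).toLinearMap.comp 𝔫.subtype) (b i) := by
      refine b.linearIndependent.map' _ (LinearMap.ker_eq_bot'.2 fun a ha => Subtype.ext ?_)
      exact Submodule.disjoint_def.1 hd a a.2 ((flagDeriv_eq_zero_iff h _ _).1 ha)
    exact hli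
  · have h1 : Submodule.span 𝕜 (Set.range fun i => flagDeriv 𝔤 (σ y) (b i)) = flagDist 𝔤 n y := by
      apply le_antisymm
      · refine Submodule.span_le.2 ?_
        rintro _ ⟨i, rfl⟩
        exact flagDeriv_mem_flagDist h (hpσ y hy) (hb i)
      · intro v hv
        obtain ⟨X, hX, rfl⟩ := (mem_flagDist_iff h (hpσ y hy)).1 hv
        rw [← hsup] at hX
        obtain ⟨Y, hY, Z, hZ, rfl⟩ := Submodule.mem_sup.1 hX
        rw [map_add, (flagDeriv_eq_zero_iff h _ Z).2 hZ, add_zero]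
        have h2 : (⊤ : Submodule 𝕜 𝔫) ≤ (Submodule.span 𝕜
            (Set.range fun i => flagDeriv 𝔤 (σ y) (b i))).comap
              ((flagDeriv 𝔤 (σ y)).toLinearMap.comp 𝔫.subtype) := by
          rw [← b.span_eq, Submodule.span_le]
          rintro _ ⟨i, rfl⟩
          exact Submodule.subset_span ⟨i, rfl⟩
        exact h2 (Submodule.mem_top (x := ⟨Y, hY⟩))
    exact h1

theorem exists_isSmoothSubbundle_flagTangent (h : IsHomogeneousStructure 𝔤) (n : ℕ) :
    ∃ r, IsSmoothSubbundle (flagTangent 𝔤 n) r := by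
  have hc := isCompl_modelFilt_modelLow 𝔤 0
  refine ⟨_, isSmoothSubbundle_flagTangent h (𝔫 := modelLow 𝔤 0 ⊓ modelFilt 𝔤 (-n))
    (hc.disjoint.symm.mono_left inf_le_left) ?_⟩
  have hle : modelFilt 𝔤 0 ≤ modelFilt 𝔤 (-n) := modelFilt_antitone 𝔤 (by omega)
  rw [sup_comm, ← sup_inf_assoc_of_le _ hle, hc.sup_eq_top, top_inf_eq]

theorem isSmoothSubbundle_flagTangent_one (h : IsHomogeneousStructure 𝔤) :
    IsSmoothSubbundle (flagTangent 𝔤 1) (Module.finrank 𝕜 (𝔤.comp (-1))) :=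
  isSmoothSubbundle_flagTangent h (𝔫 := modelComp 𝔤 (-1))
    (𝔤.disjoint_comp_filt (by norm_num)) (𝔤.comp_sup_filt (-1))

theorem isRegularOfDepth_flagTangent (h : IsHomogeneousStructure 𝔤) :
    IsRegularOfDepth (flagTangent 𝔤 1) k := by
  constructor
  · intro n
    rw [symbolFiltration_flagTangent h]
    exact exists_isSmoothSubbundle_flagTangent h n
  · intro x
    rw [symbolFiltration_flagTangent h]
    exact flagDist_eq_top h le_rfl x

/-- Iterated brackets realize each filtration step modulo the previous one. The induction also
records that these fields are sections of the right distribution, without which the bracket formula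
could not be applied again. -/
theorem modelFilt_le_span_isIteratedBracket (h : IsHomogeneousStructure 𝔤)
    {U : Set (FlagManifold 𝔤)} {σ : FlagManifold 𝔤 → G} (hU : IsOpen U)
    (hσ : ContMDiffOn 𝓘(𝕜, FlagModel 𝔤) 𝓘(𝕜, E) ∞ σ U)
    (hpσ : ∀ y ∈ U, QuotientGroup.mk (σ y) = y) {x : FlagManifold 𝔤} (hx : x ∈ U) (n : ℕ) :
    modelFilt 𝔤 (-(n + 1 : ℕ)) ≤ Submodule.span 𝕜 {X : E | X ∈ modelFilt 𝔤 (-(n + 1 : ℕ)) ∧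
      ∃ ξ : FlagManifold 𝔤 → FlagModel 𝔤, IsIteratedBracket (flagTangent 𝔤 1) U ξ ∧
        IsFlagSection (n + 1) U ξ ∧ flagDeriv 𝔤 (σ x) X = ξ x} ⊔ modelFilt 𝔤 (-n) := by
  have hsec : ∀ {m : ℕ} {X : E}, X ∈ modelFilt 𝔤 (-m) →
      IsFlagSection m U (fun y => flagDeriv 𝔤 (σ y) X) := isFlagSection_flagDeriv h hσ hpσ
  induction n with
  | zero =>
    intro X hX
    exact Submodule.mem_sup_left (Submodule.subset_span ⟨hX, _,
      IsIteratedBracket.of_section _ (isSectionOn_flagTangent_iff.2 (hsec hX)), hsec hX, rfl⟩)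
  | succ n ih =>
    intro X hX
    set S := Submodule.span 𝕜 {X : E | X ∈ modelFilt 𝔤 (-(n + 1 + 1 : ℕ)) ∧
      ∃ ξ : FlagManifold 𝔤 → FlagModel 𝔤, IsIteratedBracket (flagTangent 𝔤 1) U ξ ∧
        IsFlagSection (n + 1 + 1) U ξ ∧ flagDeriv 𝔤 (σ x) X = ξ x} ⊔ modelFilt 𝔤 (-(n + 1 : ℕ))
      with hS
    obtain ⟨Y, hY, Z, hZ, rfl⟩ := exists_add_of_mem_modelFilt hX
    refine add_mem ?_ (Submodule.mem_sup_right (by convert hZ using 2; push_cast; ring))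
    refine (modelComp_le_span n).trans (Submodule.span_le.2 ?_) hY
    rintro _ ⟨A, hA, B, hB, rfl⟩
    have hB' : B ∈ modelFilt 𝔤 (-(0 + 1 : ℕ)) := modelComp_le_modelFilt _ hB
    have hadB : IsLinearMap 𝕜 (fun A => modelBracket 𝕜 E G A B) :=
      ⟨fun a a' => add_lie (L := GroupLieAlgebra 𝓘(𝕜, E) G) (M := GroupLieAlgebra 𝓘(𝕜, E) G) a a' B,
        fun c a => smul_lie (L := GroupLieAlgebra 𝓘(𝕜, E) G) (M := GroupLieAlgebra 𝓘(𝕜, E) G) c a B⟩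
    refine (ih.trans (sup_le (Submodule.span_le.2 ?_) ?_) : _ ≤ S.comap hadB.mk')
      (modelComp_le_modelFilt _ hA)
    · rintro C ⟨hC, ξ, hξ, hξs, hξC⟩
      obtain ⟨R, hR, hbr⟩ := hξs.exists_fieldBracket_eq h hU (hsec hB') (hpσ x hx) hx hC hξC rfl
      have h1 : modelBracket 𝕜 E G C B + R ∈ S := by
        refine Submodule.mem_sup_left (Submodule.subset_span ⟨add_mem ?_ ?_, _,
          IsIteratedBracket.bracket _ _ hξ (IsIteratedBracket.of_section _
            (isSectionOn_flagTangent_iff.2 (hsec hB'))), hξs.fieldBracket h hU (hsec hB'),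
            hbr.symm⟩)
        · exact modelFilt_antitone 𝔤 (by push_cast; omega) (modelBracket_mem_modelFilt 𝔤 hC hB')
        · exact modelFilt_antitone 𝔤 (by push_cast; omega) hR
      have h2 := sub_mem h1 (Submodule.mem_sup_right hR)
      rwa [add_sub_cancel_right] at h2
    · intro C hC
      exact Submodule.mem_sup_right (modelFilt_antitone 𝔤 (by push_cast; omega)
        (modelBracket_mem_modelFilt 𝔤 hC hB'))

theorem isBracketGenerating_flagTangent (h : IsHomogeneousStructure 𝔤) :
    IsBracketGenerating (flagTangent 𝔤 1) := by
  intro x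
  obtain ⟨U, σ, hU, hxU, hσ, hpσ⟩ := exists_flag_local_section h x
  set S : Submodule 𝕜 (FlagModel 𝔤) := Submodule.span 𝕜 {v : FlagModel 𝔤 |
    ∃ U : Set (FlagManifold 𝔤), IsOpen U ∧ x ∈ U ∧ ∃ ξ : FlagManifold 𝔤 → FlagModel 𝔤,
      IsIteratedBracket (flagTangent 𝔤 1) U ξ ∧ v = ξ x} with hS
  change S = ⊤
  have key : ∀ n : ℕ, modelFilt 𝔤 (-n) ≤ S.comap (flagDeriv 𝔤 (σ x)).toLinearMap := by
    intro n
    induction n with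
    | zero =>
      intro X hX
      have : flagDeriv 𝔤 (σ x) X = 0 := (flagDeriv_eq_zero_iff h _ X).2 (by simpa using hX)
      change flagDeriv 𝔤 (σ x) X ∈ S
      rw [this]
      exact zero_mem _
    | succ n ih =>
      refine (modelFilt_le_span_isIteratedBracket h hU hσ hpσ hxU n).trans
        (sup_le (Submodule.span_le.2 ?_) ih)
      rintro X ⟨-, ξ, hξ, -, hX⟩
      exact Submodule.subset_span ⟨U, hU, hxU, ξ, hξ, hX⟩
  rw [eq_top_iff]
  intro v _
  have hv : v ∈ flagDist 𝔤 k x := by rw [flagDist_eq_top h le_rfl]; trivial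
  obtain ⟨X, hX, rfl⟩ := (mem_flagDist_iff h (hpσ x hxU)).1 hv
  exact key k hX

end FlagFiltration

/-! ### A criterion for locally trivial symbol algebras. -/

section SymbolClass

variable {𝕜 : Type*} [NontriviallyNormedField 𝕜]
  {E : Type*} [NormedAddCommGroup E] [NormedSpace 𝕜 E]
  {H : Type*} [TopologicalSpace H] {I : ModelWithCorners 𝕜 E H}
  {M : Type*} [TopologicalSpace M] [ChartedSpace H M] [IsManifold I 1 M]

theorem symbolClass_eq_iff {D : TangentSubspaces I M} {n : ℕ} {x : M} {v w : TangentSpace I x}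
    {hv : v ∈ symbolFiltration D n x} {hw : w ∈ symbolFiltration D n x} :
    symbolClass D n x v hv = symbolClass D n x w hw ↔ v - w ∈ symbolFiltration D (n - 1) x := by
  rw [symbolClass, symbolClass, Submodule.Quotient.eq]
  rfl

/-- A criterion for the local triviality of the bundle of symbol algebras: there are local families
`s n y : 𝔫 n → T⁻ⁿ_yM` of sections which induce isomorphisms of graded Lie algebras. -/
theorem hasLocallyTrivialSymbol_of_frames {D : TangentSubspaces I M} {L : Type*} [LieRing L]
    [LieAlgebra 𝕜 L] {𝔫 : ℕ → Submodule 𝕜 L}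
    (hlie : ∀ i j, ∀ a ∈ 𝔫 i, ∀ b ∈ 𝔫 j, ⁅a, b⁆ ∈ 𝔫 (i + j))
    (hs : ∀ x : M, ∃ U : Set M, IsOpen U ∧ x ∈ U ∧ ∃ s : ∀ n (y : M), 𝔫 n →ₗ[𝕜] TangentSpace I y,
      (∀ n a, IsSectionOn (symbolFiltration D n) U (fun y => s n y a)) ∧
      (∀ n, ∀ y ∈ U, ∀ a, s n y a ∈ symbolFiltration D (n - 1) y → a = 0) ∧
      (∀ n, ∀ y ∈ U, ∀ v ∈ symbolFiltration D n y,
        ∃ a, s n y a - v ∈ symbolFiltration D (n - 1) y) ∧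
      ∀ i j, ∀ y ∈ U, ∀ (a : 𝔫 i) (b : 𝔫 j) (O : Set M) (_ : IsOpen O) (_ : y ∈ O)
        (ξ η : ∀ y : M, TangentSpace I y), IsSectionOn (symbolFiltration D i) O ξ →
        IsSectionOn (symbolFiltration D j) O η → s i y a - ξ y ∈ symbolFiltration D (i - 1) y →
        s j y b - η y ∈ symbolFiltration D (j - 1) y →
        VectorField.mlieBracket I ξ η y ∈ symbolFiltration D (i + j) y ∧
        s (i + j) y ⟨⁅(a : L), (b : L)⁆, hlie i j a a.2 b b.2⟩ - VectorField.mlieBracket I ξ η y ∈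
          symbolFiltration D (i + j - 1) y) :
    HasLocallyTrivialSymbol D 𝔫 := by
  intro x
  obtain ⟨U, hU, hxU, s, hsec, hker, hsurj, hbr⟩ := hs x
  let l : ∀ (n : ℕ) (y : U), 𝔫 n →ₗ[𝕜] SymbolGr D n (y : M) := fun n y =>
    (Submodule.mkQ _).comp ((s n y).codRestrict _ fun a => (hsec n a).2 y y.2)
  have hl : ∀ n (y : U) a, l n y a = symbolClass D n y (s n y a) ((hsec n a).2 y y.2) :=
    fun n y a => rfl
  have hl_eq : ∀ n (y : U) a v hv, l n y a = symbolClass D n (y : M) v hv ↔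
      s n y a - v ∈ symbolFiltration D (n - 1) (y : M) := fun n y a v hv => by
    rw [hl, symbolClass_eq_iff]
  have hbij : ∀ n y, Function.Bijective (l n y) := by
    refine fun n y => ⟨(injective_iff_map_eq_zero _).2 fun a ha => ?_, fun c => ?_⟩
    · have := (hl_eq n y a 0 (Submodule.zero_mem _)).1 ha
      rw [sub_zero] at this
      exact hker n y y.2 a this
    · obtain ⟨⟨v, hv⟩, rfl⟩ := Submodule.Quotient.mk_surjective _ c
      obtain ⟨a, ha⟩ := hsurj n y y.2 v hv
      exact ⟨a, (hl_eq n y a v hv).2 ha⟩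
  let φ : ∀ (n : ℕ) (y : U), 𝔫 n ≃ₗ[𝕜] SymbolGr D n (y : M) := fun n y =>
    LinearEquiv.ofBijective (l n y) (hbij n y)
  have hφ : ∀ n y a, φ n y a = l n y a := fun n y a => rfl
  let β : ∀ i j, 𝔫 i →ₗ[𝕜] 𝔫 j →ₗ[𝕜] 𝔫 (i + j) := fun i j =>
    LinearMap.mk₂ 𝕜 (fun a b => ⟨⁅(a : L), (b : L)⁆, hlie i j a a.2 b b.2⟩)
      (fun a a' b => Subtype.ext (add_lie (a : L) (a' : L) (b : L)))
      (fun c a b => Subtype.ext (smul_lie c (a : L) (b : L)))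
      (fun a b b' => Subtype.ext (lie_add (a : L) (b : L) (b' : L)))
      (fun c a b => Subtype.ext (lie_smul c (a : L) (b : L)))
  clear_value φ
  have hB : ∀ (y : U) i j (a : 𝔫 i) (b : 𝔫 j),
      (((β i j).compl₁₂ (φ i y).symm.toLinearMap (φ j y).symm.toLinearMap).compr₂
        (φ (i + j) y).toLinearMap) (φ i y a) (φ j y b) = φ (i + j) y (β i j a b) := by
    intro y i j a b
    simp only [LinearMap.compr₂_apply, LinearMap.compl₁₂_apply, LinearEquiv.coe_coe,
      LinearEquiv.symm_apply_apply]
  refine ⟨U, hU, hxU, φ, fun n a => ⟨fun y => s n y a, hsec n a, fun y => hφ n y a⟩, fun y =>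
    ⟨fun i j => ((β i j).compl₁₂ (φ i y).symm.toLinearMap (φ j y).symm.toLinearMap).compr₂
      (φ (i + j) y).toLinearMap, ?_, fun i j a b => ⟨hlie i j a a.2 b b.2, (hB y i j a b).symm⟩⟩⟩
  intro i j O hO hyO ξ η hξ hη
  -- The symbol bracket must be tested on arbitrary sections; their classes come from `a` and `b`,
  -- and the frame hypothesis covers all sections with those classes.
  obtain ⟨a, ha⟩ := (φ i y).surjective (symbolClass D i y (ξ y) (hξ.2 y hyO))
  obtain ⟨b, hb⟩ := (φ j y).surjective (symbolClass D j y (η y) (hη.2 y hyO))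
  have ha' := ha
  have hb' := hb
  rw [hφ, hl_eq] at ha' hb'
  obtain ⟨hm, hm'⟩ := hbr i j y y.2 a b O hO hyO ξ η hξ hη ha' hb'
  refine ⟨hm, ?_⟩
  rw [← ha, ← hb, hB, hφ, hl_eq]
  exact hm'

end SymbolClass

/-! ### The symbol algebra of the flag distribution and its invariance. -/

section FlagSymbol

variable {𝕜 : Type*} [RCLike 𝕜]
  {E : Type*} [NormedAddCommGroup E] [NormedSpace 𝕜 E] [FiniteDimensional 𝕜 E] [CompleteSpace E]
  {G : Type*} [TopologicalSpace G] [ChartedSpace E G] [Group G] [LieGroup 𝓘(𝕜, E) ∞ G]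
  {k : ℕ} {𝔤 : KGrading 𝕜 (GroupLieAlgebra 𝓘(𝕜, E) G) k}

variable (𝔤) in
/-- The inclusion of the component of degree `-n` of `𝔤₋` into the model space. -/
def negInclusion (n : ℕ) : 𝔤.negComp n →ₗ[𝕜] E :=
  𝔤.neg.toSubmodule.subtype.comp (𝔤.negComp n).subtype

theorem negInclusion_mem {n : ℕ} (a : 𝔤.negComp n) : negInclusion 𝔤 n a ∈ modelComp 𝔤 (-n) := a.2

theorem negInclusion_mem_modelFilt {n : ℕ} (a : 𝔤.negComp n) :
    negInclusion 𝔤 n a ∈ modelFilt 𝔤 (-n) := modelComp_le_modelFilt _ (negInclusion_mem a)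

theorem negInclusion_injective (n : ℕ) : Function.Injective (negInclusion 𝔤 n) :=
  fun _ _ hab => Subtype.ext (Subtype.ext hab)

/-- Degree zero meets 𝔤₋ trivially, matching the vanishing of the symbol algebra in degree 0. -/
theorem eq_zero_of_mem_negComp_zero (c : 𝔤.negComp 0) : c = 0 := by
  apply negInclusion_injective 0
  rw [map_zero]
  exact Submodule.disjoint_def.1 (isCompl_modelFilt_modelLow 𝔤 0).disjoint _
    (negInclusion_mem_modelFilt (n := 0) c) (c : 𝔤.neg).2

theorem exists_negInclusion_eq {n : ℕ} {X : E} (hX : X ∈ modelComp 𝔤 (-(n + 1 : ℕ))) :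
    ∃ a, negInclusion 𝔤 (n + 1) a = X :=
  ⟨⟨⟨X, 𝔤.comp_le_neg (by push_cast; omega) hX⟩, hX⟩, rfl⟩

theorem lie_mem_negComp {i j : ℕ} (a : 𝔤.negComp i) (b : 𝔤.negComp j) :
    ⁅(a : 𝔤.neg), (b : 𝔤.neg)⁆ ∈ 𝔤.negComp (i + j) := by
  have := 𝔤.lie_mem _ _ _ _ a.2 b.2
  change _ ∈ 𝔤.comp (-((i + j : ℕ) : ℤ))
  rwa [show (-((i + j : ℕ) : ℤ)) = -i + -j by push_cast; ring]

variable (𝔤) in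
/-- The bracket of `𝔤₋` as a family of bilinear maps between its components. -/
def negBracket (i j : ℕ) : 𝔤.negComp i →ₗ[𝕜] 𝔤.negComp j →ₗ[𝕜] 𝔤.negComp (i + j) :=
  LinearMap.mk₂ 𝕜 (fun a b => ⟨⁅(a : 𝔤.neg), (b : 𝔤.neg)⁆, lie_mem_negComp a b⟩)
    (fun a a' b => Subtype.ext (add_lie (a : 𝔤.neg) (a' : 𝔤.neg) (b : 𝔤.neg)))
    (fun c a b => Subtype.ext (smul_lie c (a : 𝔤.neg) (b : 𝔤.neg)))
    (fun a b b' => Subtype.ext (lie_add (a : 𝔤.neg) (b : 𝔤.neg) (b' : 𝔤.neg)))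
    (fun c a b => Subtype.ext (lie_smul c (a : 𝔤.neg) (b : 𝔤.neg)))

theorem negInclusion_negBracket {i j : ℕ} (a : 𝔤.negComp i) (b : 𝔤.negComp j) :
    negInclusion 𝔤 (i + j) (negBracket 𝔤 i j a b) =
      modelBracket 𝕜 E G (negInclusion 𝔤 i a) (negInclusion 𝔤 j b) := rfl

variable [ChartedSpace (FlagModel 𝔤) (FlagManifold 𝔤)]
  [IsManifold 𝓘(𝕜, FlagModel 𝔤) ∞ (FlagManifold 𝔤)]
  [LieAlgebra.IsSemisimple 𝕜 (GroupLieAlgebra 𝓘(𝕜, E) G)] (h : IsHomogeneousStructure 𝔤)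

include h

theorem mem_symbolFiltration_iff {n : ℕ} {x : FlagManifold 𝔤} {v : FlagModel 𝔤} :
    v ∈ symbolFiltration (flagTangent 𝔤 1) n x ↔ v ∈ flagDist 𝔤 n x := by
  rw [symbolFiltration_flagTangent h]
  rfl

theorem flagDeriv_sub_mem_symbolFiltration_iff {n : ℕ} {x : FlagManifold 𝔤} {g : G}
    (hg : QuotientGroup.mk g = x) {A : E} {v : FlagModel 𝔤} :
    flagDeriv 𝔤 g A - v ∈ symbolFiltration (flagTangent 𝔤 1) n x ↔
      ∃ R ∈ modelFilt 𝔤 (-n), flagDeriv 𝔤 g (A + R) = v := by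
  refine (mem_symbolFiltration_iff h).trans ((mem_flagDist_iff h hg).trans ?_)
  constructor
  · rintro ⟨R, hR, hRv⟩
    exact ⟨-R, neg_mem hR, by rw [map_add, map_neg, hRv]; abel⟩
  · rintro ⟨R, hR, rfl⟩
    exact ⟨-R, neg_mem hR, by rw [map_neg, map_add]; abel⟩

/-- Injectivity of 𝔤₋ₙ → gr₋ₙ: the kernel 𝔤⁰ of the projection is absorbed into 𝔤⁻ⁿ⁺¹, which meets
𝔤₋ₙ only in 0. For n = 0 the truncated `n - 1` is harmless as the source is zero. -/
theorem eq_zero_of_flagDeriv_mem_flagDist {n : ℕ} {x : FlagManifold 𝔤} {g : G}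
    (hg : QuotientGroup.mk g = x) {a : 𝔤.negComp n}
    (ha : flagDeriv 𝔤 g (negInclusion 𝔤 n a) ∈ flagDist 𝔤 (n - 1) x) : a = 0 := by
  rcases n with _ | n
  · exact eq_zero_of_mem_negComp_zero a
  obtain ⟨R, hR, hRa⟩ := (mem_flagDist_iff h hg).1 ha
  have h1 : negInclusion 𝔤 (n + 1) a - R ∈ modelFilt 𝔤 0 := by
    rw [← flagDeriv_eq_zero_iff h g, map_sub, hRa, sub_self]
  apply negInclusion_injective
  rw [map_zero]
  refine eq_zero_of_mem_modelComp (j := -(n : ℤ)) (by push_cast; omega) (negInclusion_mem a) ?_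
  have h2 := add_mem (modelFilt_antitone 𝔤 (i := -(n : ℤ)) (by omega) h1) hR
  rwa [sub_add_cancel] at h2

theorem exists_flagDeriv_negInclusion_add {n : ℕ} {x : FlagManifold 𝔤} {g : G}
    (hg : QuotientGroup.mk g = x) {v : FlagModel 𝔤} (hv : v ∈ flagDist 𝔤 n x) :
    ∃ a : 𝔤.negComp n, ∃ R ∈ modelFilt 𝔤 (-(n - 1 : ℕ)),
      flagDeriv 𝔤 g (negInclusion 𝔤 n a + R) = v := by
  obtain ⟨X, hX, rfl⟩ := (mem_flagDist_iff h hg).1 hv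
  rcases n with _ | n
  · exact ⟨0, X, hX, by rw [map_zero, zero_add]⟩
  · obtain ⟨Y, hY, Z, hZ, rfl⟩ := exists_add_of_mem_modelFilt hX
    obtain ⟨a, rfl⟩ := exists_negInclusion_eq hY
    refine ⟨a, Z, ?_, rfl⟩
    rwa [show (-((n + 1 : ℕ) : ℤ) + 1) = -((n + 1 - 1 : ℕ) : ℤ) by push_cast; simp] at hZ

/-- The bracket of vector fields is given by the algebraic bracket up to terms of higher degree. -/
theorem exists_fieldBracket_eq_negBracket {i j : ℕ} {U : Set (FlagManifold 𝔤)} (hU : IsOpen U)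
    {ξ η : FlagManifold 𝔤 → FlagModel 𝔤} (hξ : IsFlagSection i U ξ) (hη : IsFlagSection j U η)
    {x : FlagManifold 𝔤} (hx : x ∈ U) {g : G} (hg : QuotientGroup.mk g = x)
    {a : 𝔤.negComp i} {b : 𝔤.negComp j}
    (ha : ∃ R ∈ modelFilt 𝔤 (-(i - 1 : ℕ)), flagDeriv 𝔤 g (negInclusion 𝔤 i a + R) = ξ x)
    (hb : ∃ R ∈ modelFilt 𝔤 (-(j - 1 : ℕ)), flagDeriv 𝔤 g (negInclusion 𝔤 j b + R) = η x) :
    fieldBracket 𝕜 ξ η x ∈ flagDist 𝔤 (i + j) x ∧ ∃ R ∈ modelFilt 𝔤 (-(i + j - 1 : ℕ)),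
      flagDeriv 𝔤 g (negInclusion 𝔤 (i + j) (negBracket 𝔤 i j a b) + R) =
        fieldBracket 𝕜 ξ η x := by
  have hzero : ∀ ζ : FlagManifold 𝔤 → FlagModel 𝔤, IsFlagSection 0 U ζ → ζ =ᶠ[𝓝 x] fun _ => 0 := by
    intro ζ hζ
    filter_upwards [hU.mem_nhds hx] with y hy
    have := hζ.mem y hy
    rwa [flagDist_zero h, Submodule.mem_bot] at this
  have htriv : fieldBracket 𝕜 ξ η x = 0 → negBracket 𝔤 i j a b = 0 →
      fieldBracket 𝕜 ξ η x ∈ flagDist 𝔤 (i + j) x ∧ ∃ R ∈ modelFilt 𝔤 (-(i + j - 1 : ℕ)),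
        flagDeriv 𝔤 g (negInclusion 𝔤 (i + j) (negBracket 𝔤 i j a b) + R) =
          fieldBracket 𝕜 ξ η x := by
    intro h1 h2
    refine ⟨by rw [h1]; exact zero_mem _, 0, zero_mem _, ?_⟩
    rw [h1, h2, map_zero, add_zero, map_zero]
  -- The bracket formula needs both degrees positive. In degree 0 sections vanish near `x`, so both
  -- brackets are zero.
  rcases i with _ | i
  · refine htriv ?_ (by rw [eq_zero_of_mem_negComp_zero a, map_zero]; rfl)
    rw [fieldBracket_congr (hzero ξ hξ) (Filter.EventuallyEq.refl _ η), fieldBracket_zero_left]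
  rcases j with _ | j
  · refine htriv ?_ (by rw [eq_zero_of_mem_negComp_zero b, map_zero])
    rw [fieldBracket_congr (Filter.EventuallyEq.refl _ ξ) (hzero η hη), fieldBracket_zero_right]
  obtain ⟨R, hR, hRξ⟩ := ha
  obtain ⟨S, hS, hSη⟩ := hb
  have hR' : R ∈ modelFilt 𝔤 (-i) := hR
  have hS' : S ∈ modelFilt 𝔤 (-j) := hS
  have ha' := negInclusion_mem_modelFilt a
  have hb' := negInclusion_mem_modelFilt b
  obtain ⟨Q, hQ, hbr⟩ := hξ.exists_fieldBracket_eq h hU hη hg hx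
    (add_mem ha' (modelFilt_antitone 𝔤 (by push_cast; omega) hR')) hRξ hSη
  have hm := (hξ.fieldBracket h hU hη).mem x hx
  rw [show i + j + 2 = i + 1 + (j + 1) by ring] at hm
  refine ⟨hm, ?_⟩
  rw [negInclusion_negBracket]
  set A := negInclusion 𝔤 (i + 1) a
  set B := negInclusion 𝔤 (j + 1) b
  -- Changing `A`, `B` within their classes alters the bracket only in degrees at least −(i+j+1),
  -- one step above the leading degree.
  have hexp : modelBracket 𝕜 E G (A + R) (B + S) =
      modelBracket 𝕜 E G A B + (modelBracket 𝕜 E G R (B + S) + modelBracket 𝕜 E G A S) := by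
    have h1 := modelBracket_sub_left (𝕜 := 𝕜) (G := G) (A + R) A (B + S)
    have h2 := modelBracket_sub_right (𝕜 := 𝕜) (G := G) A (B + S) B
    rw [add_sub_cancel_left] at h1 h2
    rw [h1, h2]
    abel
  refine ⟨modelBracket 𝕜 E G R (B + S) + modelBracket 𝕜 E G A S + Q, ?_, ?_⟩
  · refine add_mem (add_mem ?_ ?_) ?_
    · exact modelFilt_antitone 𝔤 (by push_cast; omega) (modelBracket_mem_modelFilt 𝔤 hR'
        (add_mem hb' (modelFilt_antitone 𝔤 (by push_cast; omega) hS')))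
    · exact modelFilt_antitone 𝔤 (by push_cast; omega) (modelBracket_mem_modelFilt 𝔤 ha' hS')
    · exact modelFilt_antitone 𝔤 (by push_cast; omega) hQ
  · rw [hbr, hexp, ← add_assoc]

theorem isFlagSection_of_isSectionOn {n : ℕ} {U : Set (FlagManifold 𝔤)}
    {ξ : FlagManifold 𝔤 → FlagModel 𝔤}
    (hξ : IsSectionOn (symbolFiltration (flagTangent 𝔤 1) n) U ξ) : IsFlagSection n U ξ :=
  ⟨hξ.1, fun y hy => (mem_symbolFiltration_iff h).1 (hξ.2 y hy)⟩

theorem hasLocallyTrivialSymbol_flagTangent :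
    HasLocallyTrivialSymbol (flagTangent 𝔤 1) 𝔤.negComp := by
  refine hasLocallyTrivialSymbol_of_frames
    (fun i j a ha b hb => lie_mem_negComp (⟨a, ha⟩ : 𝔤.negComp i) (⟨b, hb⟩ : 𝔤.negComp j))
    fun x => ?_
  obtain ⟨U, σ, hU, hxU, hσ, hpσ⟩ := exists_flag_local_section h x
  refine ⟨U, hU, hxU, fun n y => (flagDeriv 𝔤 (σ y)).toLinearMap.comp (negInclusion 𝔤 n),
    fun n a => ?_, fun n y hy a ha => ?_, fun n y hy v hv => ?_, ?_⟩
  · have hs := isFlagSection_flagDeriv h hσ hpσ (negInclusion_mem_modelFilt a)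
    exact ⟨hs.1, fun y hy => (mem_symbolFiltration_iff h).2 (hs.2 y hy)⟩
  · exact eq_zero_of_flagDeriv_mem_flagDist h (hpσ y hy) ((mem_symbolFiltration_iff h).1 ha)
  · obtain ⟨a, ha⟩ := exists_flagDeriv_negInclusion_add h (hpσ y hy)
      ((mem_symbolFiltration_iff h).1 hv)
    exact ⟨a, (flagDeriv_sub_mem_symbolFiltration_iff h (hpσ y hy)).2 ha⟩
  · intro i j y hy a b O hO hyO ξ η hξ hη ha hb
    obtain ⟨hm, hR⟩ := exists_fieldBracket_eq_negBracket h hO (isFlagSection_of_isSectionOn h hξ)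
      (isFlagSection_of_isSectionOn h hη) hyO (hpσ y hy)
      ((flagDeriv_sub_mem_symbolFiltration_iff h (hpσ y hy)).1 ha)
      ((flagDeriv_sub_mem_symbolFiltration_iff h (hpσ y hy)).1 hb)
    exact ⟨(mem_symbolFiltration_iff h).2 hm,
      (flagDeriv_sub_mem_symbolFiltration_iff h (hpσ y hy)).2 hR⟩

/-- Left translation leaves the left trivialization unchanged, so the same `X` represents a vector
and its translate. -/
theorem map_modelDeriv_smul_flagDist (n : ℕ) (g : G) (x : FlagManifold 𝔤) :
    (flagDist 𝔤 n x).map (modelDeriv 𝕜 (FlagModel 𝔤) (FlagModel 𝔤)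
      (fun x : FlagManifold 𝔤 => g • x) x).toLinearMap = flagDist 𝔤 n (g • x) := by
  obtain ⟨a, rfl⟩ := QuotientGroup.mk_surjective x
  have key := modelDeriv_smul_quotientDeriv h.isSubmersion_mk g a
  have hga : (QuotientGroup.mk (g * a) : FlagManifold 𝔤) = g • QuotientGroup.mk a := rfl
  ext v
  rw [mem_flagDist_iff h hga, Submodule.mem_map]
  constructor
  · rintro ⟨w, hw, rfl⟩
    obtain ⟨X, hX, rfl⟩ := (mem_flagDist_iff h rfl).1 hw
    exact ⟨X, hX, (key X).symm⟩
  · rintro ⟨X, hX, rfl⟩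
    exact ⟨_, flagDeriv_mem_flagDist h rfl hX, key X⟩

end FlagSymbol

end

/-! ### Assembly of the theorem. -/

theorem mainTheorem8 {𝕜 : Type*} [RCLike 𝕜]
    {E : Type*} [NormedAddCommGroup E] [NormedSpace 𝕜 E] [FiniteDimensional 𝕜 E] [CompleteSpace E]
    {G : Type*} [TopologicalSpace G] [ChartedSpace E G] [Group G] [LieGroup 𝓘(𝕜, E) ∞ G]
    [LieAlgebra.IsSemisimple 𝕜 (GroupLieAlgebra 𝓘(𝕜, E) G)]
    {k : ℕ} (hk : 0 < k) (𝔤 : KGrading 𝕜 (GroupLieAlgebra 𝓘(𝕜, E) G) k) :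
    T2Space (FlagManifold 𝔤) ∧
    (∃ _ : ChartedSpace (FlagModel 𝔤) (FlagManifold 𝔤), IsHomogeneousStructure 𝔤) ∧
    ∀ [ChartedSpace (FlagModel 𝔤) (FlagManifold 𝔤)]
      [IsManifold 𝓘(𝕜, FlagModel 𝔤) ∞ (FlagManifold 𝔤)], IsHomogeneousStructure 𝔤 →
      ∃ D : TangentSubspaces 𝓘(𝕜, FlagModel 𝔤) (FlagManifold 𝔤),
        (∀ g : G, (D (flagProj 𝔤 g) : Set (TangentSpace 𝓘(𝕜, FlagModel 𝔤) (flagProj 𝔤 g))) =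
          {v | ∃ X ∈ 𝔤.filt (-1), v = mfderiv 𝓘(𝕜, E) 𝓘(𝕜, FlagModel 𝔤) (flagProj 𝔤) g
            (mulInvariantVectorField (I := 𝓘(𝕜, E)) X g)}) ∧
        IsSmoothSubbundle D (Module.finrank 𝕜 (𝔤.comp (-1))) ∧
        IsBracketGenerating D ∧
        IsRegularOfDepth D k ∧
        HasLocallyTrivialSymbol D 𝔤.negComp ∧
        ∀ g : G,
          ContMDiff 𝓘(𝕜, FlagModel 𝔤) 𝓘(𝕜, FlagModel 𝔤) ∞ (fun x : FlagManifold 𝔤 => g • x) ∧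
          ∀ x : FlagManifold 𝔤,
            (D x).map (mfderiv 𝓘(𝕜, FlagModel 𝔤) 𝓘(𝕜, FlagModel 𝔤)
              (fun x : FlagManifold 𝔤 => g • x) x).toLinearMap = D (g • x) := by
  refine ⟨t2Space_flagManifold 𝔤, exists_isHomogeneousStructure 𝔤, fun h => ?_⟩
  refine ⟨flagTangent 𝔤 1, fun g => ?_, isSmoothSubbundle_flagTangent_one h,
    isBracketGenerating_flagTangent h, isRegularOfDepth_flagTangent h,
    hasLocallyTrivialSymbol_flagTangent h, fun g =>
    ⟨contMDiff_quotient_smul h.isSubmersion_mk g, fun x => map_modelDeriv_smul_flagDist h 1 g x⟩⟩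
  -- The fibre over gP is described with the given `g`, not the chosen representative, by
  -- `mem_flagDist_iff`.
  ext v
  refine (mem_flagDist_iff h (n := 1) rfl).trans ?_
  exact ⟨fun ⟨X, hX, hv⟩ => ⟨X, hX, hv.symm⟩, fun ⟨X, hX, hv⟩ => ⟨X, hX, hv.symm⟩⟩
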